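/- Let $k$ be an algebraically closed field of characteristic $0$. A variety is a reduced separated scheme of finite type over $k$, and all morphisms are over $k$. Let $H$ be a linear algebraic group over $k$ acting on an irreducible variety $X$, with a linearisation on a line bundle $L\to X$. Notation. Let $S^H=\bigoplus_{m\ge 0}H^0(X,L^{\otimes m})^H$ be the graded ring of invariant sections. For a homogeneous $f\in S^H$ of positive degree let $X_f\subseteq X$ be the open set where $f\neq 0$, and let $(S^H)_{(f)}$ be the degree $0$ part of the localisation $(S^H)_f$. Let $I^{\mathrm{ss,fg}}$ be the set of all $f\in\bigcup_{m>0}H^0(X,L^{\otimes m})^H$ such that $(S^H)_{(f)}$ is a finitely generated $k$-algebra, let $X^{\mathrm{ss,fg}}=\bigcup_{f\in I^{\mathrm{ss,fg}}}X_f$, and let the enveloping quotient be the open subscheme $X/\!\!/_{\mathrm{env}}H=\bigcup_{f\in I^{\mathrm{ss,fg}}}\operatorname{Spec}\,(S^H)_{(f)}$ of $\operatorname{Proj}S^H$. Let $q:X^{\mathrm{ss,fg}}\to X/\!\!/_{\mathrm{env}}H$ be the canonical morphism, given on $X_f$ by the natural ring homomorphism $(S^H)_{(f)}\to\mathcal O(X_f)$.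 For a nonempty $H$-invariant open $U\subseteq X^{\mathrm{ss,fg}}$, an inner enveloping quotient of $U$ is a quasi-compact open subscheme of $X/\!\!/_{\mathrm{env}}H$ that contains $q(U)$. For an open $\mathcal U\subseteq\operatorname{Proj}S^H$ let $\mathcal O_{\mathcal U}(r)$ be the restriction to $\mathcal U$ of the twisting sheaf $\mathcal O(r)$. Let $\mathcal S\subseteq I^{\mathrm{ss,fg}}$ be a subset such that $U=\bigcup_{f\in\mathcal S}X_f$ is nonempty. Let $Z$ be a quasi-projective variety with a very ample line bundle $M\to Z$ (that is, $M$ is the pullback of $\mathcal O(1)$ along a locally closed immersion of $Z$ in some $\mathbb P^n$), let $\phi:U\to Z$ be an $H$-invariant morphism, let $r>0$, and suppose that $\phi^*M\cong L^{\otimes r}|_U$ as $H$-linearised line bundles, where $\phi^*M$ carries the pulled back linearisation, for which the pullbacks $\phi^*m$ of local sections $m$ of $M$ are $H$-invariant. Then: 1. there are an inner enveloping quotient $\mathcal U$ of $U$ and a morphism $\overline\phi:\mathcal U\to Z$ such that $\phi=\overline\phi\circ q|_U$ and $\overline\phi^*M\cong\mathcal O_{\mathcal U}(r)$; 2. if $\mathcal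 U$ and $\mathcal U'$ are two inner enveloping quotients of $U$, and $\psi:\mathcal U\to Z$ and $\psi':\mathcal U'\to Z$ are morphisms with $\psi\circ q|_U=\psi'\circ q|_U$, then $\psi=\psi'$ on $\mathcal U\cap\mathcal U'$. -/

import Mathlib

open CategoryTheory AlgebraicGeometry TopologicalSpace Opposite

universe u

namespace EnvQuot

noncomputable section

section
/-- A local condition on families `(s x)`, `x ∈ V`, of elements of given `𝒪_{X,x}`-modules `E x`,
stable under addition and under multiplication by functions. It cuts out a sheaf of `𝒪_X`-modules. -/
structure StalkPredicate (X : Scheme.{u}) (E : X → Type u) [∀ x, AddCommGroup (E x)]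
    [∀ x, Module (X.presheaf.stalk x) (E x)] extends TopCat.LocalPredicate (X := X.toTopCat) E where
  zero_mem : ∀ V : X.Opens, pred (U := V) fun _ => 0
  add_mem : ∀ (V : X.Opens) (s t : ∀ x : V, E x), pred s → pred t → pred fun x => s x + t x
  smul_mem : ∀ (V : X.Opens) (f : Γ(X, V)) (s : ∀ x : V, E x), pred s →
    pred fun x => X.presheaf.germ V x.1 x.2 f • s x

variable {X : Scheme.{u}} {E : X → Type u} [∀ x, AddCommGroup (E x)]
    [∀ x, Module (X.presheaf.stalk x) (E x)]

/-- The families over `V` that satisfy the condition. -/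
def StalkPredicate.sections (P : StalkPredicate X E) (V : X.Opens) :
    AddSubgroup (∀ x : V, E x) where
  carrier := {s | P.pred s}
  zero_mem' := P.zero_mem V
  add_mem' := P.add_mem V _ _
  neg_mem' {s} hs := by
    have := P.smul_mem V (-1) s hs
    simp only [map_neg, map_one, neg_smul, one_smul] at this
    exact this

instance instModuleSections (P : StalkPredicate X E) (V : X.Opens) : Module Γ(X, V) (P.sections V) where
  smul f s := ⟨fun x => X.presheaf.germ V x.1 x.2 f • s.1 x, P.smul_mem V f s.1 s.2⟩
  one_smul s := by
    apply Subtype.ext; funext x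
    change X.presheaf.germ V x.1 x.2 1 • s.1 x = _
    rw [map_one, one_smul]
  mul_smul f g s := by
    apply Subtype.ext; funext x
    change X.presheaf.germ V x.1 x.2 (f * g) • s.1 x = X.presheaf.germ V x.1 x.2 f • X.presheaf.germ V x.1 x.2 g • s.1 x
    rw [map_mul, mul_smul]
  smul_zero f := by
    apply Subtype.ext; funext x
    exact smul_zero _
  smul_add f s t := by
    apply Subtype.ext; funext x
    exact smul_add _ _ _
  add_smul f g s := by
    apply Subtype.ext; funext x
    change X.presheaf.germ V x.1 x.2 (f + g) • s.1 x = X.presheaf.germ V x.1 x.2 f • s.1 x + X.presheaf.germ V x.1 x.2 g • s.1 x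
    rw [map_add, add_smul]
  zero_smul s := by
    apply Subtype.ext; funext x
    change X.presheaf.germ V x.1 x.2 0 • s.1 x = 0
    rw [map_zero, zero_smul]

/-- The sections with their restriction maps, as a presheaf of abelian groups. -/
def StalkPredicate.presheaf (P : StalkPredicate X E) : TopCat.Presheaf Ab X.toTopCat where
  obj V := AddCommGrpCat.of (P.sections V.unop)
  map {V W} i := AddCommGrpCat.ofHom
    { toFun s := ⟨fun x => s.1 ⟨x.1, i.unop.le x.2⟩, P.res i.unop _ s.2⟩
      map_zero' := rfl
      map_add' _ _ := rfl }

lemma StalkPredicate.isSheaf (P : StalkPredicate X E) :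
    TopCat.Presheaf.IsSheaf P.presheaf :=
  (TopCat.Presheaf.isSheaf_iff_isSheaf_comp (forget AddCommGrpCat) _).2
    (TopCat.subsheafToTypes P.toLocalPredicate).2

/-- The sheaf of `𝒪_X`-modules of families that satisfy the condition. -/
def StalkPredicate.toModules (P : StalkPredicate X E) : X.Modules where
  val :=
    letI (V : (X.Opens)ᵒᵖ) : Module (X.ringCatSheaf.obj.obj V) (P.presheaf.obj V) :=
      inferInstanceAs (Module Γ(X, V.unop) (P.sections V.unop))
    .ofPresheaf P.presheaf fun V W i r m => by
      apply Subtype.ext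
      funext x
      exact congrArg (· • (m.1 ⟨x.1, i.unop.le x.2⟩ : E x.1))
        (X.presheaf.germ_res_apply' i x.1 x.2 r).symm
  isSheaf := P.isSheaf

/-- The stalk of an `𝒪_X`-module is a module over the local ring. -/
instance instModuleStalk (L : X.Modules) (x : X) : Module (X.presheaf.stalk x) (L.presheaf.stalk x) :=
  PresheafOfModules.instModuleCarrierStalkCommRingCatCarrierAbPresheafOpensCarrier
    (R := X.presheaf) L.val x

lemma germ_smul (L : X.Modules) (x : X) (U : X.Opens) (hx : x ∈ U) (r : Γ(X, U)) (m : Γ(L, U)) :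
    L.presheaf.germ U x hx (r • m) = X.presheaf.germ U x hx r • L.presheaf.germ U x hx m :=
  PresheafOfModules.germ_smul (R := X.presheaf) L.val x U hx r m

lemma exists_germ_pair (L : X.Modules) (x : X) (c : X.presheaf.stalk x)
    (m : L.presheaf.stalk x) : ∃ (V : X.Opens) (hV : x ∈ V) (c' : Γ(X, V)) (m' : Γ(L, V)),
      X.presheaf.germ V x hV c' = c ∧ L.presheaf.germ V x hV m' = m := by
  obtain ⟨V, hV, c, rfl⟩ := X.presheaf.exists_germ_eq c
  obtain ⟨W, hW, m, rfl⟩ := TopCat.Presheaf.exists_germ_eq (C := Ab) L.presheaf m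
  have hx : x ∈ V ⊓ W := ⟨hV, hW⟩
  exact ⟨V ⊓ W, hx, _, _,
    X.presheaf.germ_res_apply' (homOfLE (inf_le_left : V ⊓ W ≤ V)).op x hx c,
    L.presheaf.germ_res_apply' (homOfLE (inf_le_right : V ⊓ W ≤ W)).op x hx m⟩

/-- The tensor algebra `⨁_r (L_x)^{⊗ r}` of the stalk of `L` at `x`. -/
abbrev TensorStalk (L : X.Modules) (x : X) : Type u :=
  TensorAlgebra (X.presheaf.stalk x) (L.presheaf.stalk x)

/-- The families of germs `x ↦ c • (m₁ ⊗ ⋯ ⊗ m_r)_x` for `c` a function and `mᵢ` sections of `L`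
over `V`. -/
def pureTensors (L : X.Modules) (r : ℕ) (V : X.Opens) : Set (∀ x : V, TensorStalk L x.1) :=
  {s | ∃ (c : Γ(X, V)) (m : Fin r → Γ(L, V)), ∀ x : V, s x = X.presheaf.germ V x.1 x.2 c •
    (List.ofFn fun i => TensorAlgebra.ι (X.presheaf.stalk x.1)
      (L.presheaf.germ V x.1 x.2 (m i))).prod}

lemma pureTensors_res (L : X.Modules) (r : ℕ) {V W : X.Opens} (i : V ⟶ W)
    (s : ∀ x : W, TensorStalk L x.1) (hs : s ∈ AddSubgroup.closure (pureTensors L r W)) :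
    (fun x : V => s (i x)) ∈ AddSubgroup.closure (pureTensors L r V) := by
  let φ : (∀ x : W, TensorStalk L x.1) →+ (∀ x : V, TensorStalk L x.1) :=
    { toFun s x := s ⟨x.1, i.le x.2⟩, map_zero' := rfl, map_add' _ _ := rfl }
  have : AddSubgroup.closure (pureTensors L r W) ≤
      (AddSubgroup.closure (pureTensors L r V)).comap φ := by
    rw [AddSubgroup.closure_le]
    rintro s ⟨c, m, h⟩
    refine AddSubgroup.subset_closure
      ⟨X.presheaf.map i.op c, fun j => L.presheaf.map i.op (m j), fun x => ?_⟩
    have h1 := X.presheaf.germ_res_apply' i.op x.1 x.2 c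
    have h2 := fun j => L.presheaf.germ_res_apply' i.op x.1 x.2 (m j)
    rw [h1]
    simp only [h2]
    exact h _
  exact this hs

/-- The families of germs that are locally finite sums of products of `r` sections of `L`. -/
def tensorPredicate (L : X.Modules) (r : ℕ) : StalkPredicate X (TensorStalk L) where
  __ := TopCat.PrelocalPredicate.sheafify (X := X.toTopCat) (T := TensorStalk L)
    { pred {V} s := s ∈ AddSubgroup.closure (pureTensors L r V)
      res i s hs := pureTensors_res L r i s hs }
  zero_mem V x := ⟨V, x.2, 𝟙 _, zero_mem _⟩
  add_mem V s t hs ht x := by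
    obtain ⟨V₁, h₁, i₁, hs⟩ := hs x
    obtain ⟨V₂, h₂, i₂, ht⟩ := ht x
    exact ⟨V₁ ⊓ V₂, ⟨h₁, h₂⟩, homOfLE (inf_le_left.trans i₁.le),
      add_mem (pureTensors_res L r (homOfLE inf_le_left) _ hs)
        (pureTensors_res L r (homOfLE inf_le_right) _ ht)⟩
  smul_mem V f s hs x := by
    obtain ⟨W, h, i, hs⟩ := hs x
    refine ⟨W, h, i, ?_⟩
    let φ : (∀ x : W, TensorStalk L x.1) →+ (∀ x : W, TensorStalk L x.1) :=
      { toFun s x := X.presheaf.germ V x.1 (i.le x.2) f • s x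
        map_zero' := funext fun _ => smul_zero _
        map_add' _ _ := funext fun _ => smul_add _ _ _ }
    have : AddSubgroup.closure (pureTensors L r W) ≤
        (AddSubgroup.closure (pureTensors L r W)).comap φ := by
      rw [AddSubgroup.closure_le]
      rintro s ⟨c, m, h⟩
      refine AddSubgroup.subset_closure ⟨X.presheaf.map i.op f * c, m, fun x => ?_⟩
      change X.presheaf.germ V x.1 (i.le x.2) f • s x = _
      rw [h, map_mul, mul_smul, X.presheaf.germ_res_apply' i.op x.1 x.2 f]
    exact this hs

/-- The tensor power `L^{⊗ r}` of an invertible sheaf `L`, realised as the sheaf of those families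
of elements of the tensor algebras of the stalks that are locally sums of products of `r` sections
of `L`. -/
def tensorPow (L : X.Modules) (r : ℕ) : X.Modules := (tensorPredicate L r).toModules

/-- The sections of `L^{⊗ r}` over `V`. -/
abbrev tensorSections (L : X.Modules) (r : ℕ) (V : X.Opens) : AddSubgroup (∀ x : V, TensorStalk L x.1) := (tensorPredicate L r).sections V

section
variable {Y : Scheme.{u}} (f : Y ⟶ X) {L : X.Modules} {N : Y.Modules} (ψ : L ⟶ (Scheme.Modules.pushforward f).obj N) (y : Y)

/-- The map on stalks `L_{f y} → N_y` induced by a homomorphism `L → f_* N`. -/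
def stalkHom : L.presheaf.stalk (f y) ⟶ N.presheaf.stalk y :=
  (TopCat.Presheaf.stalkFunctor Ab (f y)).map ψ.mapPresheaf ≫ N.presheaf.stalkPushforward Ab f.base y

lemma stalkHom_germ (V : X.Opens) (hy : f y ∈ V) (m : Γ(L, V)) :
    stalkHom f ψ y (L.presheaf.germ V (f y) hy m) = N.presheaf.germ (f ⁻¹ᵁ V) y hy (ψ.app V m) := by
  have := N.presheaf.stalkPushforward_germ Ab f.base V y hy
  have h2 := TopCat.Presheaf.stalkFunctor_map_germ (C := Ab) V (f y) hy ψ.mapPresheaf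
  have h3 : L.presheaf.germ V (f y) hy ≫ stalkHom f ψ y = ψ.app V ≫ N.presheaf.germ (f ⁻¹ᵁ V) y hy := by
    exact (Category.assoc _ _ _).symm.trans ((congrArg (· ≫ _) h2).trans
      ((Category.assoc _ _ _).trans (congrArg (_ ≫ ·) this)))
  exact congr($h3 m)

lemma stalkHom_smul (c : X.presheaf.stalk (f y)) (m : L.presheaf.stalk (f y)) :
    stalkHom f ψ y (c • m) = f.stalkMap y c • stalkHom f ψ y m := by
  obtain ⟨V, hV, c, m, rfl, rfl⟩ := exists_germ_pair L (f y) c m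
  rw [← germ_smul, stalkHom_germ, stalkHom_germ]
  have h := Scheme.Hom.germ_stalkMap_apply f V y hV c
  refine (congrArg _ (Scheme.Modules.Hom.app_smul ψ c m)).trans
    ((germ_smul N y (f ⁻¹ᵁ V) hV (f.app V c) (ψ.app V m)).trans ?_)
  exact congrArg (· • N.presheaf.germ (f ⁻¹ᵁ V) y hV (ψ.app V m)) h.symm
end

end

section
variable {X : Scheme.{u}}

/-- The section `e` of `L` over `U` is a basis of `L|_U`, that is, `f ↦ f e` is an isomorphism
`𝒪_U → L|_U`. -/
def IsFrame (L : X.Modules) {U : X.Opens} (e : Γ(L, U)) : Prop :=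
  ∀ (V : X.Opens) (h : V ≤ U), Function.Bijective fun f : Γ(X, V) =>
    f • (L.presheaf.map (homOfLE h).op e : Γ(L, V))

/-- `L` is an invertible sheaf (the sheaf of sections of a line bundle): it is locally free of
rank one. -/
class IsInvertible (L : X.Modules) : Prop where
  exists_frame (x : X) : ∃ U : X.Opens, x ∈ U ∧ ∃ e : Γ(L, U), IsFrame L e

variable {L : X.Modules}

lemma IsFrame.bijective {U : X.Opens} {e : Γ(L, U)} (he : IsFrame L e) (x : X) (hx : x ∈ U) :
    Function.Bijective fun c : X.presheaf.stalk x => c • L.presheaf.germ U x hx e := by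
  constructor
  · refine (injective_iff_map_eq_zero
      (LinearMap.toSpanSingleton (X.presheaf.stalk x) _ (L.presheaf.germ U x hx e))).2 fun c hc => ?_
    change c • L.presheaf.germ U x hx e = 0 at hc
    obtain ⟨V, hV, c, rfl⟩ := X.presheaf.exists_germ_eq c
    have hxW : x ∈ V ⊓ U := ⟨hV, hx⟩
    rw [← X.presheaf.germ_res_apply' (homOfLE (inf_le_left : V ⊓ U ≤ V)).op x hxW c] at hc ⊢
    set c' := X.presheaf.map (homOfLE (inf_le_left : V ⊓ U ≤ V)).op c
    have h2 := L.presheaf.germ_res_apply' (homOfLE (inf_le_right : V ⊓ U ≤ U)).op x hxW e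
    have h3 : L.presheaf.germ (V ⊓ U) x hxW (c' • (L.presheaf.map (homOfLE inf_le_right).op e : Γ(L, V ⊓ U))) = L.presheaf.germ (V ⊓ U) x hxW 0 := by
      rw [germ_smul, map_zero, h2]
      exact hc
    obtain ⟨W, hW, i, j, h4⟩ := TopCat.Presheaf.germ_eq (C := Ab) L.presheaf x hxW hxW _ _ h3
    have h5 : X.presheaf.map i.op c' = 0 := by
      apply (he W (i.le.trans inf_le_right)).1
      dsimp only
      rw [zero_smul]
      have h6 := Scheme.Modules.map_smul L i c' (L.presheaf.map (homOfLE inf_le_right).op e : Γ(L, V ⊓ U))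
      rw [h4, map_zero] at h6
      rw [h6]
      congr 1
      rw [← ConcreteCategory.comp_apply, ← Functor.map_comp]
      rfl
    rw [← X.presheaf.germ_res_apply' i.op x hW c', h5, map_zero]
  · intro m
    obtain ⟨V, hV, m, rfl⟩ := TopCat.Presheaf.exists_germ_eq (C := Ab) L.presheaf m
    have hxW : x ∈ V ⊓ U := ⟨hV, hx⟩
    obtain ⟨c, hc⟩ := (he (V ⊓ U) inf_le_right).2 (L.presheaf.map (homOfLE inf_le_left).op m)
    refine ⟨X.presheaf.germ _ x hxW c, ?_⟩
    have h := congrArg (L.presheaf.germ _ x hxW) hc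
    dsimp only at h ⊢
    rw [germ_smul] at h
    have h1 := L.presheaf.germ_res_apply' (homOfLE (inf_le_left : V ⊓ U ≤ V)).op x hxW m
    have h2 := L.presheaf.germ_res_apply' (homOfLE (inf_le_right : V ⊓ U ≤ U)).op x hxW e
    rw [← h2, ← h1]
    exact h

section
variable {U : X.Opens} {e : Γ(L, U)} (he : IsFrame L e) (x : X) (hx : x ∈ U)

/-- A frame identifies `L_x` with the local ring. -/
def stalkEquiv : X.presheaf.stalk x ≃ₗ[X.presheaf.stalk x] L.presheaf.stalk x :=
  LinearEquiv.ofBijective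
    (LinearMap.toSpanSingleton (X.presheaf.stalk x) _ (L.presheaf.germ U x hx e))
    (he.bijective x hx)

/-- The ring homomorphism from the tensor algebra of `L_x` to the local ring that sends a frame
to `1`. -/
def coord : TensorStalk L x →ₐ[X.presheaf.stalk x] X.presheaf.stalk x :=
  TensorAlgebra.lift _ (stalkEquiv he x hx).symm.toLinearMap

/-- The germ of `e` as an element of the tensor algebra. -/
def frameAt (e : Γ(L, U)) (x : X) (hx : x ∈ U) : TensorStalk L x :=
  TensorAlgebra.ι _ (L.presheaf.germ U x hx e)

lemma coord_frameAt : coord he x hx (frameAt e x hx) = 1 := by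
  refine (TensorAlgebra.lift_ι_apply _ _).trans ((stalkEquiv he x hx).symm_apply_eq.2 ?_)
  exact (one_smul (X.presheaf.stalk x) (L.presheaf.germ U x hx e)).symm

lemma coord_smul_pow (c : X.presheaf.stalk x) (n : ℕ) :
    coord he x hx (c • frameAt e x hx ^ n) = c := by
  rw [AlgHom.map_smul_of_tower, map_pow, coord_frameAt, one_pow, smul_eq_mul, mul_one]

lemma exists_eq_smul_frameAt {U : X.Opens} {e : Γ(L, U)} (he : IsFrame L e) (x : X) (hx : x ∈ U)
    (m : L.presheaf.stalk x) :
    ∃ c : X.presheaf.stalk x, TensorAlgebra.ι (X.presheaf.stalk x) m = c • frameAt e x hx := by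
  obtain ⟨c, rfl⟩ := (he.bijective x hx).2 m
  exact ⟨c, map_smul _ _ _⟩

lemma tensorStalk_mul_comm {U : X.Opens} {e : Γ(L, U)} (he : IsFrame L e) (x : X) (hx : x ∈ U)
    (a b : TensorStalk L x) : a * b = b * a := by
  have key (m : L.presheaf.stalk x) (b : TensorStalk L x) :
      Commute (TensorAlgebra.ι (X.presheaf.stalk x) m) b := by
    induction b using TensorAlgebra.induction with
    | algebraMap r => exact (Algebra.commutes _ _).symm
    | ι m' =>
      obtain ⟨c, hc⟩ := exists_eq_smul_frameAt he x hx m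
      obtain ⟨d, hd⟩ := exists_eq_smul_frameAt he x hx m'
      rw [hc, hd]
      exact ((Commute.refl _).smul_left c).smul_right d
    | mul a b ha hb => exact ha.mul_right hb
    | add a b ha hb => exact ha.add_right hb
  induction a using TensorAlgebra.induction with
  | algebraMap r => exact Algebra.commutes _ _
  | ι m => exact key m b
  | mul a a' ha hb => exact Commute.mul_left ha hb
  | add a a' ha hb => exact Commute.add_left ha hb

end

instance instCommRingTensorStalk [IsInvertible L] (x : X) : CommRing (TensorStalk L x) where
  mul_comm := by
    obtain ⟨U, hx, e, he⟩ := IsInvertible.exists_frame (L := L) x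
    exact tensorStalk_mul_comm he x hx

/-- The germ `z` of a section of a tensor power of `L` has nonzero value in the fibre at `x`. -/
def IsNonzeroAt {x : X} (z : TensorStalk L x) : Prop :=
  z ∉ IsLocalRing.maximalIdeal (X.presheaf.stalk x) • (⊤ : Submodule (X.presheaf.stalk x) (TensorStalk L x))

lemma isNonzeroAt_iff {U : X.Opens} {e : Γ(L, U)} (he : IsFrame L e) (x : X) (hx : x ∈ U)
    (c : X.presheaf.stalk x) (n : ℕ) : IsNonzeroAt (c • frameAt e x hx ^ n) ↔ IsUnit c := by
  rw [IsNonzeroAt, not_iff_comm, ← mem_nonunits_iff, ← IsLocalRing.mem_maximalIdeal]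
  constructor
  · exact fun h => Submodule.smul_mem_smul h trivial
  · intro h
    have : IsLocalRing.maximalIdeal (X.presheaf.stalk x) • (⊤ : Submodule (X.presheaf.stalk x) (TensorStalk L x)) ≤
        Submodule.comap (coord he x hx).toLinearMap (IsLocalRing.maximalIdeal (X.presheaf.stalk x)) := by
      rw [Submodule.smul_le]
      intro r hr z _
      rw [Submodule.mem_comap, map_smul]
      exact Ideal.mul_mem_right _ _ hr
    have h' := this h
    rw [Submodule.mem_comap] at h'
    exact (coord_smul_pow he x hx c n) ▸ h'

lemma prod_ofFn_smul {R A : Type*} [CommSemiring R] [Semiring A] [Algebra R A] (a : A) :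
    ∀ {n : ℕ} (c : Fin n → R), (List.ofFn fun i => c i • a).prod = (∏ i, c i) • a ^ n
  | 0, c => by simp
  | n + 1, c => by
    rw [List.ofFn_succ, List.prod_cons, prod_ofFn_smul, Fin.prod_univ_succ, pow_succ',
      smul_mul_smul_comm]

lemma exists_coord {U : X.Opens} {e : Γ(L, U)} (he : IsFrame L e) {n : ℕ} {V : X.Opens}
    {s : ∀ x : V, TensorStalk L x.1} (hs : s ∈ tensorSections L n V) (x : X) (hxV : x ∈ V) (hxU : x ∈ U) :
    ∃ (W : X.Opens) (_ : x ∈ W) (hV : W ≤ V) (hU : W ≤ U) (a : Γ(X, W)), ∀ y (hy : y ∈ W),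
      s ⟨y, hV hy⟩ = X.presheaf.germ W y hy a • frameAt e y (hU hy) ^ n := by
  obtain ⟨W, hxW, i, hW⟩ := hs ⟨x, hxV⟩
  have hx : x ∈ W ⊓ U := ⟨hxW, hxU⟩
  have h1 := pureTensors_res L n (homOfLE (inf_le_left : W ⊓ U ≤ W)) _ hW
  refine ⟨W ⊓ U, hx, inf_le_left.trans i.le, inf_le_right, ?_⟩
  let S : AddSubgroup (∀ y : (W ⊓ U : X.Opens), TensorStalk L y.1) :=
    { carrier := {t | ∃ a : Γ(X, W ⊓ U), ∀ y (hy : y ∈ W ⊓ U), t ⟨y, hy⟩ =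
        X.presheaf.germ _ y hy a • frameAt e y hy.2 ^ n}
      zero_mem' := ⟨0, fun y hy => by rw [map_zero, zero_smul]; rfl⟩
      add_mem' := by
        rintro s t ⟨a, ha⟩ ⟨b, hb⟩
        exact ⟨a + b, fun y hy => by rw [map_add, add_smul, ← ha, ← hb]; rfl⟩
      neg_mem' := by
        rintro s ⟨a, ha⟩
        exact ⟨-a, fun y hy => by rw [map_neg, neg_smul, ← ha]; rfl⟩ }
  have h2 : AddSubgroup.closure (pureTensors L n (W ⊓ U)) ≤ S := by
    rw [AddSubgroup.closure_le]
    rintro t ⟨c, m, ht⟩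
    choose b hb using fun i => (he (W ⊓ U) inf_le_right).2 (m i)
    refine ⟨c * ∏ i, b i, fun y hy => ?_⟩
    have h3 (i) : TensorAlgebra.ι (X.presheaf.stalk y) (L.presheaf.germ (W ⊓ U) y hy (m i)) =
        X.presheaf.germ (W ⊓ U) y hy (b i) • frameAt e y hy.2 := by
      have h4 := germ_smul L y (W ⊓ U) hy (b i) (L.presheaf.map (homOfLE inf_le_right).op e)
      rw [L.presheaf.germ_res_apply' (homOfLE (inf_le_right : W ⊓ U ≤ U)).op y hy e] at h4
      have h5 : L.presheaf.germ (W ⊓ U) y hy (m i) = X.presheaf.germ (W ⊓ U) y hy (b i) • L.presheaf.germ U y hy.2 e :=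
        (congrArg (L.presheaf.germ (W ⊓ U) y hy) (hb i)).symm.trans h4
      rw [h5, map_smul]
      rfl
    rw [ht, map_mul, mul_smul, map_prod]
    dsimp only
    simp only [h3]
    rw [prod_ofFn_smul]
  exact h2 h1

end

section
variable {X : Scheme.{u}} {L : X.Modules}

lemma smul_right_cancel_of_isNonzeroAt [IsInvertible L] {n : ℕ} {V : X.Opens}
    {t : ∀ x : V, TensorStalk L x.1} (ht : t ∈ tensorSections L n V) (x : V)
    (hx : IsNonzeroAt (t x)) (a b : X.presheaf.stalk x.1) (h : a • t x = b • t x) : a = b := by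
  obtain ⟨U, hU, e, he⟩ := IsInvertible.exists_frame (L := L) x.1
  obtain ⟨W, hxW, hWV, hWU, c, hc⟩ := exists_coord he ht x.1 x.2 hU
  have hc := hc x.1 hxW
  change t x = _ at hc
  rw [hc] at hx h
  rw [isNonzeroAt_iff he] at hx
  rw [smul_smul, smul_smul] at h
  have h := congrArg (coord he x.1 hU) h
  rw [coord_smul_pow, coord_smul_pow] at h
  exact hx.mul_right_cancel h

lemma existsUnique_div [IsInvertible L] {n : ℕ} {V : X.Opens}
    {s t : ∀ x : V, TensorStalk L x.1} (hs : s ∈ tensorSections L n V)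
    (ht : t ∈ tensorSections L n V) (h : ∀ x, IsNonzeroAt (t x)) :
    ∃! g : Γ(X, V), ∀ x : V, s x = X.presheaf.germ V x.1 x.2 g • t x := by
  have loc (x : V) : ∃ (W : X.Opens) (_ : x.1 ∈ W) (hW : W ≤ V) (g : Γ(X, W)), ∀ y (hy : y ∈ W),
      s ⟨y, hW hy⟩ = X.presheaf.germ W y hy g • t ⟨y, hW hy⟩ := by
    obtain ⟨U, hU, e, he⟩ := IsInvertible.exists_frame (L := L) x.1
    obtain ⟨W₁, h₁, hV₁, hU₁, a, ha⟩ := exists_coord he hs x.1 x.2 hU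
    obtain ⟨W₂, h₂, hV₂, hU₂, b, hb⟩ := exists_coord he ht x.1 x.2 hU
    have hb' : IsUnit b := by
      refine X.toRingedSpace.isUnit_of_isUnit_germ W₂ b fun y hy => ?_
      have := h ⟨y, hV₂ hy⟩
      rw [hb, isNonzeroAt_iff he] at this
      exact this
    obtain ⟨b', hb'⟩ := hb'.exists_left_inv
    refine ⟨W₁ ⊓ W₂, ⟨h₁, h₂⟩, inf_le_left.trans hV₁,
      X.presheaf.map (homOfLE inf_le_left).op a * X.presheaf.map (homOfLE inf_le_right).op b',
      fun y hy => ?_⟩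
    rw [ha y hy.1, hb y hy.2, map_mul]
    have e1 := X.presheaf.germ_res_apply' (homOfLE (inf_le_left : W₁ ⊓ W₂ ≤ W₁)).op y hy a
    have e2 := X.presheaf.germ_res_apply' (homOfLE (inf_le_right : W₁ ⊓ W₂ ≤ W₂)).op y hy b'
    rw [e1, e2, smul_smul, mul_assoc, ← map_mul, hb', map_one, mul_one]
  choose W hxW hW g hg using loc
  have compat (x y : V) (z : X) (hx : z ∈ W x) (hy : z ∈ W y) :
      X.presheaf.germ (W x) z hx (g x) = X.presheaf.germ (W y) z hy (g y) :=
    smul_right_cancel_of_isNonzeroAt ht ⟨z, hW x hx⟩ (h _) _ _ ((hg x z hx).symm.trans (hg y z hy))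
  have uniq (a b : Γ(X, V)) (ha : ∀ x : V, s x = X.presheaf.germ V x.1 x.2 a • t x)
      (hb : ∀ x : V, s x = X.presheaf.germ V x.1 x.2 b • t x) : a = b :=
    TopCat.Presheaf.section_ext X.sheaf V _ _ fun z hz =>
      smul_right_cancel_of_isNonzeroAt ht ⟨z, hz⟩ (h _) _ _ ((ha ⟨z, hz⟩).symm.trans (hb ⟨z, hz⟩))
  obtain ⟨G, hG, -⟩ := X.sheaf.existsUnique_gluing' W V (fun x => homOfLE (hW x))
    (fun x hx => Opens.mem_iSup.2 ⟨⟨x, hx⟩, hxW _⟩) g (fun x y =>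
      TopCat.Presheaf.section_ext X.sheaf _ _ _ fun z hz => by
        have e1 := X.presheaf.germ_res_apply' (Opens.infLELeft (W x) (W y)).op z hz (g x)
        have e2 := X.presheaf.germ_res_apply' (Opens.infLERight (W x) (W y)).op z hz (g y)
        exact e1.trans ((compat x y z hz.1 hz.2).trans e2.symm))
  refine ⟨G, fun x => ?_, fun b hb => ?_⟩
  · have e1 := X.presheaf.germ_res_apply' (homOfLE (hW x)).op x.1 (hxW x) G
    have e2 := congrArg (X.presheaf.germ (W x) x.1 (hxW x)) (hG x)
    rw [← e1]
    exact (hg x x.1 (hxW x)).trans (congrArg (· • t x) e2.symm)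
  · refine uniq _ _ hb fun x => ?_
    have e1 := X.presheaf.germ_res_apply' (homOfLE (hW x)).op x.1 (hxW x) G
    have e2 := congrArg (X.presheaf.germ (W x) x.1 (hxW x)) (hG x)
    rw [← e1]
    exact (hg x x.1 (hxW x)).trans (congrArg (· • t x) e2.symm)

/-- The open set `V_f ⊆ V` on which a section `f` of `L^{⊗ n}` over `V` does not vanish. -/
def nonvanishing [IsInvertible L] {n : ℕ} {V : X.Opens} (f : tensorSections L n V) : X.Opens where
  carrier := {x | ∃ hx : x ∈ V, IsNonzeroAt (f.1 ⟨x, hx⟩)}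
  is_open' := by
    rw [isOpen_iff_forall_mem_open]
    rintro x ⟨hxV, hx⟩
    obtain ⟨U, hU, e, he⟩ := IsInvertible.exists_frame (L := L) x
    obtain ⟨W, hxW, hWV, hWU, c, hc⟩ := exists_coord he f.2 x hxV hU
    have key (y) (hy : y ∈ W) : IsNonzeroAt (f.1 ⟨y, hWV hy⟩) ↔ y ∈ X.basicOpen c := by
      rw [hc y hy, isNonzeroAt_iff he, X.mem_basicOpen'' c y, exists_prop_of_true hy]
    exact ⟨X.basicOpen c, fun y hy => ⟨hWV (X.basicOpen_le c hy),
      (key y (X.basicOpen_le c hy)).2 hy⟩, (X.basicOpen c).2, (key x hxW).1 hx⟩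

end

section
section
variable {X Y : Scheme.{u}} (f : Y ⟶ X) {L : X.Modules} {N : Y.Modules}
  (ψ : L ⟶ (Scheme.Modules.pushforward f).obj N) (y : Y)

/-- The ring homomorphism on tensor algebras of stalks induced by `L → f_* N`. -/
def tensorMap : TensorStalk L (f y) →+* TensorStalk N y :=
  let : Algebra (X.presheaf.stalk (f y)) (TensorStalk N y) :=
    ((algebraMap (Y.presheaf.stalk y) (TensorStalk N y)).comp (f.stalkMap y).hom).toAlgebra'
      fun c z => Algebra.commutes (A := TensorStalk N y) ((f.stalkMap y).hom c) z
  (TensorAlgebra.lift (X.presheaf.stalk (f y))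
    ({ toFun m := TensorAlgebra.ι (Y.presheaf.stalk y) (stalkHom f ψ y m)
       map_add' a b := by rw [map_add, map_add]
       map_smul' c m := by
        rw [stalkHom_smul, map_smul, Algebra.smul_def]
        exact (Algebra.smul_def _ _).symm } :
      L.presheaf.stalk (f y) →ₗ[X.presheaf.stalk (f y)] TensorStalk N y)).toRingHom

lemma tensorMap_algebraMap (c : X.presheaf.stalk (f y)) :
    tensorMap f ψ y (algebraMap _ _ c) = algebraMap _ _ (f.stalkMap y c) := by
  let : Algebra (X.presheaf.stalk (f y)) (TensorStalk N y) :=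
    ((algebraMap (Y.presheaf.stalk y) (TensorStalk N y)).comp (f.stalkMap y).hom).toAlgebra'
      fun c z => Algebra.commutes (A := TensorStalk N y) ((f.stalkMap y).hom c) z
  exact AlgHom.commutes _ c

end

open MonoidalCategory CartesianMonoidalCategory MonObj

variable {k : Type u} [Field k]

section
variable (H X : Over (Spec (.of k))) [GrpObj H] [ModObj H X]

/-- The action morphism `(h, x) ↦ h x`. -/
def act : H ⊗ X ⟶ X := ModObj.smul (M := H) (X := X)

lemma act_assoc : (H ◁ act H X) ≫ act H X = (α_ H H X).inv ≫ μ ▷ X ≫ act H X := by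
  rw [Iso.eq_inv_comp]
  exact (ModObj.mul_smul (M := H) X).symm

/-- A linearisation of the action of `H` on the line bundle `L` over `X`: an isomorphism
`p^* L ≅ a^* L` on `H × X`, for `p` the projection and `a` the action (in the fibre over `(h, x)`,
it is the linear map `L_x → L_{hx}` by which `h` acts), that satisfies the cocycle condition on
`H × H × X`: over `(h, h', x)`, the map `L_x → L_{hh'x}` of `hh'` is the composite of the maps
`L_x → L_{h'x}` of `h'` and `L_{h'x} → L_{hh'x}` of `h`. In the condition, `Φ f` is the pullback of
the isomorphism along `f`, and `c` is the identification of the pullbacks along equal morphisms. -/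
structure Linearisation (L : X.left.Modules) where
  iso : (Scheme.Modules.pullback (snd H X).left).obj L ≅
    (Scheme.Modules.pullback (act H X).left).obj L
  cocycle :
    let Φ {W : Over (Spec (.of k))} (f : W ⟶ H ⊗ X) :
        (Scheme.Modules.pullback (f ≫ snd H X).left).obj L ⟶
          (Scheme.Modules.pullback (f ≫ act H X).left).obj L :=
      (Scheme.Modules.pullbackComp f.left (snd H X).left).inv.app L ≫
        (Scheme.Modules.pullback f.left).map iso.hom ≫
          (Scheme.Modules.pullbackComp f.left (act H X).left).hom.app L
    let c {W : Over (Spec (.of k))} {f g : W ⟶ X} (h : f = g) :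
        (Scheme.Modules.pullback f.left).obj L ⟶ (Scheme.Modules.pullback g.left).obj L :=
      (Scheme.Modules.pullbackCongr congr(($h).left)).hom.app L
    Φ ((α_ H H X).inv ≫ μ ▷ X) =
      c (by simp) ≫ Φ (snd H (H ⊗ X)) ≫ c (by simp) ≫ Φ (H ◁ act H X) ≫
        c ((act_assoc H X).trans (Category.assoc _ _ _).symm)

end

section
variable {H X : Over (Spec (.of k))} [GrpObj H] [ModObj H X] {L : X.left.Modules}
  (Φ : Linearisation H X L)

/-- `L → a_* a^* L`, that is, pulling back sections along the action. -/
def Linearisation.fromAct :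
    L ⟶ (Scheme.Modules.pushforward (act H X).left).obj
      ((Scheme.Modules.pullback (act H X).left).obj L) :=
  (Scheme.Modules.pullbackPushforwardAdjunction (act H X).left).unit.app L

/-- `L → p_* p^* L ≅ p_* a^* L`: pulling back sections along the projection and then applying the
linearisation. -/
def Linearisation.fromProj :
    L ⟶ (Scheme.Modules.pushforward (snd H X).left).obj
      ((Scheme.Modules.pullback (act H X).left).obj L) :=
  (Scheme.Modules.pullbackPushforwardAdjunction (snd H X).left).homEquiv _ _ Φ.iso.hom

/-- The section `s` of `L^{⊗ r}` over `V` is invariant: `h (s x) = s (h x)`, as sections of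
`(a^* L)^{⊗ r}` near each point `y = (h, x)` of `H × X` such that `x` and `h x` lie in `V`. -/
def Linearisation.IsInvariant {V : X.left.Opens} (s : ∀ x : V, TensorStalk L x.1) : Prop :=
  ∀ (y : (H ⊗ X).left) (hp : (snd H X).left y ∈ V) (ha : (act H X).left y ∈ V),
    tensorMap (snd H X).left Φ.fromProj y (s ⟨_, hp⟩) =
      tensorMap (act H X).left (fromAct (L := L)) y (s ⟨_, ha⟩)

end

end

section
section
variable {X : Scheme.{u}} (L : X.Modules)

lemma one_mem_tensorSections (V : X.Opens) : (fun _ => 1) ∈ tensorSections L 0 V :=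
  fun x => ⟨V, x.2, 𝟙 _, AddSubgroup.subset_closure
    ⟨1, Fin.elim0, fun x => by rw [map_one, one_smul, List.ofFn_zero, List.prod_nil]⟩⟩

variable {L}

lemma mul_mem_closure_pureTensors {r s : ℕ} {V : X.Opens} {a b : ∀ x : V, TensorStalk L x.1}
    (ha : a ∈ AddSubgroup.closure (pureTensors L r V))
    (hb : b ∈ AddSubgroup.closure (pureTensors L s V)) :
    (fun x => a x * b x) ∈ AddSubgroup.closure (pureTensors L (r + s) V) := by
  induction ha using AddSubgroup.closure_induction with
  | zero =>
    rw [show (fun x => (0 : ∀ x : V, TensorStalk L x.1) x * b x) = 0 from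
      funext fun x => zero_mul (b x)]
    exact zero_mem _
  | add a a' _ _ h h' =>
    convert! add_mem h h'
    exact add_mul _ _ _
  | neg a _ h =>
    convert! neg_mem h
    exact neg_mul _ _
  | mem a ha =>
    induction hb using AddSubgroup.closure_induction with
    | zero =>
      rw [show (fun x => a x * (0 : ∀ x : V, TensorStalk L x.1) x) = 0 from
        funext fun x => mul_zero (a x)]
      exact zero_mem _
    | add a a' _ _ h h' =>
      convert! add_mem h h'
      exact mul_add _ _ _
    | neg a _ h =>
      convert! neg_mem h
      exact mul_neg _ _
    | mem b hb =>
      obtain ⟨c, m, hc⟩ := ha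
      obtain ⟨d, n, hd⟩ := hb
      refine AddSubgroup.subset_closure ⟨c * d, Fin.append m n, fun x => ?_⟩
      have h (i) : TensorAlgebra.ι (X.presheaf.stalk x.1)
          (L.presheaf.germ V x.1 x.2 (Fin.append m n i)) =
          Fin.append (fun i => TensorAlgebra.ι (X.presheaf.stalk x.1)
            (L.presheaf.germ V x.1 x.2 (m i))) (fun i => TensorAlgebra.ι (X.presheaf.stalk x.1)
            (L.presheaf.germ V x.1 x.2 (n i))) i := by
        refine Fin.addCases (fun j => ?_) (fun j => ?_) i
        · rw [Fin.append_left, Fin.append_left]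
        · rw [Fin.append_right, Fin.append_right]
      simp only [h]
      rw [List.ofFn_fin_append, List.prod_append, hc, hd, map_mul, smul_mul_smul_comm]

lemma mul_mem_tensorSections {r s : ℕ} {V : X.Opens} {a b : ∀ x : V, TensorStalk L x.1}
    (ha : a ∈ tensorSections L r V) (hb : b ∈ tensorSections L s V) :
    (fun x => a x * b x) ∈ tensorSections L (r + s) V := by
  intro x
  obtain ⟨V₁, h₁, i₁, hs⟩ := ha x
  obtain ⟨V₂, h₂, i₂, ht⟩ := hb x
  exact ⟨V₁ ⊓ V₂, ⟨h₁, h₂⟩, homOfLE (inf_le_left.trans i₁.le),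
    mul_mem_closure_pureTensors (pureTensors_res L r (homOfLE inf_le_left) _ hs)
      (pureTensors_res L s (homOfLE inf_le_right) _ ht)⟩
end

open MonoidalCategory CartesianMonoidalCategory MonObj

variable {k : Type u} [Field k]

/-- The structure map `k → Γ(X, 𝒪_X)`. -/
def scalar (X : Over (Spec (.of k))) : k →+* Γ(X.left, ⊤) :=
  X.hom.appTop.hom.comp (Scheme.ΓSpecIso (.of k)).inv.hom

/-- The structure map `k → 𝒪_{X,x}`. -/
def scalarGerm (X : Over (Spec (.of k))) (x : X.left) : k →+* X.left.presheaf.stalk x :=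
  (X.left.presheaf.germ ⊤ x trivial).hom.comp (scalar X)

lemma stalkMap_scalarGerm {X Y : Over (Spec (.of k))} (f : Y ⟶ X) (y : Y.left) (c : k) :
    f.left.stalkMap y (scalarGerm X (f.left y) c) = scalarGerm Y y c := by
  have h := Scheme.Hom.germ_stalkMap_apply f.left ⊤ y trivial (scalar X c)
  refine h.trans ?_
  have h2 : f.left.appTop (scalar X c) = scalar Y c := by
    have : X.hom.appTop ≫ f.left.appTop = Y.hom.appTop := by
      rw [← Scheme.Hom.comp_appTop, Over.w]
    exact congr($this ((Scheme.ΓSpecIso (.of k)).inv c))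
  exact congrArg _ h2

/-- All families of elements of the tensor algebras of the stalks; the algebra in which global
sections of the powers of `L` are multiplied. -/
def Germs (X : Over (Spec (.of k))) (L : X.left.Modules) : Type u :=
  ∀ x : (⊤ : X.left.Opens), TensorStalk L x.1

section
variable {X : Over (Spec (.of k))} {L : X.left.Modules} [IsInvertible L]

instance instCommRingGerms : CommRing (Germs X L) :=
  inferInstanceAs (CommRing (∀ x : (⊤ : X.left.Opens), TensorStalk L x.1))

instance instAlgebraGerms : Algebra k (Germs X L) :=
  (RingHom.pi fun x : (⊤ : X.left.Opens) => (algebraMap (X.left.presheaf.stalk x.1)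
    (TensorStalk L x.1)).comp (scalarGerm X x.1) : k →+* Germs X L).toAlgebra

variable {H : Over (Spec (.of k))} [GrpObj H] [ModObj H X] (Φ : Linearisation H X L)

/-- The space `H⁰(X, L^{⊗ r})^H` of invariant sections. -/
def invariants (r : ℕ) : Submodule k (Germs X L) where
  carrier := {s | s ∈ tensorSections L r ⊤ ∧ Φ.IsInvariant s}
  zero_mem' := ⟨zero_mem _, fun y _ _ => (map_zero _).trans (map_zero _).symm⟩
  add_mem' {s t} hs ht := ⟨add_mem hs.1 ht.1, fun y hp ha =>
    (map_add _ _ _).trans ((congrArg₂ _ (hs.2 y hp ha) (ht.2 y hp ha)).trans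
      (map_add _ _ _).symm)⟩
  smul_mem' c s hs := by
    have h (x) : (c • s) x = scalarGerm X x.1 c • s x :=
      (Algebra.smul_def (scalarGerm X x.1 c) (s x)).symm
    refine ⟨?_, fun y hp ha => ?_⟩
    · exact (tensorPredicate L r).smul_mem ⊤ (scalar X c) s hs.1
    · refine (congrArg _ (h _)).trans (Eq.trans ?_ (congrArg _ (h _)).symm)
      rw [Algebra.smul_def, Algebra.smul_def, map_mul, map_mul, tensorMap_algebraMap,
        tensorMap_algebraMap, stalkMap_scalarGerm, stalkMap_scalarGerm, hs.2 y hp ha]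

instance instGradedMonoidInvariants : SetLike.GradedMonoid (invariants Φ) where
  one_mem := ⟨one_mem_tensorSections L ⊤, fun _ _ _ => (map_one _).trans (map_one _).symm⟩
  mul_mem _ _ _ _ hs ht := ⟨mul_mem_tensorSections hs.1 ht.1, fun y hp ha =>
    (map_mul _ _ _).trans ((congrArg₂ _ (hs.2 y hp ha) (ht.2 y hp ha)).trans
      (map_mul _ _ _).symm)⟩

open DirectSum in
/-- The ring of invariants `S^H = ⨁_{r ≥ 0} H⁰(X, L^{⊗ r})^H`. -/
def InvariantRing : Type u := ⨁ r, invariants Φ r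

open DirectSum in
instance instCommRingInvariantRing : CommRing (InvariantRing Φ) := inferInstanceAs (CommRing (⨁ r, invariants Φ r))

open DirectSum in
instance instAlgebraInvariantRing : Algebra k (InvariantRing Φ) := inferInstanceAs (Algebra k (⨁ r, invariants Φ r))

/-- The inclusion of the degree `r` part. -/
def ofInvariant (r : ℕ) : invariants Φ r →ₗ[k] InvariantRing Φ :=
  DirectSum.lof k ℕ (fun r => invariants Φ r) r

/-- The graded pieces of `S^H`. -/
def grading (r : ℕ) : Submodule k (InvariantRing Φ) :=
  LinearMap.range (ofInvariant Φ r)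

/-- The decomposition of an element of `S^H` into its homogeneous parts. -/
def decomposition : InvariantRing Φ →ₗ[k] DirectSum ℕ fun r => grading Φ r :=
  DirectSum.toModule k ℕ _ fun r =>
    (DirectSum.lof k ℕ (fun r => grading Φ r) r).comp (ofInvariant Φ r).rangeRestrict

lemma decomposition_ofInvariant (r : ℕ) (a : invariants Φ r) :
    decomposition Φ (ofInvariant Φ r a) =
      DirectSum.lof k ℕ (fun r => grading Φ r) r ⟨ofInvariant Φ r a, a, rfl⟩ :=
  DirectSum.toModule_lof k r (M := fun r => invariants Φ r) a

instance instGradedAlgebraGrading : GradedAlgebra (grading Φ) where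
  one_mem := ⟨1, rfl⟩
  mul_mem := by
    rintro i j _ _ ⟨a, rfl⟩ ⟨b, rfl⟩
    exact ⟨(⟨a.1 * b.1, SetLike.mul_mem_graded a.2 b.2⟩ : invariants Φ (i + j)),
      (DirectSum.of_mul_of (A := fun r => invariants Φ r) a b).symm⟩
  __ := DirectSum.Decomposition.ofLinearMap (grading Φ) (decomposition Φ)
    (DirectSum.linearMap_ext _ fun r => LinearMap.ext fun a =>
      (congrArg (DirectSum.coeLinearMap (grading Φ)) (decomposition_ofInvariant Φ r a)).trans
        (DirectSum.coeLinearMap_lof _ _ _))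
    (by
      refine DirectSum.linearMap_ext _ fun r => LinearMap.ext ?_
      rintro ⟨_, a, rfl⟩
      exact (congrArg (decomposition Φ) (DirectSum.coeLinearMap_lof (grading Φ) r
        ⟨ofInvariant Φ r a, a, rfl⟩)).trans (decomposition_ofInvariant Φ r a))

/-- The germ at `x` of an element of `S^H`. -/
def evalAt (x : X.left) : InvariantRing Φ →+* TensorStalk L x :=
  (Pi.evalRingHom (fun x : (⊤ : X.left.Opens) => TensorStalk L x.1) ⟨x, trivial⟩).comp
    (DirectSum.coeAlgHom (invariants Φ)).toRingHom

lemma evalAt_ofInvariant (x : X.left) (r : ℕ) (f : invariants Φ r) :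
    evalAt Φ x (ofInvariant Φ r f) = f.1 ⟨x, trivial⟩ :=
  congrFun (DirectSum.coeAlgHom_of (invariants Φ) r f) _

end

end

section
section
variable {X : Scheme.{u}} {L : X.Modules} [IsInvertible L] {m n : ℕ} {V : X.Opens}
  {s t t' : ∀ x : V, TensorStalk L x.1}

lemma isNonzeroAt_mul_iff (hs : s ∈ tensorSections L m V) (ht : t ∈ tensorSections L n V) (x : V) :
    IsNonzeroAt (s x * t x) ↔ IsNonzeroAt (s x) ∧ IsNonzeroAt (t x) := by
  obtain ⟨U, hU, e, he⟩ := IsInvertible.exists_frame (L := L) x.1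
  obtain ⟨W₁, h₁, hV₁, hU₁, a, ha⟩ := exists_coord he hs x.1 x.2 hU
  obtain ⟨W₂, h₂, hV₂, hU₂, b, hb⟩ := exists_coord he ht x.1 x.2 hU
  have ha : s x = _ := ha x.1 h₁
  have hb : t x = _ := hb x.1 h₂
  rw [ha, hb, smul_mul_smul_comm, ← pow_add, isNonzeroAt_iff he, isNonzeroAt_iff he,
    isNonzeroAt_iff he, IsUnit.mul_iff]

lemma isNonzeroAt_one (x : X) : IsNonzeroAt (1 : TensorStalk L x) := by
  obtain ⟨U, hU, e, he⟩ := IsInvertible.exists_frame (L := L) x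
  have := isNonzeroAt_iff he x hU 1 0
  rw [pow_zero, one_smul] at this
  exact this.2 isUnit_one

lemma mul_left_cancel_of_isNonzeroAt (hs : s ∈ tensorSections L m V)
    (ht : t ∈ tensorSections L n V) (ht' : t' ∈ tensorSections L n V) (x : V)
    (hx : IsNonzeroAt (s x)) (h : s x * t x = s x * t' x) : t x = t' x := by
  obtain ⟨U, hU, e, he⟩ := IsInvertible.exists_frame (L := L) x.1
  obtain ⟨W₁, h₁, hV₁, hU₁, a, ha⟩ := exists_coord he hs x.1 x.2 hU
  obtain ⟨W₂, h₂, hV₂, hU₂, b, hb⟩ := exists_coord he ht x.1 x.2 hU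
  obtain ⟨W₃, h₃, hV₃, hU₃, c, hc⟩ := exists_coord he ht' x.1 x.2 hU
  have ha : s x = _ := ha x.1 h₁
  have hb : t x = _ := hb x.1 h₂
  have hc : t' x = _ := hc x.1 h₃
  rw [ha, isNonzeroAt_iff he] at hx
  rw [ha, hb, hc, smul_mul_smul_comm, smul_mul_smul_comm, ← pow_add] at h
  have h := congrArg (coord he x.1 hU) h
  rw [coord_smul_pow, coord_smul_pow] at h
  rw [hb, hc, hx.mul_left_cancel h]

lemma nonvanishing_mul (s : tensorSections L m V) (t : tensorSections L n V) :
    nonvanishing (⟨_, mul_mem_tensorSections s.2 t.2⟩ : tensorSections L (m + n) V) =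
      nonvanishing s ⊓ nonvanishing t := by
  ext x
  constructor
  · rintro ⟨hx, h⟩
    have := (isNonzeroAt_mul_iff s.2 t.2 ⟨x, hx⟩).1 h
    exact ⟨⟨hx, this.1⟩, ⟨hx, this.2⟩⟩
  · rintro ⟨⟨hx, h⟩, ⟨_, h'⟩⟩
    exact ⟨hx, (isNonzeroAt_mul_iff s.2 t.2 ⟨x, hx⟩).2 ⟨h, h'⟩⟩

lemma res_mem_tensorSections {X : Scheme.{u}} {L : X.Modules} {m : ℕ} {V W : X.Opens}
    {s : ∀ x : V, TensorStalk L x.1} (h : W ≤ V) (hs : s ∈ tensorSections L m V) :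
    (fun x : W => s ⟨x.1, h x.2⟩) ∈ tensorSections L m W :=
  (tensorPredicate L m).res (homOfLE h) s hs

end

variable {k : Type u} [Field k] {X : Over (Spec (.of k))} {L : X.left.Modules} [IsInvertible L]
  {H : Over (Spec (.of k))} [GrpObj H] [ModObj H X] (Φ : Linearisation H X L)

/-- The open set `X_f` where the invariant `f` does not vanish. -/
def locus {m : ℕ} (f : invariants Φ m) : X.left.Opens :=
  nonvanishing (⟨f.1, f.2.1⟩ : tensorSections L m ⊤)

/-- The product of two invariants. -/
def mulInvariants {m n : ℕ} (f : invariants Φ m) (g : invariants Φ n) : invariants Φ (m + n) :=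
  ⟨f.1 * g.1, SetLike.mul_mem_graded f.2 g.2⟩

lemma ofInvariant_mul {m n : ℕ} (f : invariants Φ m) (g : invariants Φ n) :
    ofInvariant Φ (m + n) (mulInvariants Φ f g) = ofInvariant Φ m f * ofInvariant Φ n g :=
  (DirectSum.of_mul_of (A := fun r => invariants Φ r) f g).symm

lemma ofInvariant_mem {m : ℕ} (f : invariants Φ m) : ofInvariant Φ m f ∈ grading Φ m := ⟨f, rfl⟩

lemma locus_mul {m n : ℕ} (f : invariants Φ m) (g : invariants Φ n) :
    locus Φ (mulInvariants Φ f g) = locus Φ f ⊓ locus Φ g :=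
  nonvanishing_mul (⟨f.1, f.2.1⟩ : tensorSections L m ⊤) (⟨g.1, g.2.1⟩ : tensorSections L n ⊤)

lemma evalAt_mem {n : ℕ} {a : InvariantRing Φ} (ha : a ∈ grading Φ n) (V : X.left.Opens) :
    (fun x : V => evalAt Φ x.1 a) ∈ tensorSections L n V := by
  obtain ⟨a, rfl⟩ := ha
  simp only [evalAt_ofInvariant]
  exact res_mem_tensorSections (V := ⊤) le_top a.2.1

section away
variable {m : ℕ} (f : invariants Φ m)

lemma isNonzeroAt_evalAt_pow (x : X.left) (hx : x ∈ locus Φ f) (i : ℕ) :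
    IsNonzeroAt (evalAt Φ x (ofInvariant Φ m f ^ i)) := by
  induction i with
  | zero =>
    rw [pow_zero, map_one]
    exact isNonzeroAt_one x
  | succ i ih =>
    have h1 := evalAt_mem Φ (SetLike.pow_mem_graded i (ofInvariant_mem Φ f)) ⊤
    have h2 := evalAt_mem Φ (ofInvariant_mem Φ f) ⊤
    rw [pow_succ, map_mul]
    refine (isNonzeroAt_mul_iff h1 h2 ⟨x, trivial⟩).2 ⟨ih, ?_⟩
    dsimp only
    rw [evalAt_ofInvariant]
    exact hx.2

open HomogeneousLocalization

/-- Fractions `a / f ^ i` with numerator and denominator of the same degree. -/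
abbrev Frac := NumDenSameDeg (grading Φ) (Submonoid.powers (ofInvariant Φ m f))

/-- The function `g` on `X_f` is the quotient of the two sections in the fraction `c`. -/
def IsQuotientFun (c : Frac Φ f) (g : Γ(X.left, locus Φ f)) : Prop :=
  ∀ x : locus Φ f, evalAt Φ x.1 c.num.1 =
    X.left.presheaf.germ (locus Φ f) x.1 x.2 g • evalAt Φ x.1 c.den.1

lemma isNonzeroAt_den (c : Frac Φ f) (x : locus Φ f) : IsNonzeroAt (evalAt Φ x.1 c.den.1) := by
  obtain ⟨i, hi⟩ := c.den_mem
  rw [← hi]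
  exact isNonzeroAt_evalAt_pow Φ f x.1 x.2 i

lemma existsUnique_isQuotientFun (c : Frac Φ f) : ∃! g, IsQuotientFun Φ f c g :=
  existsUnique_div (evalAt_mem Φ c.num.2 _) (evalAt_mem Φ c.den.2 _) (isNonzeroAt_den Φ f c)

lemma IsQuotientFun.of_mk_eq {c d : Frac Φ f} (h : HomogeneousLocalization.mk c = .mk d)
    {g : Γ(X.left, locus Φ f)} (hg : IsQuotientFun Φ f c g) : IsQuotientFun Φ f d g := by
  intro x
  rw [ext_iff_val, val_mk, val_mk, Localization.mk_eq_mk_iff, Localization.r_iff_exists] at h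
  obtain ⟨⟨_, i, rfl⟩, h⟩ := h
  have h := congrArg (evalAt Φ x.1) h
  simp only [map_mul] at h
  rw [hg x] at h
  refine mul_left_cancel_of_isNonzeroAt (m := i • m + c.deg)
    (mul_mem_tensorSections (evalAt_mem Φ (SetLike.pow_mem_graded i (ofInvariant_mem Φ f)) _)
      (evalAt_mem Φ c.den.2 _)) (evalAt_mem Φ d.num.2 _)
    (t' := fun y => X.left.presheaf.germ _ y.1 y.2 g • evalAt Φ y.1 d.den.1)
    ((tensorPredicate L d.deg).smul_mem _ g (fun y => evalAt Φ y.1 d.den.1)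
      (evalAt_mem Φ d.den.2 _)) x
    ((isNonzeroAt_mul_iff (evalAt_mem Φ (SetLike.pow_mem_graded i (ofInvariant_mem Φ f)) _)
      (evalAt_mem Φ c.den.2 _) x).2
      ⟨isNonzeroAt_evalAt_pow Φ f x.1 x.2 i, isNonzeroAt_den Φ f c x⟩) ?_
  rw [mul_assoc, mul_assoc, ← h]
  simp only [mul_smul_comm, smul_mul_assoc, mul_comm (evalAt Φ x.1 d.den.1)]

/-- The function on `X_f` given by an element of `(S^H)_{(f)}`. -/
def awayFun (z : Away (grading Φ) (ofInvariant Φ m f)) : Γ(X.left, locus Φ f) :=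
  (existsUnique_isQuotientFun Φ f (mk_surjective z).choose).choose

lemma isQuotientFun_awayFun (c : Frac Φ f) : IsQuotientFun Φ f c (awayFun Φ f (HomogeneousLocalization.mk c)) :=
  (existsUnique_isQuotientFun Φ f _).choose_spec.1.of_mk_eq Φ f (mk_surjective _).choose_spec

lemma awayFun_mk {c : Frac Φ f} {g : Γ(X.left, locus Φ f)} (h : IsQuotientFun Φ f c g) :
    awayFun Φ f (HomogeneousLocalization.mk c) = g :=
  (existsUnique_isQuotientFun Φ f c).unique (isQuotientFun_awayFun Φ f c) h

/-- The ring homomorphism `(S^H)_{(f)} → 𝒪(X_f)`, `a / f ^ i ↦ a / f ^ i`. -/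
def awayToSections : Away (grading Φ) (ofInvariant Φ m f) →+* Γ(X.left, locus Φ f) where
  toFun := awayFun Φ f
  map_one' := awayFun_mk Φ f (c := 1) fun x => by
    rw [map_one, one_smul]
    rfl
  map_zero' := awayFun_mk Φ f (c := 0) fun x => by
    rw [map_zero, zero_smul, NumDenSameDeg.num_zero]
    exact map_zero (evalAt Φ x.1)
  map_mul' y z := by
    obtain ⟨c, rfl⟩ := mk_surjective y
    obtain ⟨d, rfl⟩ := mk_surjective z
    refine awayFun_mk Φ f (c := c * d) fun x => ?_
    rw [NumDenSameDeg.num_mul, NumDenSameDeg.den_mul, map_mul, map_mul, map_mul,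
      isQuotientFun_awayFun Φ f c x, isQuotientFun_awayFun Φ f d x, smul_mul_smul_comm]
  map_add' y z := by
    obtain ⟨c, rfl⟩ := mk_surjective y
    obtain ⟨d, rfl⟩ := mk_surjective z
    refine awayFun_mk Φ f (c := c + d) fun x => ?_
    rw [NumDenSameDeg.num_add, NumDenSameDeg.den_add, map_mul, map_add, map_mul, map_mul, map_add,
      isQuotientFun_awayFun Φ f c x, isQuotientFun_awayFun Φ f d x, add_smul, mul_smul_comm,
      mul_smul_comm, add_comm, mul_comm (evalAt Φ x.1 d.den.1)]

/-- The morphism `X_f → Spec (S^H)_{(f)} ⊆ Proj S^H`. -/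
def locusToProj (hm : 0 < m) : (locus Φ f).toScheme ⟶ Proj (grading Φ) :=
  (locus Φ f).toSpecΓ ≫ Spec.map (CommRingCat.ofHom (awayToSections Φ f)) ≫
    Proj.awayι (grading Φ) (ofInvariant Φ m f) (ofInvariant_mem Φ f) hm

variable {n : ℕ} {g : invariants Φ n}

lemma homOfLE_locusToProj (hm : 0 < m) {d : ℕ} (hd0 : 0 < d) (hd : d = m + n)
    (h : invariants Φ d) (hh : ofInvariant Φ d h = ofInvariant Φ m f * ofInvariant Φ n g)
    (hle : locus Φ h ≤ locus Φ f) :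
    X.left.homOfLE hle ≫ locusToProj Φ f hm = locusToProj Φ h hd0 := by
  subst hd
  rw [locusToProj, locusToProj, ← Proj.SpecMap_awayMap_awayι (grading Φ) (ofInvariant_mem Φ f) hm
    (ofInvariant_mem Φ g) hh, ← Scheme.Opens.toSpecΓ_SpecMap_presheaf_map_assoc,
    ← Spec.map_comp_assoc, ← Spec.map_comp_assoc]
  congr 3
  ext z
  obtain ⟨i, a, ha, rfl⟩ := Away.mk_surjective (grading Φ) (ofInvariant_mem Φ f) z
  change X.left.presheaf.map (homOfLE hle).op (awayFun Φ f (Away.mk _ _ _ _ _)) =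
    awayFun Φ h (awayMap (grading Φ) (ofInvariant_mem Φ g) hh (Away.mk _ _ _ _ _))
  rw [awayMap_mk]
  symm
  apply awayFun_mk
  intro x
  have h1 := isQuotientFun_awayFun Φ f ⟨_, ⟨a, ha⟩, ⟨ofInvariant Φ m f ^ i, SetLike.pow_mem_graded i (ofInvariant_mem Φ f)⟩, ⟨i, rfl⟩⟩ ⟨x.1, hle x.2⟩
  have h2 := X.left.presheaf.germ_res_apply' (homOfLE hle).op x.1 x.2 (awayFun Φ f (Away.mk _ (ofInvariant_mem Φ f) i a ha))
  rw [h2]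
  change evalAt Φ x.1 (a * ofInvariant Φ n g ^ i) = _ • evalAt Φ x.1 (ofInvariant Φ (m + n) h ^ i)
  rw [map_mul, hh, mul_pow, map_mul, ← smul_mul_assoc]
  exact congrArg (· * evalAt Φ x.1 (ofInvariant Φ n g ^ i)) h1

end away

/-- The homogeneous invariants of positive degree: pairs of `r` and an element of
`H⁰(X, L^{⊗ (r + 1)})^H`. -/
abbrev PosInvariant : Type u := Σ r : ℕ, invariants Φ (r + 1)

section
variable {Φ}

/-- `f` as an element of `S^H`. -/
def PosInvariant.elem (f : PosInvariant Φ) : InvariantRing Φ := ofInvariant Φ (f.1 + 1) f.2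

/-- `X_f`. -/
def PosInvariant.locus (f : PosInvariant Φ) : X.left.Opens := EnvQuot.locus Φ f.2

/-- `X_f → Spec (S^H)_{(f)} ⊆ Proj S^H`. -/
def PosInvariant.toProj (f : PosInvariant Φ) : f.locus.toScheme ⟶ Proj (grading Φ) :=
  locusToProj Φ f.2 f.1.succ_pos

lemma PosInvariant.toProj_compat (f g : PosInvariant Φ) :
    X.left.homOfLE (inf_le_left : f.locus ⊓ g.locus ≤ f.locus) ≫ f.toProj =
      X.left.homOfLE (inf_le_right : f.locus ⊓ g.locus ≤ g.locus) ≫ g.toProj := by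
  have h := locus_mul Φ f.2 g.2
  have hd : 0 < f.1 + 1 + (g.1 + 1) := Nat.add_pos_left f.1.succ_pos _
  have e1 := homOfLE_locusToProj Φ f.2 f.1.succ_pos hd rfl (mulInvariants Φ f.2 g.2)
    (ofInvariant_mul Φ f.2 g.2) (h.trans_le inf_le_left)
  have e2 := homOfLE_locusToProj Φ g.2 g.1.succ_pos hd (add_comm _ _) (mulInvariants Φ f.2 g.2)
    ((ofInvariant_mul Φ f.2 g.2).trans (mul_comm _ _)) (h.trans_le inf_le_right)
  have e3 := congrArg (X.left.homOfLE h.ge ≫ ·) (e1.trans e2.symm)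
  rw [Scheme.homOfLE_homOfLE_assoc, Scheme.homOfLE_homOfLE_assoc] at e3
  exact e3

lemma pullback_compat {X Y : Scheme.{u}} {J : Type u} (U : J → X.Opens)
    (f : ∀ j, (U j).toScheme ⟶ Y)
    (h : ∀ i j, X.homOfLE (inf_le_left : U i ⊓ U j ≤ U i) ≫ f i =
      X.homOfLE (inf_le_right : U i ⊓ U j ≤ U j) ≫ f j) (i j : J) :
    Limits.pullback.fst (X.homOfLE (le_iSup U i)) (X.homOfLE (le_iSup U j)) ≫ f i =
      Limits.pullback.snd (X.homOfLE (le_iSup U i)) (X.homOfLE (le_iSup U j)) ≫ f j := by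
  rw [← cancel_epi (isPullback_opens_inf_le (le_iSup U i) (le_iSup U j)).isoPullback.hom,
    IsPullback.isoPullback_hom_fst_assoc, IsPullback.isoPullback_hom_snd_assoc]
  exact h i j

/-- The morphisms `X_f → Proj S^H` agree on overlaps and glue to a morphism on the union of any
family of the `X_f`. -/
def PosInvariant.glue {J : Type u} (f : J → PosInvariant Φ) :
    (⨆ j, (f j).locus).toScheme ⟶ Proj (grading Φ) :=
  (Scheme.Opens.iSupOpenCover fun j => (f j).locus).glueMorphisms (fun j => (f j).toProj)
    (pullback_compat (fun j => (f j).locus) (fun j => (f j).toProj)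
      fun i j => toProj_compat (f i) (f j))

end

end

section
variable {k : Type u} [Field k]

section
variable {A : Type u} [CommRing A] [Algebra k A] (𝒜 : ℕ → Submodule k A) [GradedAlgebra 𝒜]

/-- `Proj` of a graded `k`-algebra as a scheme over `k`. -/
def projOver : Over (Spec (.of k)) :=
  Over.mk (Proj.toSpecZero 𝒜 ≫ Spec.map (CommRingCat.ofHom (algebraMap k (𝒜 0))))

/-- The degree zero part `A_{(f)}` of the localisation is a finitely generated `k`-algebra. -/
def HomogeneousFiniteType (f : A) : Prop :=
  ((HomogeneousLocalization.fromZeroRingHom 𝒜 (Submonoid.powers f)).comp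
    (algebraMap k (𝒜 0))).FiniteType

instance isPrime_point (x : Proj 𝒜) : x.asHomogeneousIdeal.toIdeal.IsPrime := x.isPrime

/-- The localisation `A_𝔭` of the graded ring at the homogeneous prime of the point `x`. -/
def TwistStalk (x : Proj 𝒜) : Type u := Localization.AtPrime x.asHomogeneousIdeal.toIdeal

instance instCommRingTwistStalk (x : Proj 𝒜) : CommRing (TwistStalk 𝒜 x) :=
  inferInstanceAs (CommRing (Localization.AtPrime x.asHomogeneousIdeal.toIdeal))

/-- The inclusion of `𝒪_{Proj A, x} = A_{(𝔭)}` in `A_𝔭`. -/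
def stalkToTwistStalk (x : Proj 𝒜) : (Proj 𝒜).presheaf.stalk x →+* TwistStalk 𝒜 x :=
  (algebraMap (HomogeneousLocalization.AtPrime 𝒜 x.asHomogeneousIdeal.toIdeal)
    (Localization.AtPrime x.asHomogeneousIdeal.toIdeal)).comp (Proj.stalkIso 𝒜 x).hom.hom

instance instModuleTwistStalk (x : Proj 𝒜) : Module ((Proj 𝒜).presheaf.stalk x) (TwistStalk 𝒜 x) :=
  Module.compHom _ (stalkToTwistStalk 𝒜 x)

variable {𝒜} in
/-- The fraction `a / b`. -/
def TwistStalk.frac {x : Proj 𝒜} (a b : A) (hb : b ∉ x.asHomogeneousIdeal) : TwistStalk 𝒜 x :=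
  Localization.mk a ⟨b, hb⟩

lemma TwistStalk.frac_add {x : Proj 𝒜} (a b c d : A) (hb : b ∉ x.asHomogeneousIdeal)
    (hd : d ∉ x.asHomogeneousIdeal) : TwistStalk.frac a b hb + TwistStalk.frac c d hd =
      TwistStalk.frac (d * a + b * c) (b * d)
        (x.asHomogeneousIdeal.toIdeal.primeCompl.mul_mem hb hd) :=
  (Localization.add_mk _ _ _ _).trans (congrArg (Localization.mk · _) (add_comm _ _))

lemma TwistStalk.frac_mul {x : Proj 𝒜} (a b c d : A) (hb : b ∉ x.asHomogeneousIdeal)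
    (hd : d ∉ x.asHomogeneousIdeal) : TwistStalk.frac a b hb * TwistStalk.frac c d hd =
      TwistStalk.frac (a * c) (b * d)
        (x.asHomogeneousIdeal.toIdeal.primeCompl.mul_mem hb hd) :=
  Localization.mk_mul _ _ _ _

/-- The family is given on all of `V` by one fraction `a / b` of homogeneous elements with
`deg a = deg b + r`. -/
def IsTwistFraction (r : ℕ) {V : (Proj 𝒜).Opens} (s : ∀ x : V, TwistStalk 𝒜 x.1) : Prop :=
  ∃ (d : ℕ) (a b : A) (_ : a ∈ 𝒜 (d + r)) (_ : b ∈ 𝒜 d), ∀ x : V,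
    ∃ hb : b ∉ x.1.asHomogeneousIdeal, s x = TwistStalk.frac a b hb

/-- The families that are locally fractions of degree `r`. -/
def twistPredicate (r : ℕ) : StalkPredicate (Proj 𝒜) (TwistStalk 𝒜) where
  __ := TopCat.PrelocalPredicate.sheafify (X := (Proj 𝒜).toTopCat) (T := TwistStalk 𝒜)
    { pred {V} s := IsTwistFraction 𝒜 r s
      res := by
        rintro V W i s ⟨d, a, b, ha, hb, h⟩
        exact ⟨d, a, b, ha, hb, fun x => h ⟨x.1, i.le x.2⟩⟩ }
  zero_mem V x := ⟨V, x.2, 𝟙 _, 0, 0, 1, zero_mem _, SetLike.GradedOne.one_mem, fun x =>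
    ⟨fun h => x.1.isPrime.ne_top ((Ideal.eq_top_iff_one _).2 h), (Localization.mk_zero _).symm⟩⟩
  add_mem V s t hs ht x := by
    obtain ⟨V₁, h₁, i₁, d, a, b, ha, hb, hs⟩ := hs x
    obtain ⟨V₂, h₂, i₂, d', a', b', ha', hb', ht⟩ := ht x
    refine ⟨V₁ ⊓ V₂, ⟨h₁, h₂⟩, homOfLE (inf_le_left.trans i₁.le), d + d', b' * a + b * a', b * b',
      add_mem ?_ ?_, SetLike.mul_mem_graded hb hb', fun y => ?_⟩
    · rw [add_comm d d', add_assoc]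
      exact SetLike.mul_mem_graded hb' ha
    · rw [add_assoc]
      exact SetLike.mul_mem_graded hb ha'
    · obtain ⟨hy, e⟩ := hs ⟨y.1, y.2.1⟩
      obtain ⟨hy', e'⟩ := ht ⟨y.1, y.2.2⟩
      exact ⟨_, (congrArg₂ (· + ·) e e').trans (TwistStalk.frac_add 𝒜 _ _ _ _ hy hy')⟩
  smul_mem V f s hs x := by
    obtain ⟨V₁, h₁, i₁, d, a, b, ha, hb, hs⟩ := hs x
    obtain ⟨V₂, h₂, i₂, d', ⟨a', ha'⟩, ⟨b', hb'⟩, hb'', ht⟩ := f.2 x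
    refine ⟨V₁ ⊓ V₂, ⟨h₁, h₂⟩, homOfLE (inf_le_left.trans i₁.le), d' + d, a' * a, b' * b,
      ?_, SetLike.mul_mem_graded hb' hb, fun y => ?_⟩
    · rw [add_assoc]
      exact SetLike.mul_mem_graded ha' ha
    · obtain ⟨hy, e⟩ := hs ⟨y.1, y.2.1⟩
      have e' := ht ⟨y.1, y.2.2⟩
      have e'' : (Proj.stalkIso 𝒜 y.1).hom ((Proj 𝒜).presheaf.germ V y.1 (i₁.le y.2.1) f) =
        f.1 ⟨y.1, i₁.le y.2.1⟩ := Proj.stalkIso'_germ 𝒜 V y.1 (i₁.le y.2.1) f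
      have e3 : stalkToTwistStalk 𝒜 y.1 ((Proj 𝒜).presheaf.germ V y.1 (i₁.le y.2.1) f) =
          TwistStalk.frac a' b' (hb'' ⟨y.1, y.2.2⟩) :=
        congrArg HomogeneousLocalization.val (e''.trans e')
      exact ⟨_, (congrArg₂ (· * ·) e3 e).trans (TwistStalk.frac_mul 𝒜 _ _ _ _ _ hy)⟩

/-- The twisting sheaf `𝒪(r)` on `Proj A`: its sections are the families of elements of the
localisations that are locally fractions of homogeneous elements, of degree `r`. -/
def twist (r : ℕ) : (projOver 𝒜).left.Modules := (twistPredicate 𝒜 r).toModules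

end

instance instGradedAlgebraHomogeneous (n : ℕ) : GradedAlgebra (MvPolynomial.homogeneousSubmodule (Fin (n + 1)) k) :=
  MvPolynomial.gradedAlgebra

/-- Projective space `ℙⁿ` over `k`. -/
def projectiveSpace (k : Type u) [Field k] (n : ℕ) : Over (Spec (.of k)) :=
  projOver (MvPolynomial.homogeneousSubmodule (Fin (n + 1)) k)

/-- The line bundle `𝒪(1)` on `ℙⁿ`. -/
def hyperplaneBundle (k : Type u) [Field k] (n : ℕ) : (projectiveSpace k n).left.Modules :=
  twist (MvPolynomial.homogeneousSubmodule (Fin (n + 1)) k) 1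

/-- `M` is very ample: it is the pullback of `𝒪(1)` along a locally closed immersion of `Z` in a
projective space over `k`. -/
def IsVeryAmple {Z : Over (Spec (.of k))} (M : Z.left.Modules) : Prop :=
  ∃ (n : ℕ) (i : Z ⟶ projectiveSpace k n), IsImmersion i.left ∧
    Nonempty (M ≅ (Scheme.Modules.pullback i.left).obj (hyperplaneBundle k n))

end

section
open MonoidalCategory CartesianMonoidalCategory

variable {k : Type u} [Field k]

/-- A variety over `k`: a reduced separated scheme of finite type over `k`. -/
structure IsVariety (X : Over (Spec (.of k))) : Prop where
  isReduced : IsReduced X.left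
  isSeparated : IsSeparated X.hom
  locallyOfFiniteType : LocallyOfFiniteType X.hom
  quasiCompact : QuasiCompact X.hom

/-- A linear algebraic group over `k`: a group variety that is affine. -/
structure IsLinearAlgebraicGroup (H : Over (Spec (.of k))) [GrpObj H] : Prop extends
    IsVariety H where
  isAffine : IsAffine H.left

/-- An open subscheme of a scheme over `k`, as a scheme over `k`. -/
abbrev openOver {X : Over (Spec (.of k))} (U : X.left.Opens) : Over (Spec (.of k)) :=
  Over.mk (U.ι ≫ X.hom)

section
variable {H X : Over (Spec (.of k))} [GrpObj H] [ModObj H X] {L : X.left.Modules} [IsInvertible L]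
  (Φ : Linearisation H X L)

/-- The set `I^{ss,fg}` of homogeneous invariants `f` of positive degree such that `(S^H)_{(f)}` is
a finitely generated `k`-algebra. -/
def finitelyGenerated : Set (PosInvariant Φ) :=
  {f | HomogeneousFiniteType (grading Φ) f.elem}

/-- The finitely generated semistable locus `X^{ss,fg}`, the union of the `X_f` for `f` in
`I^{ss,fg}`. -/
def semistable : X.left.Opens := ⨆ f : finitelyGenerated Φ, f.1.locus

variable {Φ} in
/-- The union of the `X_f` for `f` in `𝒮`. -/
def unionLocus (𝒮 : Set (PosInvariant Φ)) : X.left.Opens := ⨆ f : 𝒮, f.1.locus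

variable {Φ} in
lemma unionLocus_le {𝒮 : Set (PosInvariant Φ)} (h : 𝒮 ⊆ finitelyGenerated Φ) :
    unionLocus 𝒮 ≤ semistable Φ :=
  iSup_le fun f => le_iSup (fun g : finitelyGenerated Φ => g.1.locus) ⟨f.1, h f.2⟩

/-- The enveloping quotient of `X`: the open subscheme of `Proj S^H` that is the union of the
affine open sets `Spec (S^H)_{(f)}` for `f` in `I^{ss,fg}`. -/
def envelopingQuotient : (projOver (grading Φ)).left.Opens :=
  ⨆ f : finitelyGenerated Φ, Proj.basicOpen (grading Φ) f.1.elem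

/-- The canonical map `q` from `X^{ss,fg}` to the enveloping quotient. -/
def quotientMap : (semistable Φ).toScheme ⟶ (projOver (grading Φ)).left :=
  PosInvariant.glue fun f : finitelyGenerated Φ => f.1

variable {Φ} {U : X.left.Opens} (hU : U ≤ semistable Φ)

/-- The restriction `q|_U` to an open set `U ⊆ X^{ss,fg}`. -/
def quotientMapOn : U.toScheme ⟶ (projOver (grading Φ)).left :=
  X.left.homOfLE hU ≫ quotientMap Φ

/-- `𝒰` is an inner enveloping quotient of `U`: a quasi-compact open subscheme of the enveloping
quotient that contains `q(U)`. -/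
structure IsInnerEnvelopingQuotient (𝒰 : (projOver (grading Φ)).left.Opens) : Prop where
  isCompact : IsCompact (𝒰 : Set (projOver (grading Φ)).left)
  le_envelopingQuotient : 𝒰 ≤ envelopingQuotient Φ
  range_subset : Set.range (quotientMapOn hU) ⊆ 𝒰

variable {hU}

/-- `q|_U` as a morphism to `𝒰`. -/
def IsInnerEnvelopingQuotient.map {𝒰 : (projOver (grading Φ)).left.Opens}
    (h : IsInnerEnvelopingQuotient hU 𝒰) : U.toScheme ⟶ 𝒰.toScheme :=
  IsOpenImmersion.lift 𝒰.ι (quotientMapOn hU)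
    (h.range_subset.trans (Scheme.Opens.range_ι 𝒰).ge)

end

section
variable {H X Z : Over (Spec (.of k))} [GrpObj H] [ModObj H X] {U : X.left.Opens}

variable (H) in
/-- The morphism `φ : U → Z` is `H`-invariant, `φ (h x) = φ x`: its composites with the projection
and with the action agree on the open set of `(h, x)` in `H × X` with `x` and `h x` in `U` (which is
`H × U` if `U` is stable under `H`). -/
def IsInvariantMorphism (φ : openOver U ⟶ Z) : Prop :=
  let V := (snd H X).left ⁻¹ᵁ U ⊓ (act H X).left ⁻¹ᵁ U
  (snd H X).left.resLE U V inf_le_left ≫ φ.left = (act H X).left.resLE U V inf_le_right ≫ φ.left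

variable {L : X.left.Modules} [IsInvertible L] (Φ : Linearisation H X L)
  {φ : openOver U ⟶ Z} {M : Z.left.Modules} {r : ℕ}

/-- The section `φ^* m` of `φ^* M`. -/
def pullbackSection (φ : openOver U ⟶ Z) {W : Z.left.Opens} (m : Γ(M, W)) :
    Γ((Scheme.Modules.pullback φ.left).obj M, φ.left ⁻¹ᵁ W) :=
  ((Scheme.Modules.pullbackPushforwardAdjunction φ.left).unit.app M).app W m

/-- The isomorphism `θ : φ^* M ≅ L^{⊗ r}|_U` respects the linearisations, where `H` acts on `φ^* M`
as it does on the pullback of a line bundle along an invariant morphism, that is, such that the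
pulled back local sections `φ^* m` are invariant. These generate `φ^* M`, so that `θ` is equivariant
if and only if it takes each of them to an invariant section of `L^{⊗ r}`. -/
def IsEquivariantIso (θ : (Scheme.Modules.pullback φ.left).obj M ≅ (tensorPow L r).restrict U.ι) :
    Prop :=
  ∀ (W : Z.left.Opens) (m : Γ(M, W)),
    Φ.IsInvariant (V := U.ι ''ᵁ φ.left ⁻¹ᵁ W)
      (θ.hom.app (φ.left ⁻¹ᵁ W) (pullbackSection φ m) : tensorSections L r _).1
end

end

end

end EnvQuot

open EnvQuot

/-!
The proof covers `U` by open sets `X_h` on which `φ` visibly factors through `D_+(h)`, and glues.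

Let `f ∈ 𝒮`, and let `h` be an invariant multiple of `f` such that `φ` maps `X_h` to an affine open
set `W` of `Z`. Functions on `W` pull back to invariant functions on `X_h`, and the invariant
functions on `X_h` are exactly the elements of `(S^H)_{(h)}` (`awayToSections_injective`,
`exists_awayToSections_eq`), so that `φ` factors on `X_h` through `D_+(h) = Spec (S^H)_{(h)}`
(`exists_descent`). Behind this is that an invariant section over `X_h` extends to an invariant on
`X` after multiplication by a power of `h` (`exists_invariant_extension`): a section extends because
`X` is quasi-compact and integral, and since the difference of its two pullbacks to `H × X` vanishes
where the pullback of `h` does not, it is killed by a further power of `h`.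

There are enough such `h` (`exists_chart`). Near a given point of `Z`, the line bundle `M` is
generated by a global section `m` that comes from a coordinate of the projective space. Then `φ^* m`
is an invariant section of `L^{⊗ r}` over `U`, and `f ^ N φ^* m` extends to an invariant `s` for some
`N`. The open set `X_{f s}` is the part of `X_f` that is mapped to the locus where `m` generates `M`.
As `Z` is only quasi-projective, that locus need not be affine, but some function `g` on it has an
affine nonvanishing locus around the given point, and the same argument applied to the invariant
function `φ^* g` gives `h`. Moreover the fraction `s / f ^ N` represents `φ^* m`, and generates
`𝒪(r)` on `D_+(h)`. These data form a `Chart`.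

Finitely many charts suffice, since `U` is quasi-compact. The image of `X_h` in `D_+(h)` is dense,
`Proj S^H` is reduced and `Z` is separated. Therefore the morphisms `D_+(h) → Z` agree on overlaps
and glue to a morphism on the union of the `D_+(h)`, which is an inner enveloping quotient
(`exists_factorisation`, `isInnerEnvelopingQuotient_iSup_basicOpen`). The same density gives the
uniqueness statement (`homOfLE_comp_eq_of_map_comp_eq`). Finally, the sections `m` of `M` and the
fractions `s / f ^ N` of the charts have the same transition functions, as an identity between
invariants can be checked on the nonempty open set `X_{h h'}` of `X`, where the fractions become the
sections `φ^* m` (`Chart.frac_eq`). Hence `M` pulls back to `𝒪(r)`.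
-/

namespace EnvQuot

noncomputable section

/-! ### Sections and frames of sheaves of modules -/

section modules
variable {X Y : Scheme.{u}} {L N : X.Modules}

/-- The restriction of a section of a sheaf of modules. -/
abbrev resSec (L : X.Modules) {U V : X.Opens} (h : V ≤ U) (e : Γ(L, U)) : Γ(L, V) :=
  L.presheaf.map (homOfLE h).op e

/-- The restriction of a function. -/
abbrev resFun {U V : X.Opens} (h : V ≤ U) (e : Γ(X, U)) : Γ(X, V) :=
  X.presheaf.map (homOfLE h).op e

lemma resSec_resSec {U V W : X.Opens} (h : V ≤ U) (h' : W ≤ V) (e : Γ(L, U)) :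
    resSec L h' (resSec L h e) = resSec L (h'.trans h) e := by
  rw [resSec, resSec, ← ConcreteCategory.comp_apply, ← Functor.map_comp]
  rfl

lemma resFun_resFun {U V W : X.Opens} (h : V ≤ U) (h' : W ≤ V) (e : Γ(X, U)) :
    resFun h' (resFun h e) = resFun (h'.trans h) e := by
  rw [resFun, resFun, ← ConcreteCategory.comp_apply, ← Functor.map_comp]
  rfl

lemma resSec_self {U : X.Opens} (e : Γ(L, U)) : resSec L le_rfl e = e :=
  congr($(L.presheaf.map_id (op U)) e)

lemma resFun_self {U : X.Opens} (e : Γ(X, U)) : resFun le_rfl e = e :=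
  congr($(X.presheaf.map_id (op U)) e)

lemma resSec_smul {U V : X.Opens} (h : V ≤ U) (c : Γ(X, U)) (e : Γ(L, U)) :
    resSec L h (c • e) = resFun h c • resSec L h e :=
  Scheme.Modules.map_smul L (homOfLE h) c e

lemma app_resSec (φ : L ⟶ N) {U V : X.Opens} (h : V ≤ U) (e : Γ(L, U)) :
    φ.app V (resSec L h e) = resSec N h (φ.app U e) :=
  congr($(φ.mapPresheaf.naturality (homOfLE h).op) e)

lemma app_resFun (f : Y ⟶ X) {U V : X.Opens} (h : V ≤ U) (c : Γ(X, U)) :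
    f.app V (resFun h c) = resFun (f.preimage_mono h) (f.app U c) :=
  congr($(f.naturality (homOfLE h).op) c)

lemma smul_restrict (f : Y ⟶ X) [IsOpenImmersion f] {U : Y.Opens} (c : Γ(Y, U))
    (e : Γ(L.restrict f, U)) :
    c • e = ((f.appIso U).inv c • (show Γ(L, f ''ᵁ U) from e) : Γ(L, f ''ᵁ U)) := rfl

/-- A homomorphism of sheaves of modules from compatible maps on sections. -/
def homMk (φ : ∀ U : X.Opens, Γ(L, U) →+ Γ(N, U))
    (hsmul : ∀ U (c : Γ(X, U)) (s : Γ(L, U)), φ U (c • s) = c • φ U s)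
    (hres : ∀ U V (h : V ≤ U) (s : Γ(L, U)), φ V (resSec L h s) = resSec N h (φ U s)) : L ⟶ N :=
  ⟨PresheafOfModules.homMk
    { app U := AddCommGrpCat.ofHom (φ U.unop)
      naturality U V i := by
        ext s
        exact hres U.unop V.unop i.unop.le s }
    fun U c s => hsmul U.unop c s⟩

lemma hom_ext_apply {φ ψ : L ⟶ N} (h : ∀ U (s : Γ(L, U)), φ.app U s = ψ.app U s) : φ = ψ := by
  apply Scheme.Modules.hom_ext
  intro U
  ext s
  exact h U s

lemma IsFrame.res {U V : X.Opens} {e : Γ(L, U)} (he : IsFrame L e) (h : V ≤ U) :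
    IsFrame L (resSec L h e) := by
  intro W hW
  have := he W (hW.trans h)
  convert this using 3
  exact resSec_resSec h hW e

lemma IsFrame.existsUnique {U V : X.Opens} {e : Γ(L, U)} (he : IsFrame L e) (h : V ≤ U)
    (s : Γ(L, V)) : ∃! c : Γ(X, V), c • resSec L h e = s :=
  (he V h).existsUnique s

lemma IsFrame.map_iso {U : X.Opens} {e : Γ(L, U)} (he : IsFrame L e) (φ : L ≅ N) :
    IsFrame N (φ.hom.app U e) := by
  intro V hV
  have h1 : Function.Bijective (φ.hom.app V) := ConcreteCategory.bijective_of_isIso _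
  have := h1.comp (he V hV)
  convert this using 1
  funext c
  change _ = φ.hom.app V (c • resSec L hV e)
  rw [Scheme.Modules.Hom.app_smul, app_resSec]

lemma IsFrame.eq_of_smul_eq {U : X.Opens} {e : Γ(L, U)} (he : IsFrame L e) {c d : Γ(X, U)}
    (h : c • e = d • e) : c = d := by
  apply (he U le_rfl).1
  change c • resSec L le_rfl e = d • resSec L le_rfl e
  rwa [resSec_self]

lemma section_ext_of_cover {J : Type*} {V : J → X.Opens} {U : X.Opens} (hV : U ≤ ⨆ j, V j)
    {s t : Γ(L, U)} (h : ∀ j, resSec L inf_le_left s = resSec L (inf_le_left : U ⊓ V j ≤ U) t) :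
    s = t := by
  refine TopCat.Sheaf.eq_of_locally_eq' ⟨L.presheaf, L.isSheaf⟩ (fun j => U ⊓ V j) U
    (fun j => homOfLE inf_le_left) ?_ s t h
  rw [← inf_iSup_eq]
  exact le_inf le_rfl hV

lemma exists_glue {J : Type*} {V : J → X.Opens} {U : X.Opens} (hV : U ≤ ⨆ j, V j)
    (s : ∀ j, Γ(L, U ⊓ V j))
    (h : ∀ i j, resSec L (le_inf inf_le_left (inf_le_right.trans inf_le_left)) (s i) =
      resSec L (V := U ⊓ (V i ⊓ V j)) (le_inf inf_le_left (inf_le_right.trans inf_le_right)) (s j)) :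
    ∃ t : Γ(L, U), ∀ j, resSec L inf_le_left t = s j := by
  obtain ⟨t, ht, -⟩ := TopCat.Sheaf.existsUnique_gluing' ⟨L.presheaf, L.isSheaf⟩
    (fun j => U ⊓ V j) U (fun j => homOfLE inf_le_left)
    (by rw [← inf_iSup_eq]; exact le_inf le_rfl hV) s (fun i j => by
      have h1 : (U ⊓ V i) ⊓ (U ⊓ V j) ≤ U ⊓ (V i ⊓ V j) :=
        le_inf (inf_le_left.trans inf_le_left)
          (le_inf (inf_le_left.trans inf_le_right) (inf_le_right.trans inf_le_right))
      have h2 := congrArg (resSec L h1) (h i j)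
      rw [resSec_resSec, resSec_resSec] at h2
      exact h2)
  exact ⟨t, ht⟩

end modules

/-! ### Invertible sheaves with the same transition functions -/

section gluing
variable {X : Scheme.{u}} {J : Type*} {V : J → X.Opens}

/-- The sections `s` of `P` and `t` of `N` over `U` have the same coordinates with respect to
given families of sections `p` and `n`. -/
def SameCoord {P N : X.Modules} (p : ∀ j, Γ(P, V j)) (n : ∀ j, Γ(N, V j)) {U : X.Opens}
    (s : Γ(P, U)) (t : Γ(N, U)) : Prop :=
  ∀ (j : J) (W : X.Opens) (hU : W ≤ U) (hj : W ≤ V j) (c : Γ(X, W)),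
    resSec P hU s = c • resSec P hj (p j) → resSec N hU t = c • resSec N hj (n j)

variable {P N : X.Modules} {p : ∀ j, Γ(P, V j)} {n : ∀ j, Γ(N, V j)} {U : X.Opens}

lemma SameCoord.symm (hp : ∀ j, IsFrame P (p j)) (hn : ∀ j, IsFrame N (n j)) {s : Γ(P, U)}
    {t : Γ(N, U)} (h : SameCoord p n s t) : SameCoord n p t s := by
  intro j W hU hj c hc
  obtain ⟨c', hc', -⟩ := (hp j).existsUnique hj (resSec P hU s)
  have := h j W hU hj c' hc'.symm
  rw [((hn j).res hj).eq_of_smul_eq (hc.symm.trans this)]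
  exact hc'.symm

lemma SameCoord.res {s : Γ(P, U)} {t : Γ(N, U)} (h : SameCoord p n s t) {U' : X.Opens}
    (hU' : U' ≤ U) : SameCoord p n (resSec P hU' s) (resSec N hU' t) := by
  intro j W hU hj c hc
  rw [resSec_resSec] at hc ⊢
  exact h j W _ hj c hc

lemma SameCoord.smul (hp : ∀ j, IsFrame P (p j)) {s : Γ(P, U)} {t : Γ(N, U)}
    (h : SameCoord p n s t) (a : Γ(X, U)) : SameCoord p n (a • s) (a • t) := by
  intro j W hU hj c hc
  obtain ⟨c', hc', -⟩ := (hp j).existsUnique hj (resSec P hU s)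
  rw [resSec_smul, ← hc', smul_smul] at hc
  rw [resSec_smul, h j W hU hj c' hc'.symm, smul_smul, ((hp j).res hj).eq_of_smul_eq hc]

lemma SameCoord.add (hp : ∀ j, IsFrame P (p j)) {s s' : Γ(P, U)} {t t' : Γ(N, U)}
    (h : SameCoord p n s t) (h' : SameCoord p n s' t') : SameCoord p n (s + s') (t + t') := by
  intro j W hU hj c hc
  obtain ⟨d, hd, -⟩ := (hp j).existsUnique hj (resSec P hU s)
  obtain ⟨d', hd', -⟩ := (hp j).existsUnique hj (resSec P hU s')
  rw [resSec, map_add, ← resSec, ← resSec, ← hd, ← hd', ← add_smul] at hc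
  rw [resSec, map_add, ← resSec, ← resSec, h j W hU hj d hd.symm, h' j W hU hj d' hd'.symm,
    ← add_smul, ((hp j).res hj).eq_of_smul_eq hc]

lemma SameCoord.unique (hp : ∀ j, IsFrame P (p j)) (hV : ⨆ j, V j = ⊤) {s : Γ(P, U)}
    {t t' : Γ(N, U)} (h : SameCoord p n s t) (h' : SameCoord p n s t') : t = t' := by
  refine section_ext_of_cover (le_top.trans hV.ge) fun j => ?_
  obtain ⟨d, hd, -⟩ := (hp j).existsUnique inf_le_right (resSec P (inf_le_left : U ⊓ V j ≤ U) s)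
  rw [h j _ inf_le_left inf_le_right d hd.symm, h' j _ inf_le_left inf_le_right d hd.symm]

/-- The families of sections `p` and `n` have the same transition functions. -/
def SameTransition (p : ∀ j, Γ(P, V j)) (n : ∀ j, Γ(N, V j)) : Prop :=
  ∀ (i j : J) (u : Γ(X, V i ⊓ V j)),
    resSec P inf_le_left (p i) = u • resSec P inf_le_right (p j) →
      resSec N inf_le_left (n i) = u • resSec N inf_le_right (n j)

lemma SameTransition.exists_sameCoord (h : SameTransition p n) (hp : ∀ j, IsFrame P (p j))
    (hV : ⨆ j, V j = ⊤) (s : Γ(P, U)) : ∃ t : Γ(N, U), SameCoord p n s t := by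
  choose c hc _ using fun j =>
    (hp j).existsUnique inf_le_right (resSec P (inf_le_left : U ⊓ V j ≤ U) s)
  dsimp only at hc
  have key (i j) (W : X.Opens) (hU : W ≤ U) (hi : W ≤ V i) (hj : W ≤ V j) (d : Γ(X, W))
      (hd : resSec P hU s = d • resSec P hj (p j)) :
      resFun (le_inf hU hi) (c i) • resSec N hi (n i) = d • resSec N hj (n j) := by
    obtain ⟨u, hu, -⟩ := (hp j).existsUnique inf_le_right
      (resSec P (inf_le_left : V i ⊓ V j ≤ V i) (p i))
    have h1 := congrArg (resSec N (le_inf hi hj)) (h i j u hu.symm)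
    have h2 := congrArg (resSec P (le_inf hi hj)) hu
    have h3 := congrArg (resSec P (le_inf hU hi)) (hc i)
    simp only [resSec_smul, resSec_resSec] at h1 h2 h3
    rw [h1, smul_smul]
    congr 1
    apply ((hp j).res hj).eq_of_smul_eq
    rw [← smul_smul, h2, h3, hd]
  obtain ⟨t, ht⟩ := exists_glue (L := N) (V := V) (U := U) (le_top.trans hV.ge)
    (fun j => c j • resSec N inf_le_right (n j)) (fun i j => by
      simp only [resSec_smul, resSec_resSec]
      refine key i j _ inf_le_left _ _ _ ?_
      have h3 := congrArg (resSec P (le_inf inf_le_left (inf_le_right.trans inf_le_right) :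
        U ⊓ (V i ⊓ V j) ≤ U ⊓ V j)) (hc j)
      simp only [resSec_smul, resSec_resSec] at h3
      exact h3.symm)
  refine ⟨t, fun j W hU hj d hd => ?_⟩
  refine section_ext_of_cover (le_top.trans hV.ge) fun i => ?_
  have h1 := congrArg (resSec N (inf_le_inf_right (V i) hU)) (ht i)
  simp only [resSec_smul, resSec_resSec] at h1 ⊢
  rw [h1]
  refine key i j _ (inf_le_left.trans hU) _ _ _ ?_
  rw [← resSec_resSec hU inf_le_left, hd, resSec_smul, resSec_resSec]

/-- A homomorphism between sheaves with frames that have the same transition functions. -/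
def SameTransition.hom (h : SameTransition p n) (hp : ∀ j, IsFrame P (p j))
    (hV : ⨆ j, V j = ⊤) : P ⟶ N :=
  homMk (fun U => AddMonoidHom.mk' (fun s => (h.exists_sameCoord hp hV (U := U) s).choose)
      fun s t => ((h.exists_sameCoord hp hV _).choose_spec).unique hp hV
        ((h.exists_sameCoord hp hV s).choose_spec.add hp (h.exists_sameCoord hp hV t).choose_spec))
    (fun _ c s => ((h.exists_sameCoord hp hV _).choose_spec).unique hp hV
      ((h.exists_sameCoord hp hV s).choose_spec.smul hp c))
    (fun _ _ hV' s => ((h.exists_sameCoord hp hV _).choose_spec).unique hp hV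
      ((h.exists_sameCoord hp hV s).choose_spec.res hV'))

lemma SameTransition.sameCoord_hom (h : SameTransition p n) (hp : ∀ j, IsFrame P (p j))
    (hV : ⨆ j, V j = ⊤) (s : Γ(P, U)) : SameCoord p n s ((h.hom hp hV).app U s) :=
  (h.exists_sameCoord hp hV (U := U) s).choose_spec

lemma SameTransition.symm (h : SameTransition p n) (hp : ∀ j, IsFrame P (p j))
    (hn : ∀ j, IsFrame N (n j)) : SameTransition n p := by
  intro i j u hu
  obtain ⟨v, hv, -⟩ := (hp j).existsUnique inf_le_right
    (resSec P (inf_le_left : V i ⊓ V j ≤ V i) (p i))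
  rw [((hn j).res inf_le_right).eq_of_smul_eq (hu.symm.trans (h i j v hv.symm))]
  exact hv.symm

/-- Invertible sheaves with the same transition functions are isomorphic. -/
def SameTransition.iso (h : SameTransition p n) (hp : ∀ j, IsFrame P (p j))
    (hn : ∀ j, IsFrame N (n j)) (hV : ⨆ j, V j = ⊤) : P ≅ N where
  hom := h.hom hp hV
  inv := (h.symm hp hn).hom hn hV
  hom_inv_id := hom_ext_apply fun U s =>
    ((h.symm hp hn).sameCoord_hom hn hV ((h.hom hp hV).app U s)).unique hn hV
      ((h.sameCoord_hom hp hV s).symm hp hn)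
  inv_hom_id := hom_ext_apply fun U s =>
    (h.sameCoord_hom hp hV (((h.symm hp hn).hom hn hV).app U s)).unique hp hV
      (((h.symm hp hn).sameCoord_hom hn hV s).symm hn hp)

end gluing

section pullback
variable {X Y : Scheme.{u}} (f : Y ⟶ X) (M : X.Modules)

/-- The pullback `f^* m` of a section `m` of `M`, as a section of `f^* M`. -/
def pullSec {W : X.Opens} (m : Γ(M, W)) : Γ((Scheme.Modules.pullback f).obj M, f ⁻¹ᵁ W) :=
  ((Scheme.Modules.pullbackPushforwardAdjunction f).unit.app M).app W m

lemma pullSec_smul {W : X.Opens} (c : Γ(X, W)) (m : Γ(M, W)) :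
    pullSec f M (c • m) = f.app W c • pullSec f M m :=
  Scheme.Modules.Hom.app_smul _ _ _

lemma pullSec_res {W W' : X.Opens} (h : W' ≤ W) (m : Γ(M, W)) :
    pullSec f M (resSec M h m) = resSec _ (f.preimage_mono h) (pullSec f M m) :=
  app_resSec _ _ _

/-- Homomorphisms out of `f^* M` that agree on the pulled back sections are equal. -/
lemma pullback_hom_ext {N : Y.Modules} {α β : (Scheme.Modules.pullback f).obj M ⟶ N}
    (h : ∀ (W : X.Opens) (m : Γ(M, W)), α.app _ (pullSec f M m) = β.app _ (pullSec f M m)) :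
    α = β := by
  apply ((Scheme.Modules.pullbackPushforwardAdjunction f).homEquiv _ _).injective
  rw [Adjunction.homEquiv_unit, Adjunction.homEquiv_unit]
  exact hom_ext_apply h

lemma exists_pullback_desc {N : Y.Modules} (α : M ⟶ (Scheme.Modules.pushforward f).obj N) :
    ∃ β : (Scheme.Modules.pullback f).obj M ⟶ N, ∀ (W : X.Opens) (m : Γ(M, W)),
      β.app _ (pullSec f M m) = α.app W m := by
  obtain ⟨β, rfl⟩ :=
    ((Scheme.Modules.pullbackPushforwardAdjunction f).homEquiv _ _).surjective α
  refine ⟨β, fun W m => ?_⟩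
  rw [Adjunction.homEquiv_unit]
  rfl

/-- The sheaf `V ↦ N(V₀ ∩ V)`, that is, `j_* j^* N` for the inclusion `j` of the open set `V₀`. -/
def extendRestrict (N : X.Modules) (V : X.Opens) : X.Modules :=
  (Scheme.Modules.pushforward V.ι).obj (N.restrict V.ι)

lemma extendRestrict_smul (N : X.Modules) (V : X.Opens) {W : X.Opens} (c : Γ(X, W))
    (s : Γ(extendRestrict N V, W)) :
    c • s = (resFun (V.ι.image_preimage_le W) c •
      (show Γ(N, V.ι ''ᵁ V.ι ⁻¹ᵁ W) from s) : Γ(N, V.ι ''ᵁ V.ι ⁻¹ᵁ W)) := by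
  change (V.ι.appIso _).inv (V.ι.app W c) • (show Γ(N, V.ι ''ᵁ V.ι ⁻¹ᵁ W) from s) = _
  congr 1
  exact congr($(V.ι.app_appIso_inv W) c)

lemma extendRestrict_res (N : X.Modules) (V : X.Opens) {W W' : X.Opens} (h : W' ≤ W)
    (s : Γ(extendRestrict N V, W)) :
    resSec (extendRestrict N V) h s = resSec N (V.ι.image_mono (V.ι.preimage_mono h))
      (show Γ(N, V.ι ''ᵁ V.ι ⁻¹ᵁ W) from s) := rfl

end pullback

/-! ### Frames of pullbacks -/

section pullbackFrame
variable {X Y : Scheme.{u}} (f : Y ⟶ X) {M : X.Modules}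

lemma image_preimage_ι_le (V A : X.Opens) : V.ι ''ᵁ V.ι ⁻¹ᵁ A ≤ V ⊓ A := by
  rw [Scheme.Hom.image_preimage_eq_opensRange_inf, Scheme.Opens.opensRange_ι]

lemma le_image_preimage_ι (V A : X.Opens) : V ⊓ A ≤ V.ι ''ᵁ V.ι ⁻¹ᵁ A := by
  rw [Scheme.Hom.image_preimage_eq_opensRange_inf, Scheme.Opens.opensRange_ι]

lemma resFun_one {U V : X.Opens} (h : V ≤ U) : resFun h (1 : Γ(X, U)) = 1 := map_one _

/-- The structure sheaf as a sheaf of modules. -/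
abbrev structureModule (X : Scheme.{u}) : X.Modules := SheafOfModules.unit X.ringCatSheaf

/-- A section of `j_* j^* N` as a section of `N`. -/
def extSec (N : X.Modules) {V A : X.Opens} (s : Γ(extendRestrict N V, A)) :
    Γ(N, V.ι ''ᵁ V.ι ⁻¹ᵁ A) := s

/-- A section of `j_* j^* 𝒪` as a function. -/
def extFun {V A : X.Opens} (s : Γ(extendRestrict (structureModule X) V, A)) :
    Γ(X, V.ι ''ᵁ V.ι ⁻¹ᵁ A) := s

lemma extFun_add {V A : X.Opens} (s t : Γ(extendRestrict (structureModule X) V, A)) :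
    extFun (s + t) = extFun s + extFun t := rfl

lemma extFun_smul {V A : X.Opens} (c : Γ(X, A)) (s : Γ(extendRestrict (structureModule X) V, A)) :
    extFun (c • s) = resFun (V.ι.image_preimage_le A) c * extFun s :=
  extendRestrict_smul (structureModule X) V c s

lemma extFun_res {V A B : X.Opens} (h : B ≤ A) (s : Γ(extendRestrict (structureModule X) V, A)) :
    extFun (resSec _ h s) = resFun (V.ι.image_mono (V.ι.preimage_mono h)) (extFun s) := rfl

/-- The coordinate map `f^* M → j_* 𝒪` of a frame `m` of `M` over `W`, where `j` is the inclusion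
of the preimage of `W`. -/
lemma exists_coordinate {W : X.Opens} {m : Γ(M, W)} (hm : IsFrame M m) :
    ∃ ρ : (Scheme.Modules.pullback f).obj M ⟶ extendRestrict (structureModule Y) (f ⁻¹ᵁ W),
      ∀ (W' : X.Opens) (hW : W' ≤ W) (c : Γ(X, W')) (m' : Γ(M, W')),
        m' = c • resSec M hW m → extFun (ρ.app _ (pullSec f M m')) =
          resFun ((f ⁻¹ᵁ W).ι.image_preimage_le _) (f.app W' c) := by
  choose c hc hc' using fun (W' : X.Opens) (m' : Γ(M, W')) =>
    hm.existsUnique inf_le_left (resSec M (inf_le_right : W ⊓ W' ≤ W') m')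
  dsimp only at hc hc'
  have hle (W' : X.Opens) : (f ⁻¹ᵁ W).ι ''ᵁ (f ⁻¹ᵁ W).ι ⁻¹ᵁ (f ⁻¹ᵁ W') ≤ f ⁻¹ᵁ (W ⊓ W') :=
    image_preimage_ι_le _ _
  obtain ⟨ρ, hρ⟩ := exists_pullback_desc f M (N := extendRestrict (structureModule Y) (f ⁻¹ᵁ W))
    (homMk (fun W' => AddMonoidHom.mk' (fun m' => (resFun (hle W') (f.app _ (c W' m')) : Γ(Y, _)))
      fun m' m'' => by
        rw [← hc' W' (m' + m'') (c W' m' + c W' m'')]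
        · simp only [map_add]
          rfl
        · rw [add_smul, hc, hc, resSec, resSec, resSec, map_add])
      (fun W' a m' => by
        refine Eq.trans ?_ (extendRestrict_smul (structureModule Y) (f ⁻¹ᵁ W) (f.app W' a)
          (resFun (hle W') (f.app _ (c W' m')))).symm
        change resFun (hle W') (f.app _ (c W' (a • m'))) = resFun _ (f.app W' a) *
          resFun (hle W') (f.app _ (c W' m'))
        rw [← hc' W' (a • m') (resFun inf_le_right a * c W' m'), map_mul, app_resFun]
        · simp only [map_mul]
          congr 1
          exact resFun_resFun _ _ _
        · rw [← smul_smul, hc, resSec_smul])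
      (fun W' W'' h m' => by
        refine Eq.trans ?_ (extendRestrict_res (structureModule Y) (f ⁻¹ᵁ W) (f.preimage_mono h)
          (resFun (hle W') (f.app _ (c W' m')))).symm
        change resFun (hle W'') (f.app _ (c W'' (resSec M h m'))) = resFun _
          (resFun (hle W') (f.app _ (c W' m')))
        rw [← hc' W'' (resSec M h m') (resFun (inf_le_inf_left W h) (c W' m')), app_resFun,
          resFun_resFun, resFun_resFun]
        have h1 := congrArg (resSec M (inf_le_inf_left W h)) (hc W' m')
        rw [resSec_smul, resSec_resSec, resSec_resSec] at h1
        rw [h1, resSec_resSec]))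
  refine ⟨ρ, fun W' hW a m' h => ?_⟩
  rw [hρ]
  change resFun (hle W') (f.app _ (c W' m')) = _
  rw [← hc' W' m' (resFun inf_le_right a), app_resFun, resFun_resFun]
  rw [h, resSec_smul, resSec_resSec]

lemma image_preimage_ι_le_left (V A : X.Opens) : V.ι ''ᵁ V.ι ⁻¹ᵁ A ≤ V :=
  (image_preimage_ι_le V A).trans inf_le_left

lemma exists_extendRestrict (F : X.Modules) (V : X.Opens) :
    ∃ α : F ⟶ extendRestrict F V, ∀ (A : X.Opens) (s : Γ(F, A)),
      extSec F (α.app A s) = resSec F (V.ι.image_preimage_le A) s :=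
  ⟨(Scheme.Modules.restrictAdjunction V.ι).unit.app F, fun _ _ => rfl⟩

lemma exists_smul_extendRestrict {F : X.Modules} {V : X.Opens}
    (ρ : F ⟶ extendRestrict (structureModule X) V) (e : Γ(F, V)) :
    ∃ β : F ⟶ extendRestrict F V, ∀ (A : X.Opens) (s : Γ(F, A)),
      extSec F (β.app A s) = extFun (ρ.app A s) • resSec F (image_preimage_ι_le_left V A) e :=
  ⟨homMk
    (fun A => AddMonoidHom.mk'
      (fun s => (extFun (ρ.app A s) • resSec F (image_preimage_ι_le_left V A) e : Γ(F, _)))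
      fun s t => by
        rw [map_add, extFun_add]
        exact add_smul (extFun (ρ.app A s)) (extFun (ρ.app A t))
          (resSec F (image_preimage_ι_le_left V A) e))
    (fun A a s => by
      refine Eq.trans ?_ (extendRestrict_smul F V a
        (extFun (ρ.app A s) • resSec F (image_preimage_ι_le_left V A) e)).symm
      change extFun (ρ.app A (a • s)) • resSec F (image_preimage_ι_le_left V A) e = _
      rw [Scheme.Modules.Hom.app_smul, extFun_smul]
      exact mul_smul _ _ (resSec F (image_preimage_ι_le_left V A) e))
    (fun A B h s => by
      refine Eq.trans ?_ (extendRestrict_res F V h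
        (extFun (ρ.app A s) • resSec F (image_preimage_ι_le_left V A) e)).symm
      change extFun (ρ.app B (resSec F h s)) • resSec F (image_preimage_ι_le_left V B) e = _
      rw [resSec_smul, resSec_resSec, app_resSec, extFun_res]),
    fun _ _ => rfl⟩

/-- A section with value `1` under a coordinate map that determines all sections is a frame. -/
lemma isFrame_of_coordinate {F : X.Modules} {V : X.Opens}
    (ρ : F ⟶ extendRestrict (structureModule X) V) (e : Γ(F, V)) (he : extFun (ρ.app V e) = 1)
    (h : ∀ (A : X.Opens) (s : Γ(F, A)), resSec F (V.ι.image_preimage_le A) s =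
      extFun (ρ.app A s) • resSec F (image_preimage_ι_le_left V A) e) : IsFrame F e := by
  intro A hA
  have hA' : A ≤ V.ι ''ᵁ V.ι ⁻¹ᵁ A := (le_inf hA le_rfl).trans (le_image_preimage_ι _ _)
  have hρA (c : Γ(X, A)) : resFun hA' (extFun (ρ.app A (c • resSec F hA e))) = c := by
    rw [Scheme.Modules.Hom.app_smul, extFun_smul, app_resSec, extFun_res, he, resFun_one, mul_one,
      resFun_resFun, resFun_self]
  refine ⟨fun c d h => ?_, fun s => ?_⟩
  · have := congrArg (fun z => resFun hA' (extFun (ρ.app A z))) h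
    exact (hρA c).symm.trans (this.trans (hρA d))
  · have h2 : resSec F hA' (resSec F (V.ι.image_preimage_le A) s) = s :=
      (resSec_resSec _ _ _).trans (resSec_self s)
    rw [h A s, resSec_smul, resSec_resSec] at h2
    exact ⟨_, h2⟩

/-- The pullback of a frame is a frame. As sections of `f^* M` have no explicit description, both
the coordinate map and the identity that a section is its coordinate times `f^* m` are expressed by
homomorphisms out of `f^* M`, which are determined by the pulled back sections. -/
lemma IsFrame.pullSec {W : X.Opens} {m : Γ(M, W)} (hm : IsFrame M m) :
    IsFrame ((Scheme.Modules.pullback f).obj M) (pullSec f M m) := by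
  obtain ⟨ρ, hρ⟩ := exists_coordinate f hm
  refine isFrame_of_coordinate ρ _ ?_ fun A s => ?_
  · have := hρ W le_rfl 1 m (by rw [one_smul, resSec_self])
    rwa [map_one, resFun_one] at this
  obtain ⟨α, hα⟩ := exists_extendRestrict ((Scheme.Modules.pullback f).obj M) (f ⁻¹ᵁ W)
  obtain ⟨β, hβ⟩ := exists_smul_extendRestrict ρ (EnvQuot.pullSec f M m)
  rw [← hα, ← hβ]
  suffices hαβ : α = β by rw [hαβ]
  apply pullback_hom_ext f M
  intro W' m'
  refine (hα _ _).trans (Eq.trans ?_ (hβ _ _).symm)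
  have hle : (f ⁻¹ᵁ W).ι ''ᵁ (f ⁻¹ᵁ W).ι ⁻¹ᵁ (f ⁻¹ᵁ W') ≤ f ⁻¹ᵁ (W ⊓ W') :=
    image_preimage_ι_le _ _
  obtain ⟨c, hc, -⟩ := hm.existsUnique inf_le_left (resSec M (inf_le_right : W ⊓ W' ≤ W') m')
  have h1 := congrArg (EnvQuot.pullSec f M) hc
  simp only [pullSec_smul, pullSec_res] at h1
  have h2 := congrArg (resSec _ hle) h1
  rw [resSec_smul, resSec_resSec, resSec_resSec] at h2
  refine h2.symm.trans ?_
  congr 1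
  have h3 := hρ (W ⊓ W') inf_le_left c _ hc.symm
  rw [pullSec_res, app_resSec, extFun_res] at h3
  have hle' : (f ⁻¹ᵁ W).ι ''ᵁ (f ⁻¹ᵁ W).ι ⁻¹ᵁ (f ⁻¹ᵁ W') ≤
      (f ⁻¹ᵁ W).ι ''ᵁ (f ⁻¹ᵁ W).ι ⁻¹ᵁ (f ⁻¹ᵁ (W ⊓ W')) :=
    (le_inf (image_preimage_ι_le_left _ _) hle).trans (le_image_preimage_ι _ _)
  have h4 := congrArg (resFun hle') h3
  rw [resFun_resFun] at h4
  rw [resFun_resFun, resFun_self] at h4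
  exact h4.symm

end pullbackFrame

/-! ### Sections of tensor powers -/

section
variable {X : Scheme.{u}} {L : X.Modules}

lemma germ_resFun {U V : X.Opens} (h : V ≤ U) (x : X) (hx : x ∈ V) (c : Γ(X, U)) :
    X.presheaf.germ V x hx (resFun h c) = X.presheaf.germ U x (h hx) c :=
  X.presheaf.germ_res_apply' (homOfLE h).op x hx c

lemma frameAt_resSec {U V : X.Opens} (h : V ≤ U) (e : Γ(L, U)) (x : X) (hx : x ∈ V) :
    frameAt (resSec L h e) x hx = frameAt e x (h hx) :=
  congrArg (TensorAlgebra.ι (X.presheaf.stalk x))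
    (L.presheaf.germ_res_apply' (homOfLE h).op x hx e)

lemma IsInvertible.exists_isAffineOpen [IsInvertible L] (x : X) (V : X.Opens) (hx : x ∈ V) :
    ∃ W : X.Opens, IsAffineOpen W ∧ x ∈ W ∧ W ≤ V ∧ ∃ e : Γ(L, W), IsFrame L e := by
  obtain ⟨U, hU, e, he⟩ := IsInvertible.exists_frame (L := L) x
  obtain ⟨W, hW, hxW, hle⟩ := Opens.isBasis_iff_nbhd.1 X.isBasis_affineOpens (U := U ⊓ V) ⟨hU, hx⟩
  exact ⟨W, hW, hxW, hle.trans inf_le_right, _, he.res (hle.trans inf_le_left)⟩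

lemma frameAt_pow_mem {U : X.Opens} (e : Γ(L, U)) (n : ℕ) :
    (fun x : U => frameAt e x.1 x.2 ^ n) ∈ tensorSections L n U := fun x =>
  ⟨U, x.2, 𝟙 _, AddSubgroup.subset_closure ⟨1, fun _ => e, fun y => by
    rw [map_one, one_smul, List.ofFn_const, List.prod_replicate]
    rfl⟩⟩

lemma IsFrame.isNonzeroAt_pow {U : X.Opens} {e : Γ(L, U)} (he : IsFrame L e) (n : ℕ) (x : X)
    (hx : x ∈ U) : IsNonzeroAt (frameAt e x hx ^ n) := by
  have := (isNonzeroAt_iff he x hx 1 n).2 isUnit_one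
  rwa [one_smul] at this

/-- A section of `L^{⊗ n}` has a coordinate function with respect to a frame of `L`. -/
lemma exists_coord_frame [IsInvertible L] {V W : X.Opens} {e : Γ(L, W)} (he : IsFrame L e)
    (h : W ≤ V) {n : ℕ} {s : ∀ x : V, TensorStalk L x.1} (hs : s ∈ tensorSections L n V) :
    ∃ a : Γ(X, W), ∀ x (hx : x ∈ W),
      s ⟨x, h hx⟩ = X.presheaf.germ W x hx a • frameAt e x hx ^ n := by
  obtain ⟨a, ha, -⟩ := existsUnique_div (res_mem_tensorSections h hs) (frameAt_pow_mem e n)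
    (fun x => he.isNonzeroAt_pow n x.1 x.2)
  exact ⟨a, fun x hx => ha ⟨x, hx⟩⟩

lemma smul_mem_tensorSections {V : X.Opens} {n : ℕ} {s : ∀ x : V, TensorStalk L x.1}
    (hs : s ∈ tensorSections L n V) (a : Γ(X, V)) :
    (fun x : V => X.presheaf.germ V x.1 x.2 a • s x) ∈ tensorSections L n V :=
  (tensorPredicate L n).smul_mem V a s hs

lemma pow_mem_tensorSections {V : X.Opens} {m : ℕ} {s : ∀ x : V, TensorStalk L x.1}
    (hs : s ∈ tensorSections L m V) (n : ℕ) :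
    (fun x : V => s x ^ n) ∈ tensorSections L (n * m) V := by
  induction n with
  | zero =>
    simp only [pow_zero, zero_mul]
    exact one_mem_tensorSections L V
  | succ n ih =>
    simp only [pow_succ, Nat.succ_mul]
    exact mul_mem_tensorSections ih hs

lemma mem_tensorSections_of_locally {V : X.Opens} {n : ℕ} {s : ∀ x : V, TensorStalk L x.1}
    (h : ∀ x : V, ∃ (W : X.Opens) (_ : x.1 ∈ W) (hW : W ≤ V),
      (fun y : W => s ⟨y.1, hW y.2⟩) ∈ tensorSections L n W) : s ∈ tensorSections L n V :=
  (tensorPredicate L n).locality s fun x => by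
    obtain ⟨W, hx, hW, h⟩ := h x
    exact ⟨W, hx, homOfLE hW, h⟩

/-- A frame of `L^{⊗ n}` vanishes nowhere. -/
lemma IsFrame.isNonzeroAt [IsInvertible L] {n : ℕ} {V : X.Opens} {t : Γ(tensorPow L n, V)}
    (ht : IsFrame (tensorPow L n) t) (x : V) : IsNonzeroAt ((show tensorSections L n V from t).1 x) := by
  obtain ⟨W, -, hxW, hWV, e, he⟩ := IsInvertible.exists_isAffineOpen (L := L) x.1 V x.2
  obtain ⟨a, ha⟩ := exists_coord_frame he hWV (show tensorSections L n V from t).2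
  obtain ⟨b, hb, -⟩ := ht.existsUnique hWV
    (show tensorSections L n W from ⟨_, frameAt_pow_mem e n⟩)
  have h1 : X.presheaf.germ W x.1 hxW b • (show tensorSections L n V from t).1 x =
      frameAt e x.1 hxW ^ n :=
    congrFun (congrArg Subtype.val hb) (⟨x.1, hxW⟩ : W)
  have h2 := ha x.1 hxW
  change (show tensorSections L n V from t).1 x = _ at h2
  rw [h2, isNonzeroAt_iff he]
  rw [h2, smul_smul] at h1
  have h3 := congrArg (coord he x.1 hxW) h1
  rw [coord_smul_pow, ← one_smul (X.presheaf.stalk x.1) (frameAt e x.1 hxW ^ n), coord_smul_pow] at h3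
  exact IsUnit.of_mul_eq_one _ ((mul_comm _ _).trans h3)

/-- Some power of a section `u` kills a section that vanishes where `u` does not. -/
lemma exists_pow_mul_eq_zero [IsInvertible L] [CompactSpace X] {m n : ℕ}
    {u d : ∀ x : (⊤ : X.Opens), TensorStalk L x.1} (hu : u ∈ tensorSections L m ⊤)
    (hd : d ∈ tensorSections L n ⊤) (h : ∀ x, IsNonzeroAt (u x) → d x = 0) :
    ∃ N : ℕ, ∀ x, u x ^ N * d x = 0 := by
  have loc (x : X) : ∃ (W : X.Opens) (_ : x ∈ W) (N : ℕ), ∀ y ∈ W, u ⟨y, trivial⟩ ^ N * d ⟨y, trivial⟩ = 0 := by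
    obtain ⟨W, hW, hxW, -, e, he⟩ := IsInvertible.exists_isAffineOpen (L := L) x ⊤ trivial
    obtain ⟨a, ha⟩ := exists_coord_frame he le_top hu
    obtain ⟨b, hb⟩ := exists_coord_frame he le_top hd
    obtain ⟨N, hN⟩ := exists_pow_mul_eq_zero_of_res_basicOpen_eq_zero_of_isAffineOpen X hW b a (by
      refine TopCat.Presheaf.section_ext X.sheaf _ _ _ fun y hy => ?_
      refine (germ_resFun (X.basicOpen_le a) y hy b).trans ?_
      have hyW := X.basicOpen_le a hy
      have h1 := h ⟨y, trivial⟩ (by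
        rw [ha y hyW, isNonzeroAt_iff he]
        exact (X.mem_basicOpen a y hyW).1 hy)
      rw [hb y hyW] at h1
      have h2 := congrArg (coord he y hyW) h1
      rw [coord_smul_pow, map_zero] at h2
      exact h2.trans (map_zero _).symm)
    refine ⟨W, hxW, N, fun y hy => ?_⟩
    rw [ha y hy, hb y hy, smul_pow, smul_mul_smul_comm, ← map_pow, ← map_mul, hN, map_zero, zero_smul]
  choose W hxW N hN using loc
  obtain ⟨T, hT⟩ := isCompact_univ.elim_finite_subcover (fun x : X => (W x : Set X))
    (fun x => (W x).2) fun x _ => Set.mem_iUnion.2 ⟨x, hxW x⟩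
  refine ⟨T.sup N, fun x => ?_⟩
  obtain ⟨i, hi⟩ := Set.mem_iUnion.1 (hT (Set.mem_univ x.1))
  obtain ⟨hiT, hxi⟩ := Set.mem_iUnion.1 hi
  obtain ⟨j, hj⟩ := Nat.exists_eq_add_of_le (Finset.le_sup (f := N) hiT)
  rw [hj, add_comm, pow_add, mul_assoc, hN i x.1 hxi, mul_zero]

/-- On an integral scheme, sections that agree on a nonempty open set are equal. -/
lemma tensorSections_ext [IsInvertible L] [IsIntegral X] {n : ℕ} {V O : X.Opens}
    (hO : (O : Set X).Nonempty) {s t : ∀ x : V, TensorStalk L x.1} (hs : s ∈ tensorSections L n V)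
    (ht : t ∈ tensorSections L n V) (h : ∀ x : V, x.1 ∈ O → s x = t x) : s = t := by
  funext x
  obtain ⟨W, -, hxW, hWV, e, he⟩ := IsInvertible.exists_isAffineOpen (L := L) x.1 V x.2
  obtain ⟨a, ha⟩ := exists_coord_frame he hWV hs
  obtain ⟨b, hb⟩ := exists_coord_frame he hWV ht
  have hne : Nonempty (W ⊓ O : X.Opens) := by
    obtain ⟨y, hy⟩ := nonempty_preirreducible_inter W.2 O.2 ⟨x.1, hxW⟩ hO
    exact ⟨⟨y, hy⟩⟩
  have hab : a = b := by
    apply map_injective_of_isIntegral X (homOfLE (inf_le_left : W ⊓ O ≤ W))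
    refine TopCat.Presheaf.section_ext X.sheaf _ _ _ fun y hy => ?_
    refine (germ_resFun inf_le_left y hy a).trans (Eq.trans ?_ (germ_resFun inf_le_left y hy b).symm)
    have h1 := h ⟨y, hWV hy.1⟩ hy.2
    rw [ha y hy.1, hb y hy.1] at h1
    have h2 := congrArg (coord he y hy.1) h1
    rwa [coord_smul_pow, coord_smul_pow] at h2
  have ha := ha x.1 hxW
  have hb := hb x.1 hxW
  rw [hab] at ha
  exact ha.trans hb.symm

/-- On a quasi-compact integral scheme, a section over the open set where `f` does not vanish
extends to the whole scheme after multiplication by a power of `f`. -/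
lemma exists_extension [IsInvertible L] [IsIntegral X] [CompactSpace X] {m n : ℕ}
    (f : tensorSections L m ⊤) (hf : (nonvanishing f : Set X).Nonempty)
    {t : ∀ x : nonvanishing f, TensorStalk L x.1} (ht : t ∈ tensorSections L n (nonvanishing f)) :
    ∃ (N : ℕ) (s : ∀ x : (⊤ : X.Opens), TensorStalk L x.1), s ∈ tensorSections L (N * m + n) ⊤ ∧
      ∀ x : nonvanishing f, s ⟨x.1, trivial⟩ = f.1 ⟨x.1, trivial⟩ ^ N * t x := by
  have loc (x : X) : ∃ (W : X.Opens) (_ : x ∈ W) (N₀ : ℕ), ∀ N ≥ N₀,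
      ∃ s ∈ tensorSections L (N * m + n) W, ∀ (y) (hy : y ∈ W) (hy' : y ∈ nonvanishing f),
        s ⟨y, hy⟩ = f.1 ⟨y, trivial⟩ ^ N * t ⟨y, hy'⟩ := by
    obtain ⟨W, hW, hxW, -, e, he⟩ := IsInvertible.exists_isAffineOpen (L := L) x ⊤ trivial
    obtain ⟨a, ha⟩ := exists_coord_frame he le_top f.2
    have hD : X.basicOpen a ≤ nonvanishing f := fun y hy => ⟨trivial, by
      rw [ha y (X.basicOpen_le a hy), isNonzeroAt_iff he]
      exact (X.mem_basicOpen a y (X.basicOpen_le a hy)).1 hy⟩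
    have hD' (y) (hy : y ∈ W) (hy' : y ∈ nonvanishing f) : y ∈ X.basicOpen a := by
      obtain ⟨_, h⟩ := hy'
      rw [ha y hy, isNonzeroAt_iff he] at h
      exact (X.mem_basicOpen a y hy).2 h
    obtain ⟨c, hc⟩ := exists_coord_frame (he.res (X.basicOpen_le a)) hD ht
    obtain ⟨N₀, b, hb⟩ := exists_eq_pow_mul_of_isAffineOpen X W hW a c
    refine ⟨W, hxW, N₀, fun N hN => ⟨_, smul_mem_tensorSections (frameAt_pow_mem e _)
      (a ^ (N - N₀) * b), fun y hy hy' => ?_⟩⟩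
    have hyD := hD' y hy hy'
    have h1 := congrArg (X.presheaf.germ _ y hyD) hb
    have h2 : X.presheaf.germ W y hy b = X.presheaf.germ W y hy a ^ N₀ *
        X.presheaf.germ _ y hyD c := by
      refine (germ_resFun (X.basicOpen_le a) y hyD b).symm.trans (h1.trans ?_)
      rw [map_mul, map_pow]
      congr 2
      exact germ_resFun (X.basicOpen_le a) y hyD a
    dsimp only
    rw [ha y hy, hc y hyD, frameAt_resSec, smul_pow, smul_mul_smul_comm, ← pow_mul, ← pow_add,
      map_mul, map_pow, h2, ← mul_assoc, ← pow_add, Nat.sub_add_cancel hN, mul_comm m N]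
  choose W hxW N₀ hN₀ using loc
  obtain ⟨T, hT⟩ := isCompact_univ.elim_finite_subcover (fun x : X => (W x : Set X))
    (fun x => (W x).2) fun x _ => Set.mem_iUnion.2 ⟨x, hxW x⟩
  have hT' (x : X) : ∃ i ∈ T, x ∈ W i := by
    obtain ⟨i, hi⟩ := Set.mem_iUnion.1 (hT (Set.mem_univ x))
    obtain ⟨hiT, hxi⟩ := Set.mem_iUnion.1 hi
    exact ⟨i, hiT, hxi⟩
  choose i hiT hi using hT'
  choose s hs hst using fun x => hN₀ (i x) (T.sup N₀) (Finset.le_sup (hiT x))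
  refine ⟨T.sup N₀, fun x => s x.1 ⟨x.1, hi x.1⟩, ?_, fun x => hst x.1 x.1 (hi x.1) x.2⟩
  refine mem_tensorSections_of_locally fun x => ⟨W (i x.1), hi x.1, le_top, ?_⟩
  convert hs x.1 using 1
  funext y
  have := tensorSections_ext hf (V := W (i x.1) ⊓ W (i y.1))
    (res_mem_tensorSections inf_le_right (hs y.1)) (res_mem_tensorSections inf_le_left (hs x.1))
    fun z hz => (hst _ _ z.2.2 hz).trans (hst _ _ z.2.1 hz).symm
  exact congrFun this (⟨y.1, y.2, hi y.1⟩ : (W (i x.1) ⊓ W (i y.1) : X.Opens))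

end

/-! ### Invariant functions and invariant sections -/

section
variable {X Y : Scheme.{u}} (f : Y ⟶ X) {L : X.Modules} {N : Y.Modules}
  (ψ : L ⟶ (Scheme.Modules.pushforward f).obj N)

/-- The homomorphism `L → f_* N` takes frames to frames, that is, the homomorphism `f^* L → N` is
an isomorphism if `L` is invertible. -/
def PreservesFrames : Prop :=
  ∀ (U : X.Opens) (e : Γ(L, U)), IsFrame L e → IsFrame N (U := f ⁻¹ᵁ U) (ψ.app U e)

lemma tensorMap_smul (y : Y) (c : X.presheaf.stalk (f y)) (z : TensorStalk L (f y)) :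
    tensorMap f ψ y (c • z) = f.stalkMap y c • tensorMap f ψ y z := by
  rw [Algebra.smul_def, map_mul, tensorMap_algebraMap, Algebra.smul_def]

lemma tensorMap_ι (y : Y) (m : L.presheaf.stalk (f y)) :
    tensorMap f ψ y (TensorAlgebra.ι _ m) = TensorAlgebra.ι _ (stalkHom f ψ y m) := by
  let : Algebra (X.presheaf.stalk (f y)) (TensorStalk N y) :=
    ((algebraMap (Y.presheaf.stalk y) (TensorStalk N y)).comp (f.stalkMap y).hom).toAlgebra'
      fun c z => Algebra.commutes (A := TensorStalk N y) ((f.stalkMap y).hom c) z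
  exact TensorAlgebra.lift_ι_apply _ _

lemma tensorMap_frameAt {U : X.Opens} (e : Γ(L, U)) (y : Y) (hy : f y ∈ U) :
    tensorMap f ψ y (frameAt e (f y) hy) = frameAt (L := N) (U := f ⁻¹ᵁ U) (ψ.app U e) y hy :=
  (tensorMap_ι f ψ y _).trans (congrArg _ (stalkHom_germ f ψ y U hy e))

variable {f ψ}

lemma PreservesFrames.isInvertible [IsInvertible L] (h : PreservesFrames f ψ) : IsInvertible N where
  exists_frame y := by
    obtain ⟨U, hU, e, he⟩ := IsInvertible.exists_frame (L := L) (f y)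
    exact ⟨f ⁻¹ᵁ U, hU, _, h U e he⟩

lemma tensorMap_mem_tensorSections [IsInvertible L] {V : X.Opens} {n : ℕ}
    {s : ∀ x : V, TensorStalk L x.1} (hs : s ∈ tensorSections L n V) :
    (fun y : (f ⁻¹ᵁ V : Y.Opens) => tensorMap f ψ y.1 (s ⟨f y.1, y.2⟩)) ∈
      tensorSections N n (f ⁻¹ᵁ V) := by
  refine mem_tensorSections_of_locally fun y => ?_
  obtain ⟨W, -, hyW, hWV, e, he⟩ := IsInvertible.exists_isAffineOpen (L := L) (f y.1) V y.2
  obtain ⟨a, ha⟩ := exists_coord_frame he hWV hs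
  refine ⟨f ⁻¹ᵁ W, hyW, f.preimage_mono hWV, ?_⟩
  convert smul_mem_tensorSections (frameAt_pow_mem (L := N) (U := f ⁻¹ᵁ W) (ψ.app W e) n) (f.app W a)
    using 1
  funext z
  have hz : f z.1 ∈ W := z.2
  rw [ha (f z.1) hz, tensorMap_smul, map_pow, tensorMap_frameAt]
  congr 1
  exact Scheme.Hom.germ_stalkMap_apply f W z.1 hz a

lemma PreservesFrames.isNonzeroAt_iff [IsInvertible L] (h : PreservesFrames f ψ) {V : X.Opens}
    {n : ℕ} {s : ∀ x : V, TensorStalk L x.1} (hs : s ∈ tensorSections L n V) (y : Y)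
    (hy : f y ∈ V) :
    IsNonzeroAt (tensorMap f ψ y (s ⟨f y, hy⟩)) ↔ IsNonzeroAt (s ⟨f y, hy⟩) := by
  obtain ⟨W, -, hyW, hWV, e, he⟩ := IsInvertible.exists_isAffineOpen (L := L) (f y) V hy
  obtain ⟨a, ha⟩ := exists_coord_frame he hWV hs
  rw [ha (f y) hyW, EnvQuot.isNonzeroAt_iff he, tensorMap_smul, map_pow, tensorMap_frameAt]
  exact (EnvQuot.isNonzeroAt_iff (h W e he) y hyW _ n).trans
    (isUnit_map_iff (f.stalkMap y).hom _)

lemma preservesFrames_unit (f : Y ⟶ X) (L : X.Modules) : PreservesFrames f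
    ((Scheme.Modules.pullbackPushforwardAdjunction f).unit.app L) :=
  fun _ _ he => he.pullSec f

lemma preservesFrames_homEquiv (f : Y ⟶ X) {L : X.Modules} {N : Y.Modules}
    (θ : (Scheme.Modules.pullback f).obj L ≅ N) : PreservesFrames f
    ((Scheme.Modules.pullbackPushforwardAdjunction f).homEquiv _ _ θ.hom) := by
  intro U e he
  rw [Adjunction.homEquiv_unit]
  exact (he.pullSec f).map_iso θ

end

section
open MonoidalCategory CartesianMonoidalCategory

variable {k : Type u} [Field k] {H X : Over (Spec (.of k))} [GrpObj H] [ModObj H X]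
  {L : X.left.Modules} (Φ : Linearisation H X L)

lemma preservesFrames_fromAct :
    PreservesFrames (act H X).left (Linearisation.fromAct (H := H) (L := L)) :=
  preservesFrames_unit _ _

lemma Linearisation.preservesFrames_fromProj : PreservesFrames (snd H X).left Φ.fromProj :=
  preservesFrames_homEquiv _ _

/-- The pullback of a section `s` along the action minus its image under the linearisation. -/
def Linearisation.defect (s : ∀ x : (⊤ : X.left.Opens), TensorStalk L x.1) :
    ∀ y : (⊤ : (H ⊗ X).left.Opens),
      TensorStalk ((Scheme.Modules.pullback (act H X).left).obj L) y.1 := fun y =>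
  tensorMap (snd H X).left Φ.fromProj y.1 (s ⟨_, trivial⟩) -
    tensorMap (act H X).left (fromAct (L := L)) y.1 (s ⟨_, trivial⟩)

variable [IsInvertible L]

instance : IsInvertible ((Scheme.Modules.pullback (act H X).left).obj L) :=
  (preservesFrames_fromAct (H := H) (L := L)).isInvertible

variable {Φ}

lemma Linearisation.defect_mem {n : ℕ} {s : ∀ x : (⊤ : X.left.Opens), TensorStalk L x.1}
    (hs : s ∈ tensorSections L n ⊤) : Φ.defect s ∈ tensorSections _ n ⊤ :=
  sub_mem (tensorMap_mem_tensorSections (f := (snd H X).left) (ψ := Φ.fromProj) hs)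
    (tensorMap_mem_tensorSections (f := (act H X).left) (ψ := fromAct (H := H) (L := L)) hs)

/-- The nonvanishing locus of an invariant is stable under the group. -/
lemma locus_stable {m : ℕ} (f : invariants Φ m) (y : (H ⊗ X).left) :
    (snd H X).left y ∈ locus Φ f ↔ (act H X).left y ∈ locus Φ f := by
  have h1 := (Linearisation.preservesFrames_fromProj Φ).isNonzeroAt_iff f.2.1 y trivial
  have h2 := (preservesFrames_fromAct (H := H) (L := L)).isNonzeroAt_iff f.2.1 y trivial
  rw [f.2.2 y trivial trivial] at h1
  exact ⟨fun ⟨_, h⟩ => ⟨trivial, h2.1 (h1.2 h)⟩, fun ⟨_, h⟩ => ⟨trivial, h1.1 (h2.2 h)⟩⟩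

/-- An invariant section over `X_f` extends to an invariant on `X` after multiplication by a power
of `f`. -/
lemma exists_invariant_extension [IsIntegral X.left] [CompactSpace X.left]
    [CompactSpace (H ⊗ X).left] {m n : ℕ} (f : invariants Φ m)
    (hf : (locus Φ f : Set X.left).Nonempty) {t : ∀ x : locus Φ f, TensorStalk L x.1}
    (ht : t ∈ tensorSections L n (locus Φ f)) (hinv : Φ.IsInvariant t) :
    ∃ (N : ℕ) (s : invariants Φ (N * m + n)), ∀ x : locus Φ f,
      evalAt Φ x.1 (ofInvariant Φ _ s) = evalAt Φ x.1 (ofInvariant Φ m f) ^ N * t x := by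
  obtain ⟨N, s, hs, hst⟩ := exists_extension (⟨f.1, f.2.1⟩ : tensorSections L m ⊤) hf ht
  let u : ∀ y : (⊤ : (H ⊗ X).left.Opens), TensorStalk _ y.1 := fun y =>
    tensorMap (act H X).left (Linearisation.fromAct (H := H) (L := L)) y.1 (f.1 ⟨_, trivial⟩)
  have hu : u ∈ tensorSections _ m ⊤ := tensorMap_mem_tensorSections
    (f := (act H X).left) (ψ := Linearisation.fromAct (H := H) (L := L)) f.2.1
  -- The section `s` is invariant over `X_f`, so that a power of `f` kills its defect on `H × X`.
  obtain ⟨K, hK⟩ := exists_pow_mul_eq_zero hu (Linearisation.defect_mem (Φ := Φ) hs) fun y hy => by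
    have hy2 : (act H X).left y.1 ∈ locus Φ f :=
      ⟨trivial, ((preservesFrames_fromAct (H := H) (L := L)).isNonzeroAt_iff f.2.1 y.1 trivial).1 hy⟩
    have hy1 := (locus_stable f y.1).2 hy2
    have h1 := hst ⟨_, hy1⟩
    have h2 := hst ⟨_, hy2⟩
    rw [Linearisation.defect, sub_eq_zero]
    refine (congrArg _ h1).trans (Eq.trans ?_ (congrArg _ h2).symm)
    rw [map_mul, map_mul, map_pow, map_pow]
    congr 1
    · exact congrArg (· ^ N) (f.2.2 y.1 trivial trivial)
    · exact hinv y.1 hy1 hy2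
  have hmem := mul_mem_tensorSections (pow_mem_tensorSections f.2.1 K) hs
  rw [← add_assoc, ← add_mul] at hmem
  have hsinv : Φ.IsInvariant (V := ⊤) fun x => f.1 x ^ K * s x := fun y hp ha => by
    have h1 := hK ⟨y, trivial⟩
    rw [Linearisation.defect, mul_sub, sub_eq_zero] at h1
    rw [map_mul, map_mul, map_pow, map_pow]
    have h2 := congrArg (· ^ K) (f.2.2 y hp ha)
    exact (congrArg (· * tensorMap (snd H X).left Φ.fromProj y (s ⟨_, hp⟩)) h2).trans h1
  refine ⟨K + N, ⟨fun x => f.1 x ^ K * s x, hmem, hsinv⟩, fun x => ?_⟩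
  · have h1 := (evalAt_ofInvariant Φ x.1 _ (⟨fun x => f.1 x ^ K * s x, hmem, hsinv⟩ :
      invariants Φ ((K + N) * m + n)))
    refine h1.trans ?_
    rw [evalAt_ofInvariant, pow_add, mul_assoc]
    exact congrArg (f.1 ⟨x.1, trivial⟩ ^ K * ·) (hst x)

/-- The function `g` on `V` is invariant under the group. -/
def IsInvariantFun (H : Over (Spec (.of k))) [GrpObj H] [ModObj H X] {V : X.left.Opens}
    (g : Γ(X.left, V)) : Prop :=
  ∀ (y : (H ⊗ X).left) (hp : (snd H X).left y ∈ V) (ha : (act H X).left y ∈ V),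
    (snd H X).left.stalkMap y (X.left.presheaf.germ V _ hp g) =
      (act H X).left.stalkMap y (X.left.presheaf.germ V _ ha g)

/-- Invariant functions on `X_f` are fractions of invariants with a power of `f` as denominator. -/
lemma exists_invariant_eq_smul [IsIntegral X.left] [CompactSpace X.left]
    [CompactSpace (H ⊗ X).left] {m : ℕ} (f : invariants Φ m)
    (hf : (locus Φ f : Set X.left).Nonempty) (g : Γ(X.left, locus Φ f)) (hg : IsInvariantFun H g) :
    ∃ (N : ℕ) (s : invariants Φ (N * m)), ∀ x : locus Φ f, evalAt Φ x.1 (ofInvariant Φ _ s) =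
      X.left.presheaf.germ _ x.1 x.2 g • evalAt Φ x.1 (ofInvariant Φ m f) ^ N := by
  obtain ⟨N, s, hs⟩ := exists_invariant_extension (n := 0) f hf
    (smul_mem_tensorSections (one_mem_tensorSections L _) g) (fun y hp ha => by
      rw [tensorMap_smul, tensorMap_smul, map_one, map_one, hg y hp ha])
  refine ⟨N, s, fun x => (hs x).trans ?_⟩
  rw [mul_smul_comm, mul_one]

/-- The map `(S^H)_{(f)} → 𝒪(X_f)` hits every invariant function. -/
lemma exists_awayToSections_eq [IsIntegral X.left] [CompactSpace X.left]
    [CompactSpace (H ⊗ X).left] {m : ℕ} (f : invariants Φ m)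
    (hf : (locus Φ f : Set X.left).Nonempty) (g : Γ(X.left, locus Φ f)) (hg : IsInvariantFun H g) :
    ∃ z, awayToSections Φ f z = g := by
  obtain ⟨N, s, hs⟩ := exists_invariant_eq_smul f hf g hg
  refine ⟨HomogeneousLocalization.mk ⟨N * m, ⟨_, ofInvariant_mem Φ s⟩,
    ⟨ofInvariant Φ m f ^ N, SetLike.pow_mem_graded N (ofInvariant_mem Φ f)⟩, N, rfl⟩, ?_⟩
  refine awayFun_mk Φ f fun x => (hs x).trans ?_
  rw [map_pow]

lemma eq_zero_of_evalAt_eq_zero [IsIntegral X.left] {n : ℕ} {a : InvariantRing Φ}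
    (ha : a ∈ grading Φ n) {O : X.left.Opens} (hO : (O : Set X.left).Nonempty)
    (h : ∀ x ∈ O, evalAt Φ x a = 0) : a = 0 := by
  have h1 := tensorSections_ext hO (evalAt_mem Φ ha ⊤) (zero_mem _) fun x hx => h x.1 hx
  obtain ⟨a, rfl⟩ := ha
  have h2 : a = 0 := by
    apply Subtype.ext
    funext x
    exact (evalAt_ofInvariant Φ x.1 n a).symm.trans (congrFun h1 x)
  rw [h2, map_zero]

lemma awayToSections_injective [IsIntegral X.left] {m : ℕ} (f : invariants Φ m)
    (hf : (locus Φ f : Set X.left).Nonempty) : Function.Injective (awayToSections Φ f) := by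
  rw [injective_iff_map_eq_zero]
  intro z hz
  obtain ⟨c, rfl⟩ := HomogeneousLocalization.mk_surjective z
  have h0 : c.num.1 = 0 := eq_zero_of_evalAt_eq_zero c.num.2 hf fun x hx => by
    have h1 := isQuotientFun_awayFun Φ f c ⟨x, hx⟩
    have h2 : awayFun Φ f (HomogeneousLocalization.mk c) = 0 := hz
    rwa [h2, map_zero, zero_smul] at h1
  rw [HomogeneousLocalization.ext_iff_val, HomogeneousLocalization.val_mk,
    HomogeneousLocalization.val_zero, h0, Localization.mk_zero]

end

/-! ### Pulling back functions -/

section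
variable {X Z : Scheme.{u}} {U : X.Opens} (φ : U.toScheme ⟶ Z)

/-- The pullback of a function on `W ⊆ Z` to an open subset of `φ⁻¹ W`. -/
def pullFun {A : X.Opens} {W : Z.Opens} (h : A ≤ U.ι ''ᵁ φ ⁻¹ᵁ W) : Γ(Z, W) →+* Γ(X, A) :=
  (φ.app W ≫ X.presheaf.map (homOfLE h).op).hom

lemma pullFun_apply {A : X.Opens} {W : Z.Opens} (h : A ≤ U.ι ''ᵁ φ ⁻¹ᵁ W) (w : Γ(Z, W)) :
    pullFun φ h w = resFun h (show Γ(X, U.ι ''ᵁ φ ⁻¹ᵁ W) from φ.app W w) := rfl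

lemma preimage_homOfLE_comp_eq_top {A : X.Opens} (hA : A ≤ U) {W : Z.Opens}
    (h : A ≤ U.ι ''ᵁ φ ⁻¹ᵁ W) : (⊤ : A.toScheme.Opens) ≤ (X.homOfLE hA ≫ φ) ⁻¹ᵁ W := fun x _ => by
  obtain ⟨y, hy, hxy⟩ := h x.2
  have : X.homOfLE hA x = y := Subtype.ext ((X.homOfLE_apply hA x).trans hxy.symm)
  change φ (X.homOfLE hA x) ∈ W
  rw [this]
  exact hy

lemma pullFun_topIso_inv {A : X.Opens} (hA : A ≤ U) {W : Z.Opens} (h : A ≤ U.ι ''ᵁ φ ⁻¹ᵁ W) :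
    CommRingCat.ofHom (pullFun φ h) ≫ A.topIso.inv =
      (X.homOfLE hA ≫ φ).appLE W ⊤ (preimage_homOfLE_comp_eq_top φ hA h) := by
  have h4 := Scheme.homOfLE_appLE hA (φ ⁻¹ᵁ W) ⊤ (preimage_homOfLE_comp_eq_top φ hA h)
  refine Eq.trans ?_ ((Scheme.Hom.comp_appLE (X.homOfLE hA) φ W ⊤ _).trans
    (congrArg (φ.app W ≫ ·) h4)).symm
  exact (Category.assoc _ _ _).trans (congrArg (φ.app W ≫ ·)
    (X.presheaf.map_comp (homOfLE h).op _).symm)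

lemma toSpecΓ_pullFun {A : X.Opens} (hA : A ≤ U) {W : Z.Opens} (hW : IsAffineOpen W)
    (h : A ≤ U.ι ''ᵁ φ ⁻¹ᵁ W) :
    A.toSpecΓ ≫ Spec.map (CommRingCat.ofHom (pullFun φ h)) ≫ hW.fromSpec =
      X.homOfLE hA ≫ φ := by
  have h1 := preimage_homOfLE_comp_eq_top φ hA h
  have h2 : A.toScheme.toSpecΓ ≫ Spec.map ((X.homOfLE hA ≫ φ).appLE W ⊤ h1) ≫ hW.fromSpec =
      X.homOfLE hA ≫ φ := by
    have : IsIso (⊤ : A.toScheme.Opens).ι := inferInstanceAs (IsIso (Scheme.topIso _).hom)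
    rw [← cancel_epi (⊤ : A.toScheme.Opens).ι, ← Category.assoc, ← Scheme.Opens.toSpecΓ_top,
      ← Category.assoc, Scheme.Opens.toSpecΓ_SpecMap_appLE, Category.assoc,
      IsAffineOpen.toSpecΓ_fromSpec, Scheme.Hom.resLE_comp_ι]
  rw [Scheme.Opens.toSpecΓ, Category.assoc, ← Spec.map_comp_assoc, pullFun_topIso_inv φ hA, h2]

end

section
open MonoidalCategory CartesianMonoidalCategory
variable {k : Type u} [Field k] {H X Z : Over (Spec (.of k))} [GrpObj H] [ModObj H X]
  {U : X.left.Opens} (φ : openOver U ⟶ Z)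

lemma germ_appLE {X Y : Scheme.{u}} (f : Y ⟶ X) {U : X.Opens} {V : Y.Opens} (h : V ≤ f ⁻¹ᵁ U)
    (y : Y) (hy : y ∈ V) (g : Γ(X, U)) :
    Y.presheaf.germ V y hy (f.appLE U V h g) = f.stalkMap y (X.presheaf.germ U (f y) (h hy) g) :=
  (germ_resFun h y hy (f.app U g)).trans (Scheme.Hom.germ_stalkMap_apply f U y (h hy) g).symm

/-- Functions on `Z` pull back to invariant functions. -/
lemma IsInvariantMorphism.isInvariantFun (hφ : IsInvariantMorphism H φ) {A : X.left.Opens}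
    {W : Z.left.Opens} (h : A ≤ U.ι ''ᵁ φ.left ⁻¹ᵁ W) (w : Γ(Z.left, W)) :
    IsInvariantFun H (pullFun φ.left h w) := by
  intro y hp ha
  rw [pullFun_apply, germ_resFun, germ_resFun]
  let V := (snd H X).left ⁻¹ᵁ U ⊓ (act H X).left ⁻¹ᵁ U
  let V' : V.toScheme.Opens := V.ι ⁻¹ᵁ ((snd H X).left ⁻¹ᵁ A ⊓ (act H X).left ⁻¹ᵁ A)
  have hyV : y ∈ V.ι ''ᵁ V' := by
    refine ⟨⟨y, ?_, ?_⟩, ⟨hp, ha⟩, rfl⟩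
    · obtain ⟨z, _, hz⟩ := h hp
      change _ ∈ U
      rw [← hz]
      exact z.2
    · obtain ⟨z, _, hz⟩ := h ha
      change _ ∈ U
      rw [← hz]
      exact z.2
  let p := (snd H X).left.resLE U V inf_le_left
  let a := (act H X).left.resLE U V inf_le_right
  have hp' : V' ≤ p ⁻¹ᵁ φ.left ⁻¹ᵁ W :=
    ((snd H X).left.le_resLE_preimage_iff inf_le_left _ _).2 fun z hz => by
      obtain ⟨z, hz, rfl⟩ := hz
      exact h hz.1
  have ha' : V' ≤ a ⁻¹ᵁ φ.left ⁻¹ᵁ W :=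
    ((act H X).left.le_resLE_preimage_iff inf_le_right _ _).2 fun z hz => by
      obtain ⟨z, hz, rfl⟩ := hz
      exact h hz.2
  have hφ' : p ≫ φ.left = a ≫ φ.left := hφ
  have key : p.appLE (φ.left ⁻¹ᵁ W) V' hp' (φ.left.app W w) =
      a.appLE (φ.left ⁻¹ᵁ W) V' ha' (φ.left.app W w) := by
    have h1 : (p ≫ φ.left).appLE W V' hp' = (a ≫ φ.left).appLE W V' ha' := by
      congr 1
    have h2 := (Scheme.Hom.comp_appLE p φ.left W V' hp').symm.trans
      (h1.trans (Scheme.Hom.comp_appLE a φ.left W V' ha'))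
    exact congr($h2 w)
  rw [Scheme.Hom.resLE_appLE, Scheme.Hom.resLE_appLE] at key
  have key2 := congrArg ((H ⊗ X).left.presheaf.germ _ y hyV) key
  exact (germ_appLE (snd H X).left _ y hyV _).symm.trans
    (key2.trans (germ_appLE (act H X).left _ y hyV _))

end

/-! ### The natural map to `D_+(f)` is dominant -/

section
open MonoidalCategory CartesianMonoidalCategory
variable {k : Type u} [Field k] {H X : Over (Spec (.of k))} [GrpObj H] [ModObj H X]
  {L : X.left.Modules} [IsInvertible L] {Φ : Linearisation H X L}

lemma locus_nonempty [IsReduced X.left] {m : ℕ} {f : invariants Φ m} (hf : f ≠ 0) :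
    (locus Φ f : Set X.left).Nonempty := by
  by_contra h0
  rw [Set.not_nonempty_iff_eq_empty] at h0
  refine hf (Subtype.ext (funext fun x => ?_))
  obtain ⟨W, -, hxW, hWV, e, he⟩ := IsInvertible.exists_isAffineOpen (L := L) x.1 ⊤ trivial
  obtain ⟨a, ha⟩ := exists_coord_frame he hWV f.2.1
  have h1 : X.left.basicOpen a = ⊥ := by
    rw [eq_bot_iff]
    intro y hy
    have hyW := X.left.basicOpen_le a hy
    have : y ∈ (locus Φ f : Set X.left) := by
      refine ⟨trivial, ?_⟩
      change IsNonzeroAt (f.1 ⟨y, trivial⟩)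
      rw [ha y hyW, isNonzeroAt_iff he]
      exact (X.left.mem_basicOpen a y hyW).1 hy
    rw [h0] at this
    exact this.elim
  have h2 : a = 0 := (basicOpen_eq_bot_iff a).1 h1
  rw [ha x.1 hxW, h2, map_zero, zero_smul]
  rfl

lemma locusToProj_mem {m : ℕ} (f : invariants Φ m) (hm : 0 < m) (x : (locus Φ f).toScheme) :
    locusToProj Φ f hm x ∈ Proj.basicOpen (grading Φ) (ofInvariant Φ m f) := by
  rw [← Proj.opensRange_awayι (grading Φ) _ (ofInvariant_mem Φ f) hm]
  exact ⟨((locus Φ f).toSpecΓ ≫ Spec.map (CommRingCat.ofHom (awayToSections Φ f))) x, rfl⟩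

lemma locusToProj_mem_of_mem {m n : ℕ} (f : invariants Φ m) (hm : 0 < m) (g : invariants Φ n)
    (x : (locus Φ f).toScheme) (hx : x.1 ∈ locus Φ g) :
    locusToProj Φ f hm x ∈ Proj.basicOpen (grading Φ) (ofInvariant Φ n g) := by
  have h1 := locus_mul Φ f g
  have h2 := homOfLE_locusToProj Φ f hm (Nat.add_pos_left hm n) rfl (mulInvariants Φ f g)
    (ofInvariant_mul Φ f g) (h1.trans_le inf_le_left)
  let y : (locus Φ (mulInvariants Φ f g)).toScheme := ⟨x.1, h1.ge ⟨x.2, hx⟩⟩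
  have h3 := locusToProj_mem (mulInvariants Φ f g) (Nat.add_pos_left hm n) y
  rw [← h2, ofInvariant_mul, Proj.basicOpen_mul] at h3
  have h4 : X.left.homOfLE (h1.trans_le inf_le_left) y = x :=
    Subtype.ext (X.left.homOfLE_apply (h1.trans_le inf_le_left) y)
  have h5 := h3.2
  rw [Scheme.Hom.comp_apply, h4] at h5
  exact h5

lemma ofInvariant_ne_zero {n : ℕ} {g : invariants Φ n} (y : Proj (grading Φ))
    (hy : y ∈ Proj.basicOpen (grading Φ) (ofInvariant Φ n g)) : g ≠ 0 := by
  rintro rfl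
  rw [map_zero, Proj.basicOpen_zero] at hy
  exact hy

/-- A nonempty open subset of `Proj S^H` contains some nonempty `D_+(g)`. -/
lemma exists_basicOpen_le {y : Proj (grading Φ)} {V : (Proj (grading Φ)).Opens} (hy : y ∈ V) :
    ∃ (n : ℕ) (g : invariants Φ n), g ≠ 0 ∧ Proj.basicOpen (grading Φ) (ofInvariant Φ n g) ≤ V := by
  obtain ⟨_, ⟨g, rfl⟩, hyg, hgV⟩ := ((Opens.isBasis_iff_nbhd).1
    (Proj.isBasis_basicOpen (grading Φ))) hy
  rw [Proj.basicOpen_eq_iSup_proj, Opens.mem_iSup] at hyg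
  obtain ⟨i, hi⟩ := hyg
  obtain ⟨g', hg'⟩ : GradedRing.proj (grading Φ) i g ∈ grading Φ i :=
    (DirectSum.decompose (grading Φ) g i).2
  rw [← hg'] at hi
  refine ⟨i, g', ofInvariant_ne_zero y hi, ?_⟩
  rw [hg']
  refine le_trans ?_ hgV
  rw [Proj.basicOpen_eq_iSup_proj (grading Φ) g]
  exact le_iSup (fun i => Proj.basicOpen (grading Φ) (GradedRing.proj (grading Φ) i g)) i

/-- A nonempty `X_f` has dense image in `Proj S^H`, since it meets `X_g` for all invariants `g ≠ 0`. -/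
lemma isDominant_locusToProj [IsReduced X.left] [IrreducibleSpace X.left] {m : ℕ}
    (f : invariants Φ m) (hm : 0 < m)
    (hf : (locus Φ f : Set X.left).Nonempty) : IsDominant (locusToProj Φ f hm) := by
  refine ⟨dense_iff_inter_open.2 fun V hV ⟨y, hy⟩ => ?_⟩
  obtain ⟨n, g, hg, hgV⟩ := exists_basicOpen_le (V := ⟨V, hV⟩) hy
  obtain ⟨x, -, hxf, hxg⟩ := (PreirreducibleSpace.isPreirreducible_univ (X := X.left))
    _ _ (locus Φ f).2 (locus Φ g).2 (by simpa using hf) (by simpa using locus_nonempty hg)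
  exact ⟨_, hgV (locusToProj_mem_of_mem f hm g ⟨x, hxf⟩ hxg), Set.mem_range_self _⟩

lemma isReduced_proj [IsIntegral X.left] : IsReduced (Proj (grading Φ)) := by
  have : ∀ i, IsReduced ((Proj.affineOpenCover (grading Φ)).openCover.X i) := by
    rintro ⟨n, ⟨_, g, rfl⟩⟩
    change IsReduced (Spec (.of (HomogeneousLocalization.Away (grading Φ) (ofInvariant Φ n g))))
    have : _root_.IsReduced (HomogeneousLocalization.Away (grading Φ) (ofInvariant Φ n g)) := by
      by_cases hg : g = 0
      · refine ⟨fun z _ => ?_⟩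
        have h0 : (0 : InvariantRing Φ) ∈ Submonoid.powers (ofInvariant Φ n g) :=
          ⟨1, (pow_one _).trans (by rw [hg, map_zero])⟩
        have := HomogeneousLocalization.subsingleton (grading Φ) h0
        exact Subsingleton.elim _ _
      · exact isReduced_of_injective _ (awayToSections_injective g (locus_nonempty hg))
    infer_instance
  exact IsReduced.of_openCover _ (Proj.affineOpenCover (grading Φ)).openCover

/-- The morphism `X_f → D_+(f)`. -/
def locusToBasicOpen {m : ℕ} (f : invariants Φ m) (hm : 0 < m) : (locus Φ f).toScheme ⟶
    (Proj.basicOpen (grading Φ) (ofInvariant Φ m f)).toScheme :=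
  ((locus Φ f).toSpecΓ ≫ Spec.map (CommRingCat.ofHom (awayToSections Φ f))) ≫
    (Proj.basicOpenIsoSpec (grading Φ) _ (ofInvariant_mem Φ f) hm).inv

lemma locusToBasicOpen_ι {m : ℕ} (f : invariants Φ m) (hm : 0 < m) :
    locusToBasicOpen f hm ≫ (Proj.basicOpen (grading Φ) (ofInvariant Φ m f)).ι =
      locusToProj Φ f hm := by
  rw [locusToBasicOpen, Category.assoc, Proj.basicOpenIsoSpec_inv_ι, Category.assoc]
  rfl

lemma locusToBasicOpen_basicOpenToSpec {m : ℕ} (f : invariants Φ m) (hm : 0 < m) :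
    locusToBasicOpen f hm ≫ Proj.basicOpenToSpec (grading Φ) (ofInvariant Φ m f) =
      (locus Φ f).toSpecΓ ≫ Spec.map (CommRingCat.ofHom (awayToSections Φ f)) := by
  rw [locusToBasicOpen, Category.assoc,
    ← Proj.basicOpenIsoSpec_hom (grading Φ) _ (ofInvariant_mem Φ f) hm, Iso.inv_hom_id,
    Category.comp_id]

lemma isDominant_locusToBasicOpen [IsReduced X.left] [IrreducibleSpace X.left] {m : ℕ}
    (f : invariants Φ m) (hm : 0 < m)
    (hf : (locus Φ f : Set X.left).Nonempty) : IsDominant (locusToBasicOpen f hm) := by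
  have h1 := isDominant_locusToProj f hm hf
  rw [← locusToBasicOpen_ι] at h1
  exact IsDominant.of_comp_of_isOpenImmersion (locusToBasicOpen f hm) (Scheme.Opens.ι _)

lemma awayToSection_locusToBasicOpen {m : ℕ} (f : invariants Φ m) (hm : 0 < m) :
    Proj.awayToSection (grading Φ) (ofInvariant Φ m f) ≫
      (Proj.basicOpen (grading Φ) (ofInvariant Φ m f)).topIso.inv ≫
        (locusToBasicOpen f hm).appTop =
      CommRingCat.ofHom (awayToSections Φ f) ≫ (locus Φ f).topIso.inv := by
  have h1 := congrArg Scheme.Hom.appTop (locusToBasicOpen_basicOpenToSpec f hm)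
  rw [Scheme.Hom.comp_appTop, Scheme.Hom.comp_appTop, Scheme.Opens.toSpecΓ_appTop] at h1
  have h2 := Proj.basicOpenToSpec_app_top (grading Φ) (ofInvariant Φ m f)
  have h3 := (congrArg (· ≫ (locusToBasicOpen f hm).appTop) h2).symm.trans h1
  rw [← Category.assoc (Scheme.Hom.appTop (Spec.map _)), Scheme.ΓSpecIso_naturality,
    Category.assoc, Category.assoc, Category.assoc] at h3
  exact (cancel_epi (Scheme.ΓSpecIso _).hom).1 h3

end

/-! ### Descent of invariant morphisms to `D_+(f)` -/

section
open MonoidalCategory CartesianMonoidalCategory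
variable {k : Type u} [Field k] {H X Z : Over (Spec (.of k))} [GrpObj H] [ModObj H X]
  {L : X.left.Modules} [IsInvertible L] {Φ : Linearisation H X L}

lemma homOfLE_glue {J : Type u} (f : J → PosInvariant Φ) (j : J) :
    X.left.homOfLE (le_iSup (fun j => (f j).locus) j) ≫ PosInvariant.glue f = (f j).toProj :=
  (Scheme.Opens.iSupOpenCover fun j => (f j).locus).ι_glueMorphisms _ _ j

lemma homOfLE_quotientMapOn {U : X.left.Opens} (hU : U ≤ semistable Φ) {A : X.left.Opens}
    (hAU : A ≤ U) {f : PosInvariant Φ} (hf : f ∈ finitelyGenerated Φ) (hA : A ≤ f.locus) :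
    X.left.homOfLE hAU ≫ quotientMapOn hU = X.left.homOfLE hA ≫ f.toProj := by
  have h0 : f.locus ≤ semistable Φ :=
    le_iSup (fun g : finitelyGenerated Φ => g.1.locus) ⟨f, hf⟩
  have h1 : X.left.homOfLE h0 ≫ quotientMap Φ = f.toProj :=
    homOfLE_glue (fun g : finitelyGenerated Φ => g.1) ⟨f, hf⟩
  exact (Scheme.homOfLE_homOfLE_assoc X.left hAU hU _).trans
    ((Scheme.homOfLE_homOfLE_assoc X.left hA h0 _).symm.trans
      (congrArg (X.left.homOfLE hA ≫ ·) h1))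

/-- On `X_h`, for `h` a multiple of some `f ∈ I^{ss,fg}`, the map `q` is the natural map to
`D_+(h)`. -/
lemma homOfLE_quotientMapOn_locus {U : X.left.Opens} (hU : U ≤ semistable Φ)
    {f : PosInvariant Φ} (hf : f ∈ finitelyGenerated Φ) {n d : ℕ} (hd0 : 0 < d) {h : invariants Φ d}
    {g : invariants Φ n} (hd : d = f.1 + 1 + n)
    (hh : ofInvariant Φ d h = f.elem * ofInvariant Φ n g) (hA : locus Φ h ≤ U)
    (hle : locus Φ h ≤ f.locus) :
    X.left.homOfLE hA ≫ quotientMapOn hU = locusToProj Φ h hd0 :=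
  (homOfLE_quotientMapOn hU hA hf hle).trans
    (homOfLE_locusToProj Φ f.2 f.1.succ_pos hd0 hd h hh hle)

lemma evalAt_algebraMap (x : X.left) (c : k) :
    evalAt Φ x (algebraMap k (InvariantRing Φ) c) =
      scalarGerm X x c • (1 : TensorStalk L x) := by
  have h1 : (DirectSum.coeAlgHom (invariants Φ)).toRingHom (algebraMap k (InvariantRing Φ) c) =
      algebraMap k (Germs X L) c := (DirectSum.coeAlgHom (invariants Φ)).commutes c
  refine (congrFun h1 ⟨x, trivial⟩).trans ?_
  rw [← Algebra.algebraMap_eq_smul_one]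
  rfl

lemma hom_eq_toSpecΓ (X : Over (Spec (.of k))) :
    X.hom = X.left.toSpecΓ ≫ Spec.map (CommRingCat.ofHom (scalar X)) := by
  have h1 : CommRingCat.ofHom (scalar X) = (Scheme.ΓSpecIso (.of k)).inv ≫ X.hom.appTop := rfl
  rw [h1, Spec.map_comp, ← Scheme.toSpecΓ_naturality_assoc, toSpecΓ_SpecMap_ΓSpecIso_inv]
  exact (Category.comp_id _).symm

lemma locusToProj_hom {m : ℕ} (f : invariants Φ m) (hm : 0 < m) :
    locusToProj Φ f hm ≫ (projOver (grading Φ)).hom = (locus Φ f).ι ≫ X.hom := by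
  have h1 : (awayToSections Φ f).comp ((HomogeneousLocalization.fromZeroRingHom (grading Φ)
      (Submonoid.powers (ofInvariant Φ m f))).comp (algebraMap k (grading Φ 0))) =
      (X.left.presheaf.map (homOfLE (le_top : locus Φ f ≤ ⊤)).op).hom.comp (scalar X) := by
    ext c
    refine awayFun_mk Φ f fun x => ?_
    have h2 := X.left.presheaf.germ_res_apply' (homOfLE (le_top : locus Φ f ≤ ⊤)).op x.1 x.2
      (scalar X c)
    refine (evalAt_algebraMap x.1 c).trans ?_
    refine congrArg₂ (· • ·) h2.symm (map_one (evalAt Φ x.1)).symm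
  rw [hom_eq_toSpecΓ X, ← Scheme.Opens.toSpecΓ_SpecMap_presheaf_map_top_assoc, ← Spec.map_comp]
  change (_ ≫ _ ≫ _) ≫ Proj.toSpecZero (grading Φ) ≫ _ = _
  rw [Category.assoc, Category.assoc, Proj.awayι_toSpecZero_assoc, ← Spec.map_comp,
    ← Spec.map_comp]
  exact congrArg (fun g => (locus Φ f).toSpecΓ ≫ Spec.map (CommRingCat.ofHom g)) h1

/-- If `ψ` restricts to `φ` on `X_f`, then a function on `Z` has compatible pullbacks to `D_+(f)`
and to `X_f`. -/
lemma awayToSections_eq_pullFun {Z : Scheme.{u}} {U : X.left.Opens} {𝒰 : (Proj (grading Φ)).Opens}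
    (φ : U.toScheme ⟶ Z) (ψ : 𝒰.toScheme ⟶ Z) {m : ℕ} (f : invariants Φ m) (hm : 0 < m)
    (hA : locus Φ f ≤ U) (hD : Proj.basicOpen (grading Φ) (ofInvariant Φ m f) ≤ 𝒰)
    (hψ : locusToBasicOpen f hm ≫ (Proj (grading Φ)).homOfLE hD ≫ ψ = X.left.homOfLE hA ≫ φ)
    {W : Z.Opens} (h : locus Φ f ≤ U.ι ''ᵁ φ ⁻¹ᵁ W)
    (h' : Proj.basicOpen (grading Φ) (ofInvariant Φ m f) ≤ 𝒰.ι ''ᵁ ψ ⁻¹ᵁ W) (w : Γ(Z, W))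
    (z : HomogeneousLocalization.Away (grading Φ) (ofInvariant Φ m f))
    (hz : Proj.awayToSection (grading Φ) (ofInvariant Φ m f) z = pullFun ψ h' w) :
    awayToSections Φ f z = pullFun φ h w := by
  have h1 := pullFun_topIso_inv φ hA h
  have h2 := pullFun_topIso_inv ψ hD h'
  have h3 : (X.left.homOfLE hA ≫ φ).appLE W ⊤ (preimage_homOfLE_comp_eq_top φ hA h) =
      ((Proj (grading Φ)).homOfLE hD ≫ ψ).appLE W ⊤ (preimage_homOfLE_comp_eq_top ψ hD h') ≫
        (locusToBasicOpen f hm).appTop := by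
    have h4 : (locusToBasicOpen f hm ≫ (Proj (grading Φ)).homOfLE hD ≫ ψ).appLE W ⊤
        ((preimage_homOfLE_comp_eq_top φ hA h).trans_eq (by rw [hψ])) =
        (X.left.homOfLE hA ≫ φ).appLE W ⊤ (preimage_homOfLE_comp_eq_top φ hA h) := by
      congr 1
    refine h4.symm.trans (Eq.symm ?_)
    exact (congrArg (Scheme.Hom.appLE _ W ⊤ _ ≫ ·) (locusToBasicOpen f hm).app_eq_appLE).trans
      (Scheme.Hom.appLE_comp_appLE _ _ _ _ _ _ _)
  rw [← h1, ← h2] at h3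
  have h5 := congr($h3 w)
  have h6 := congr($(awayToSection_locusToBasicOpen f hm) z)
  apply (ConcreteCategory.bijective_of_isIso (locus Φ f).topIso.inv).1
  refine h6.symm.trans (Eq.trans ?_ h5.symm)
  exact congrArg (fun s => (locusToBasicOpen f hm).appTop
    ((Proj.basicOpen (grading Φ) (ofInvariant Φ m f)).topIso.inv s)) hz

/-- An invariant morphism that maps `X_f` to an affine open set factors through `D_+(f)`: pulling
back functions gives invariant functions on `X_f`, and these are the elements of `(S^H)_{(f)}`. -/
lemma exists_descent [IsIntegral X.left] [CompactSpace X.left] [CompactSpace (H ⊗ X).left]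
    {U : X.left.Opens} {φ : openOver U ⟶ Z} (hφ : IsInvariantMorphism H φ) {m : ℕ}
    (f : invariants Φ m) (hm : 0 < m) (hf : (locus Φ f : Set X.left).Nonempty)
    (hA : locus Φ f ≤ U) {W : Z.left.Opens} (hW : IsAffineOpen W)
    (h : locus Φ f ≤ U.ι ''ᵁ φ.left ⁻¹ᵁ W) :
    ∃ ψ : (Proj.basicOpen (grading Φ) (ofInvariant Φ m f)).toScheme ⟶ Z.left,
      locusToBasicOpen f hm ≫ ψ = X.left.homOfLE hA ≫ φ.left ∧ Set.range ψ ⊆ W := by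
  have hinj := awayToSections_injective f hf
  let e := RingEquiv.ofBijective (awayToSections Φ f).rangeRestrict
    ⟨fun a b hab => hinj (congrArg Subtype.val hab), (awayToSections Φ f).rangeRestrict_surjective⟩
  let ρ := e.symm.toRingHom.comp ((pullFun φ.left h).codRestrict (awayToSections Φ f).range
    fun w => exists_awayToSections_eq f hf _ (hφ.isInvariantFun φ h w))
  have hρ : (awayToSections Φ f).comp ρ = pullFun φ.left h := by
    ext w
    exact congrArg Subtype.val (e.apply_symm_apply ⟨pullFun φ.left h w,
      exists_awayToSections_eq f hf _ (hφ.isInvariantFun φ h w)⟩)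
  refine ⟨Proj.basicOpenToSpec (grading Φ) (ofInvariant Φ m f) ≫ Spec.map (CommRingCat.ofHom ρ) ≫
    hW.fromSpec, ?_, ?_⟩
  · rw [← Category.assoc, locusToBasicOpen_basicOpenToSpec, Category.assoc, ← Spec.map_comp_assoc]
    refine Eq.trans ?_ (toSpecΓ_pullFun φ.left hA hW h)
    rw [← hρ]
    rfl
  · rw [← Category.assoc]
    rintro _ ⟨y, rfl⟩
    have := hW.range_fromSpec
    rw [← this]
    exact ⟨_, rfl⟩

end

/-! ### Fractions as frames of the twisting sheaf -/

section
variable {k : Type u} [Field k] {A : Type u} [CommRing A] [Algebra k A] (𝒜 : ℕ → Submodule k A)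
  [GradedAlgebra 𝒜]

lemma stalkToTwistStalk_injective (x : Proj 𝒜) : Function.Injective (stalkToTwistStalk 𝒜 x) :=
  (HomogeneousLocalization.val_injective _).comp
    (ConcreteCategory.bijective_of_isIso (Proj.stalkIso 𝒜 x).hom).1

lemma stalkToTwistStalk_germ {V : (Proj 𝒜).Opens} (x : Proj 𝒜) (hx : x ∈ V) (f : Γ(Proj 𝒜, V)) :
    stalkToTwistStalk 𝒜 x ((Proj 𝒜).presheaf.germ V x hx f) =
      HomogeneousLocalization.val (f.1 ⟨x, hx⟩) :=
  congrArg HomogeneousLocalization.val (Proj.stalkIso'_germ 𝒜 V x hx f)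

variable {𝒜}

lemma TwistStalk.frac_eq_iff {x : Proj 𝒜} {a b c d : A} (hb : b ∉ x.asHomogeneousIdeal)
    (hd : d ∉ x.asHomogeneousIdeal) (h : a * d = c * b) :
    TwistStalk.frac a b hb = TwistStalk.frac c d hd := by
  refine Localization.mk_eq_mk_iff.2 (Localization.r_iff_exists.2 ⟨1, ?_⟩)
  simp only [OneMemClass.coe_one, one_mul]
  rw [mul_comm d, mul_comm b, h]

lemma TwistStalk.isUnit_frac {x : Proj 𝒜} {a b : A} (ha : a ∉ x.asHomogeneousIdeal)
    (hb : b ∉ x.asHomogeneousIdeal) :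
    TwistStalk.frac a b hb * TwistStalk.frac b a ha = 1 := by
  rw [TwistStalk.frac_mul]
  refine (TwistStalk.frac_eq_iff (c := 1) (d := 1) _
    (fun h => x.isPrime.ne_top ((Ideal.eq_top_iff_one _).2 h)) (by ring)).trans ?_
  exact Localization.mk_one

/-- The section of `𝒪(r)` given by the fraction `a / b`. -/
def twistFrac {r d : ℕ} {a b : A} (ha : a ∈ 𝒜 (d + r)) (hb : b ∈ 𝒜 d)
    {V : (projOver 𝒜).left.Opens} (hV : V ≤ Proj.basicOpen 𝒜 b) : Γ(twist 𝒜 r, V) :=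
  (⟨fun x => TwistStalk.frac a b (hV x.2), fun x => ⟨V, x.2, 𝟙 _, d, a, b, ha, hb,
    fun y => ⟨hV y.2, rfl⟩⟩⟩ : (twistPredicate 𝒜 r).sections V)

/-- Multiplying a section of `𝒪(r)` by `b / a`, of degree `-r`, gives a function. -/
lemma exists_val_eq_mul_frac {r d : ℕ} {a b : A} (ha : a ∈ 𝒜 (d + r)) (hb : b ∈ 𝒜 d)
    {W : (Proj 𝒜).Opens} (hW : W ≤ Proj.basicOpen 𝒜 a) (s : ∀ x : W, TwistStalk 𝒜 x.1)
    (hs : (twistPredicate 𝒜 r).pred (U := W) s) :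
    ∃ F : Γ(Proj 𝒜, W), ∀ x : W, HomogeneousLocalization.val (F.1 x) =
      s x * TwistStalk.frac b a (hW x.2) := by
  have key (x : W) (e : ℕ) (c b' : A) (hc : c ∈ 𝒜 (e + r)) (hb' : b' ∈ 𝒜 e)
      (hbx : b' ∉ x.1.asHomogeneousIdeal) (h : s x = TwistStalk.frac c b' hbx)
      (hn : c * b ∈ 𝒜 (e + (d + r))) (hd : b' * a ∈ 𝒜 (e + (d + r))) :
      ∃ hba : b' * a ∈ x.1.asHomogeneousIdeal.toIdeal.primeCompl,
      HomogeneousLocalization.val (HomogeneousLocalization.mk (𝒜 := 𝒜)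
        (x := x.1.asHomogeneousIdeal.toIdeal.primeCompl)
        ⟨e + (d + r), ⟨c * b, hn⟩, ⟨b' * a, hd⟩, hba⟩) = s x * TwistStalk.frac b a (hW x.2) := by
    refine ⟨x.1.asHomogeneousIdeal.toIdeal.primeCompl.mul_mem hbx (hW x.2), ?_⟩
    rw [HomogeneousLocalization.val_mk, h]
    exact (TwistStalk.frac_mul 𝒜 c b' b a hbx (hW x.2)).symm
  have hn {e : ℕ} {c : A} (hc : c ∈ 𝒜 (e + r)) : c * b ∈ 𝒜 (e + (d + r)) := by
    rw [add_comm d, ← add_assoc]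
    exact SetLike.mul_mem_graded hc hb
  have hd {e : ℕ} {b' : A} (hb' : b' ∈ 𝒜 e) : b' * a ∈ 𝒜 (e + (d + r)) :=
    SetLike.mul_mem_graded hb' ha
  have ex (x : W) : ∃ z : HomogeneousLocalization.AtPrime 𝒜 x.1.asHomogeneousIdeal.toIdeal,
      z.val = s x * TwistStalk.frac b a (hW x.2) := by
    obtain ⟨V, hx, i, e, c, b', hc, hb', h⟩ := hs x
    obtain ⟨hbx, h⟩ := h ⟨x.1, hx⟩
    obtain ⟨_, h2⟩ := key x e c b' hc hb' hbx h (hn hc) (hd hb')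
    exact ⟨_, h2⟩
  choose z hz using ex
  refine ⟨⟨z, fun x => ?_⟩, hz⟩
  obtain ⟨V, hx, i, e, c, b', hc, hb', h⟩ := hs x
  have h2 (y : V) := (h y).elim fun hby h =>
    key ⟨y.1, i.le y.2⟩ e c b' hc hb' hby h (hn hc) (hd hb')
  exact ⟨V, hx, i, e + (d + r), ⟨c * b, hn hc⟩, ⟨b' * a, hd hb'⟩, fun y => (h2 y).choose,
    fun y => HomogeneousLocalization.val_injective _ ((hz _).trans (h2 y).choose_spec.symm)⟩

lemma isFrame_twistFrac {r d : ℕ} {a b : A} (ha : a ∈ 𝒜 (d + r)) (hb : b ∈ 𝒜 d)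
    {V : (projOver 𝒜).left.Opens} (hVa : V ≤ Proj.basicOpen 𝒜 a)
    (hV : V ≤ Proj.basicOpen 𝒜 b) : IsFrame (twist 𝒜 r) (twistFrac ha hb hV) := by
  intro W hW
  constructor
  · intro f g hfg
    refine TopCat.Presheaf.section_ext (Proj 𝒜).sheaf W _ _ fun x hx => ?_
    have h1 : stalkToTwistStalk 𝒜 x ((Proj 𝒜).presheaf.germ W x hx f) *
        TwistStalk.frac a b (hV (hW hx)) = stalkToTwistStalk 𝒜 x
          ((Proj 𝒜).presheaf.germ W x hx g) * TwistStalk.frac a b (hV (hW hx)) :=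
      congrFun (congrArg Subtype.val hfg) ⟨x, hx⟩
    have h2 := congrArg (· * TwistStalk.frac b a (hVa (hW hx))) h1
    dsimp only at h2
    rw [mul_assoc, mul_assoc, TwistStalk.isUnit_frac (hVa (hW hx)) (hV (hW hx)), mul_one,
      mul_one] at h2
    exact stalkToTwistStalk_injective 𝒜 x h2
  · intro s
    obtain ⟨s, hs⟩ := (s : (twistPredicate 𝒜 r).sections W)
    obtain ⟨F, hF⟩ := exists_val_eq_mul_frac ha hb (hW.trans hVa) s hs
    refine ⟨F, Subtype.ext (funext fun x => ?_)⟩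
    refine (congrArg (· * TwistStalk.frac a b (hV (hW x.2)))
      ((stalkToTwistStalk_germ 𝒜 x.1 x.2 F).trans (hF x))).trans ?_
    dsimp only
    rw [mul_assoc, TwistStalk.isUnit_frac (hV (hW x.2)) (hVa (hW x.2)), mul_one]

end

/-! ### Sections of a very ample line bundle -/

section
variable {X Y : Scheme.{u}} {M : X.Modules}

/-- The section `m` of `M` is a frame on a neighbourhood of `x`. -/
def IsFrameAt {U : X.Opens} (m : Γ(M, U)) (x : X) : Prop :=
  ∃ (V : X.Opens) (h : V ≤ U), x ∈ V ∧ IsFrame M (resSec M h m)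

lemma IsFrame.isUnit_smul {U : X.Opens} {e : Γ(M, U)} (he : IsFrame M e) {c : Γ(X, U)}
    (hc : IsUnit c) : IsFrame M (c • e) := by
  intro V hV
  obtain ⟨d, hd⟩ := hc.map (X.presheaf.map (homOfLE hV).op).hom
  convert (he V hV).comp d.mulRight_bijective using 1
  funext f
  change f • resSec M hV (c • e) = (f * (d : Γ(X, V))) • resSec M hV e
  rw [resSec_smul, smul_smul, hd]

lemma IsFrame.isFrameAt_smul_iff {U : X.Opens} {e : Γ(M, U)} (he : IsFrame M e) (c : Γ(X, U))
    (x : X) (hx : x ∈ U) : IsFrameAt (c • e) x ↔ IsUnit (X.presheaf.germ U x hx c) := by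
  constructor
  · rintro ⟨V, hV, hxV, h⟩
    obtain ⟨d, hd, -⟩ := h.existsUnique le_rfl (resSec M hV e)
    rw [resSec_self, resSec_smul, smul_smul] at hd
    have h1 : d * resFun hV c = 1 := (he.res hV).eq_of_smul_eq (hd.trans (one_smul _ _).symm)
    have h2 := congrArg (X.presheaf.germ V x hxV) h1
    rw [map_mul, map_one, germ_resFun] at h2
    exact IsUnit.of_mul_eq_one_right _ h2
  · intro h
    have h1 : IsUnit (resFun (X.basicOpen_le c) c) := X.toRingedSpace.isUnit_res_basicOpen c
    refine ⟨X.basicOpen c, X.basicOpen_le c, (X.mem_basicOpen c x hx).2 h, ?_⟩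
    rw [resSec_smul]
    exact (he.res _).isUnit_smul h1

lemma IsFrameAt.of_resSec {U V : X.Opens} {m : Γ(M, U)} {x : X} (h : V ≤ U)
    (hm : IsFrameAt (resSec M h m) x) : IsFrameAt m x := by
  obtain ⟨W, hW, hx, hm⟩ := hm
  exact ⟨W, hW.trans h, hx, by rwa [resSec_resSec] at hm⟩

lemma IsFrameAt.resSec {U V : X.Opens} {m : Γ(M, U)} {x : X} (hm : IsFrameAt m x) (h : V ≤ U)
    (hx : x ∈ V) : IsFrameAt (resSec M h m) x := by
  obtain ⟨W, hW, hxW, hm⟩ := hm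
  refine ⟨W ⊓ V, inf_le_right, ⟨hxW, hx⟩, ?_⟩
  have := hm.res (inf_le_left : W ⊓ V ≤ W)
  rw [resSec_resSec] at this ⊢
  exact this

lemma PreservesFrames.isFrameAt_iff {f : Y ⟶ X} {N : Y.Modules} [IsInvertible M]
    {ψ : M ⟶ (Scheme.Modules.pushforward f).obj N} (h : PreservesFrames f ψ) {U : X.Opens}
    (m : Γ(M, U)) (y : Y) (hy : f y ∈ U) :
    IsFrameAt (M := N) (U := f ⁻¹ᵁ U) (ψ.app U m) y ↔ IsFrameAt m (f y) := by
  obtain ⟨V, -, hyV, hVU, e, he⟩ := IsInvertible.exists_isAffineOpen (L := M) (f y) U hy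
  obtain ⟨c, hc, -⟩ := he.existsUnique le_rfl (resSec M hVU m)
  rw [resSec_self] at hc
  have h1 : resSec N (U := f ⁻¹ᵁ U) (V := f ⁻¹ᵁ V) (f.preimage_mono hVU) (ψ.app U m) =
      (f.app V c • (show Γ(N, f ⁻¹ᵁ V) from ψ.app V e) : Γ(N, f ⁻¹ᵁ V)) := by
    refine (app_resSec ψ hVU m).symm.trans ((congrArg (ψ.app V) hc.symm).trans ?_)
    exact Scheme.Modules.Hom.app_smul ψ c e
  have h2 := (h V e he).isFrameAt_smul_iff (f.app V c) y hyV
  have h3 := he.isFrameAt_smul_iff c (f y) hyV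
  have h4 := Scheme.Hom.germ_stalkMap_apply f V y hyV c
  have h5 : IsUnit (Y.presheaf.germ (f ⁻¹ᵁ V) y hyV (f.app V c)) ↔
      IsUnit (X.presheaf.germ V (f y) hyV c) := by
    rw [← h4]
    exact isUnit_map_iff (f.stalkMap y).hom _
  constructor
  · intro hm
    have h6 := hm.resSec (f.preimage_mono hVU) hyV
    rw [h1, h2, h5, ← h3, hc] at h6
    exact h6.of_resSec
  · intro hm
    have h6 := hm.resSec hVU hyV
    rw [← hc, h3, ← h5, ← h2, ← h1] at h6
    exact h6.of_resSec

lemma isFrame_of_restrict {V : X.Opens} {A : V.toScheme.Opens} {s : Γ(M.restrict V.ι, A)}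
    (hs : IsFrame (M.restrict V.ι) s) : IsFrame M (U := V.ι ''ᵁ A) s := by
  intro B hB
  obtain ⟨B, rfl⟩ : ∃ B', V.ι ''ᵁ B' = B := ⟨V.ι ⁻¹ᵁ B, by
    rw [Scheme.Hom.image_preimage_eq_opensRange_inf, Scheme.Opens.opensRange_ι]
    exact inf_eq_right.2 (hB.trans (V.ι_image_le A))⟩
  have hBA : B ≤ A := (V.ι.image_le_image_iff B A).1 hB
  have h1 : Function.Bijective (V.ι.appIso B).hom := ConcreteCategory.bijective_of_isIso _
  have h2 : (fun f : Γ(X, V.ι ''ᵁ B) => f • resSec M hB s) =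
      fun f => (V.ι.appIso B).inv ((V.ι.appIso B).hom f) • resSec M hB s := by
    funext f
    congr 1
    exact congr($((V.ι.appIso B).hom_inv_id).hom f).symm
  change Function.Bijective (fun f : Γ(X, V.ι ''ᵁ B) => f • resSec M hB s)
  rw [h2]
  exact (hs B hBA).comp h1

end

section
variable {k : Type u} [Field k] {A : Type u} [CommRing A] [Algebra k A] {𝒜 : ℕ → Submodule k A}
  [GradedAlgebra 𝒜]

/-- If `a' ∉ y`, so that `a' / b` generates `𝒪(r)` near `y`, and `a / b` generates it there too,
then `a ∉ y`. -/
lemma not_mem_of_isFrameAt_twistFrac {r d : ℕ} {a a' b : A} (ha : a ∈ 𝒜 (d + r))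
    (ha' : a' ∈ 𝒜 (d + r)) (hb : b ∈ 𝒜 d)
    {V : (projOver 𝒜).left.Opens} (hV : V ≤ Proj.basicOpen 𝒜 b) (y : Proj 𝒜) (hyV : y ∈ V)
    (hy : a' ∉ y.asHomogeneousIdeal) (h : IsFrameAt (twistFrac ha hb hV) y) :
    a ∉ y.asHomogeneousIdeal := by
  obtain ⟨W, hW, hyW, h⟩ := h
  have h1 : (W ⊓ Proj.basicOpen 𝒜 a' : (Proj 𝒜).Opens) ≤ V := inf_le_left.trans hW
  let W' : (projOver 𝒜).left.Opens := (W ⊓ Proj.basicOpen 𝒜 a' : (Proj 𝒜).Opens)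
  have hyW' : y ∈ W' := ⟨hyW, hy⟩
  obtain ⟨c, hc, -⟩ := h.existsUnique (V := W') inf_le_left (twistFrac ha' hb (h1.trans hV))
  have h2 : stalkToTwistStalk 𝒜 y ((Proj 𝒜).presheaf.germ W' y hyW' c) *
      TwistStalk.frac a b (hV hyV) = TwistStalk.frac a' b (hV hyV) :=
    congrFun (congrArg Subtype.val hc) ⟨y, hyW'⟩
  have h3 := TwistStalk.isUnit_frac hy (hV hyV)
  rw [← h2, mul_right_comm] at h3
  have h4 : IsUnit (TwistStalk.frac a b (hV hyV)) := IsUnit.of_mul_eq_one_right _ h3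
  have h5 : IsUnit (IsLocalization.mk' (Localization.AtPrime y.asHomogeneousIdeal.toIdeal) a
      (⟨b, hV hyV⟩ : y.asHomogeneousIdeal.toIdeal.primeCompl)) := by
    rw [← Localization.mk_eq_mk'_apply]
    exact h4
  exact (IsLocalization.AtPrime.isUnit_mk'_iff _ y.asHomogeneousIdeal.toIdeal a _).1 h5

variable (k)

lemma exists_X_not_mem (n : ℕ)
    (y : Proj (MvPolynomial.homogeneousSubmodule (Fin (n + 1)) k)) :
    ∃ j : Fin (n + 1), (MvPolynomial.X j : MvPolynomial (Fin (n + 1)) k) ∉ y.asHomogeneousIdeal := by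
  have h := Proj.iSup_basicOpen_eq_top' (MvPolynomial.homogeneousSubmodule (Fin (n + 1)) k)
    (MvPolynomial.X : Fin (n + 1) → MvPolynomial (Fin (n + 1)) k)
    (fun i => ⟨1, MvPolynomial.isHomogeneous_X k i⟩) (by
      refine top_le_iff.1 fun p _ => ?_
      induction p using MvPolynomial.induction_on with
      | C r =>
        exact Subalgebra.algebraMap_mem _
          (⟨MvPolynomial.C r, MvPolynomial.isHomogeneous_C _ r⟩ :
            MvPolynomial.homogeneousSubmodule (Fin (n + 1)) k 0)
      | add p q hp hq => exact add_mem (hp trivial) (hq trivial)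
      | mul_X p i hp => exact mul_mem (hp trivial) (Algebra.subset_adjoin ⟨i, rfl⟩))
  exact Opens.mem_iSup.1 (h.ge (Opens.mem_top y))

/-- The section of `𝒪(1)` given by a coordinate. -/
def coordinateSection (n : ℕ) (j : Fin (n + 1)) : Γ(hyperplaneBundle k n, ⊤) :=
  twistFrac (𝒜 := MvPolynomial.homogeneousSubmodule (Fin (n + 1)) k) (r := 1) (d := 0)
    (a := MvPolynomial.X j) (b := 1) (MvPolynomial.isHomogeneous_X k j)
    SetLike.GradedOne.one_mem (Proj.basicOpen_one _).ge

lemma isFrame_coordinateSection (n : ℕ) (j : Fin (n + 1)) :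
    IsFrame (hyperplaneBundle k n) (U := Proj.basicOpen _ (MvPolynomial.X j))
      (resSec _ le_top (coordinateSection k n j)) :=
  isFrame_twistFrac (𝒜 := MvPolynomial.homogeneousSubmodule (Fin (n + 1)) k)
    (MvPolynomial.isHomogeneous_X k j) SetLike.GradedOne.one_mem le_rfl
    (le_top.trans (Proj.basicOpen_one _).ge)

lemma isFrameAt_coordinateSection_iff (n : ℕ) (j : Fin (n + 1))
    (y : Proj (MvPolynomial.homogeneousSubmodule (Fin (n + 1)) k)) :
    IsFrameAt (coordinateSection k n j) y ↔
      y ∈ Proj.basicOpen (MvPolynomial.homogeneousSubmodule (Fin (n + 1)) k) (MvPolynomial.X j) := by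
  constructor
  · intro h
    obtain ⟨l, hl⟩ := exists_X_not_mem k n y
    exact not_mem_of_isFrameAt_twistFrac
      (𝒜 := MvPolynomial.homogeneousSubmodule (Fin (n + 1)) k) (r := 1) (d := 0)
      (MvPolynomial.isHomogeneous_X k j) (MvPolynomial.isHomogeneous_X k l)
      SetLike.GradedOne.one_mem (Proj.basicOpen_one _).ge y (Opens.mem_top y) hl h
  · exact fun h => ⟨_, le_top, h, isFrame_coordinateSection k n j⟩

instance isInvertible_hyperplaneBundle (n : ℕ) : IsInvertible (hyperplaneBundle k n) where
  exists_frame y := by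
    obtain ⟨l, hl⟩ := exists_X_not_mem k n y
    exact ⟨_, hl, _, isFrame_coordinateSection k n l⟩

variable {k}

lemma IsVeryAmple.isInvertible {Z : Over (Spec (.of k))} {M : Z.left.Modules}
    (hM : IsVeryAmple M) : IsInvertible M := by
  obtain ⟨n, i, hi, ⟨α⟩⟩ := hM
  exact (preservesFrames_homEquiv i.left α.symm).isInvertible

/-- A very ample line bundle has near each point a generating section `m` such that some affine
neighbourhood of the point is the nonvanishing locus of a function on the locus `W` where `m`
generates. -/
lemma IsVeryAmple.exists_section {Z : Over (Spec (.of k))} {M : Z.left.Modules}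
    (hM : IsVeryAmple M) (z : Z.left) : ∃ (m : Γ(M, ⊤)) (W : Z.left.Opens) (g : Γ(Z.left, W)),
      IsFrame M (resSec M (le_top : W ≤ ⊤) m) ∧ (∀ z', IsFrameAt m z' → z' ∈ W) ∧
      z ∈ Z.left.basicOpen g ∧ IsAffineOpen (Z.left.basicOpen g) := by
  obtain ⟨n, i, hi, ⟨α⟩⟩ := hM
  have hψ := preservesFrames_homEquiv i.left α.symm
  obtain ⟨j, hj⟩ := exists_X_not_mem k n (i.left z)
  let D : (projectiveSpace k n).left.Opens :=
    Proj.basicOpen (MvPolynomial.homogeneousSubmodule (Fin (n + 1)) k) (MvPolynomial.X j)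
  have hD : IsAffineOpen D := Proj.isAffineOpen_basicOpen _ _
    (MvPolynomial.isHomogeneous_X k j) one_pos
  have hz : i.left z ∈ i.left.coborderRange :=
    subset_coborder ⟨z, rfl⟩
  -- The immersion `i` is closed in the open set `coborderRange`, hence affine over its affine open
  -- subsets.
  obtain ⟨G, hG, hzG⟩ := hD.exists_basicOpen_le ⟨i.left z, hz⟩ hj
  refine ⟨((Scheme.Modules.pullbackPushforwardAdjunction i.left).homEquiv _ _ α.symm.hom).app ⊤
      (coordinateSection k n j), i.left ⁻¹ᵁ D, i.left.app D G, ?_, fun z' hz' => ?_, ?_, ?_⟩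
  · have h1 := hψ _ _ (isFrame_coordinateSection k n j)
    have h2 := app_resSec ((Scheme.Modules.pullbackPushforwardAdjunction i.left).homEquiv _ _
      α.symm.hom) (le_top : D ≤ ⊤) (coordinateSection k n j)
    exact h2 ▸ h1
  · exact (isFrameAt_coordinateSection_iff k n j _).1 ((hψ.isFrameAt_iff _ z' (Opens.mem_top _)).1 hz')
  · rw [← Scheme.preimage_basicOpen]
    exact hzG
  · rw [← Scheme.preimage_basicOpen]
    have h1 := (hD.basicOpen G).preimage_of_isOpenImmersion i.left.coborderRange.ι
      (hG.trans (Scheme.Opens.opensRange_ι _).ge)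
    have h2 := h1.preimage i.left.liftCoborder
    rw [← Scheme.Hom.comp_preimage, Scheme.Hom.liftCoborder_ι] at h2
    exact h2

end

/-! ### Pulling back sections to the tensor power -/

section
variable {X : Scheme.{u}} {L : X.Modules}

lemma isNonzeroAt_smul_iff {x : X} (c : X.presheaf.stalk x) {z : TensorStalk L x}
    (hz : IsNonzeroAt z) : IsNonzeroAt (c • z) ↔ IsUnit c := by
  rw [IsNonzeroAt, not_iff_comm, ← mem_nonunits_iff, ← IsLocalRing.mem_maximalIdeal]
  constructor
  · exact fun h => Submodule.smul_mem_smul h trivial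
  · intro h
    by_contra hc
    rw [IsLocalRing.mem_maximalIdeal, mem_nonunits_iff, not_not] at hc
    obtain ⟨d, rfl⟩ := hc
    refine hz ?_
    have := Submodule.smul_mem _ (↑d⁻¹ : X.presheaf.stalk x) h
    rwa [smul_smul, Units.inv_mul, one_smul] at this

end

section
variable {X Z : Scheme.{u}} {U : X.Opens} (φ : U.toScheme ⟶ Z)

lemma isUnit_germ_pullFun_iff {A : X.Opens} {W : Z.Opens} (h : A ≤ U.ι ''ᵁ φ ⁻¹ᵁ W)
    (x : U.toScheme) (hx : x.1 ∈ A) (hxW : φ x ∈ W) (c : Γ(Z, W)) :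
    IsUnit (X.presheaf.germ A x.1 hx (pullFun φ h c)) ↔
      IsUnit (Z.presheaf.germ W (φ x) hxW c) := by
  have h1 := congr($(U.germ_stalkIso_hom (V := φ ⁻¹ᵁ W) x hxW) (φ.app W c))
  have h2 := Scheme.Hom.germ_stalkMap_apply φ W x hxW c
  rw [pullFun_apply, germ_resFun]
  refine (iff_of_eq (congrArg IsUnit h1)).symm.trans ((isUnit_map_iff (U.stalkIso x).hom.hom _).trans
    ((iff_of_eq (congrArg IsUnit h2)).symm.trans (isUnit_map_iff (φ.stalkMap x).hom _)))

end

section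
variable {k : Type u} [Field k] {X Z : Over (Spec (.of k))}
  {L : X.left.Modules} {U : X.left.Opens} {φ : openOver U ⟶ Z} {M : Z.left.Modules} {r : ℕ}
  (θ : (Scheme.Modules.pullback φ.left).obj M ≅ (tensorPow L r).restrict U.ι)

/-- The section of `L^{⊗ r}` that corresponds to `φ^* m`. -/
def tensorPullback {W : Z.left.Opens} (m : Γ(M, W)) :
    tensorSections L r (U.ι ''ᵁ φ.left ⁻¹ᵁ W) :=
  θ.hom.app (φ.left ⁻¹ᵁ W) (pullSec φ.left M m)

lemma tensorPullback_smul {W : Z.left.Opens} (c : Γ(Z.left, W)) (m : Γ(M, W))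
    (x : (U.ι ''ᵁ φ.left ⁻¹ᵁ W : X.left.Opens)) : (tensorPullback θ (c • m)).1 x =
      X.left.presheaf.germ _ x.1 x.2 (pullFun φ.left le_rfl c) • (tensorPullback θ m).1 x := by
  have h1 : θ.hom.app (φ.left ⁻¹ᵁ W) (pullSec φ.left M (c • m)) =
      φ.left.app W c • θ.hom.app (φ.left ⁻¹ᵁ W) (pullSec φ.left M m) :=
    (congrArg (θ.hom.app (φ.left ⁻¹ᵁ W)) (pullSec_smul φ.left M c m)).trans
      (Scheme.Modules.Hom.app_smul θ.hom _ _)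
  have h2 : (U.ι.appIso (φ.left ⁻¹ᵁ W)).inv (φ.left.app W c) = pullFun φ.left le_rfl c := by
    rw [pullFun_apply, resFun_self, Scheme.Opens.ι_appIso]
    rfl
  refine (congrFun (congrArg Subtype.val h1) x).trans ?_
  exact congrArg (fun c => X.left.presheaf.germ _ x.1 x.2 c • (tensorPullback θ m).1 x) h2

lemma tensorPullback_res {W W' : Z.left.Opens} (h : W' ≤ W) (m : Γ(M, W))
    (x : (U.ι ''ᵁ φ.left ⁻¹ᵁ W' : X.left.Opens)) : (tensorPullback θ (resSec M h m)).1 x =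
      (tensorPullback θ m).1 ⟨x.1, U.ι.image_mono (φ.left.preimage_mono h) x.2⟩ := by
  have h1 : θ.hom.app (φ.left ⁻¹ᵁ W') (pullSec φ.left M (resSec M h m)) =
      resSec ((tensorPow L r).restrict U.ι) (φ.left.preimage_mono h)
        (θ.hom.app (φ.left ⁻¹ᵁ W) (pullSec φ.left M m)) :=
    (congrArg (θ.hom.app (φ.left ⁻¹ᵁ W')) (pullSec_res φ.left M h m)).trans
      (app_resSec θ.hom _ _)
  exact congrFun (congrArg Subtype.val h1) x

variable [IsInvertible L]

lemma isNonzeroAt_tensorPullback_of_isFrame {W : Z.left.Opens} {m : Γ(M, W)} (hm : IsFrame M m)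
    (x : (U.ι ''ᵁ φ.left ⁻¹ᵁ W : X.left.Opens)) : IsNonzeroAt ((tensorPullback θ m).1 x) :=
  IsFrame.isNonzeroAt (t := (tensorPullback θ m : Γ(tensorPow L r, _)))
    (isFrame_of_restrict ((hm.pullSec φ.left).map_iso θ)) x

/-- `φ^* m` vanishes exactly over the points where `m` does not generate `M`. -/
lemma isNonzeroAt_tensorPullback_iff [IsInvertible M] {W : Z.left.Opens} (m : Γ(M, W))
    (x : U.toScheme) (hx : φ.left x ∈ W) :
    IsNonzeroAt ((tensorPullback θ m).1 ⟨x.1, x, hx, rfl⟩) ↔ IsFrameAt m (φ.left x) := by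
  obtain ⟨V, -, hxV, hVW, e, he⟩ := IsInvertible.exists_isAffineOpen (L := M) (φ.left x) W hx
  obtain ⟨c, hc, -⟩ := he.existsUnique le_rfl (resSec M hVW m)
  rw [resSec_self] at hc
  have h1 := tensorPullback_res θ hVW m ⟨x.1, x, hxV, rfl⟩
  have h2 := tensorPullback_smul θ c e ⟨x.1, x, hxV, rfl⟩
  rw [hc, h1] at h2
  have h3 := isNonzeroAt_tensorPullback_of_isFrame θ he ⟨x.1, x, hxV, rfl⟩
  have h4 : IsFrameAt m (φ.left x) ↔ IsFrameAt (resSec M hVW m) (φ.left x) :=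
    ⟨fun h => h.resSec hVW hxV, fun h => h.of_resSec⟩
  rw [h4, ← hc, he.isFrameAt_smul_iff c _ hxV]
  refine (iff_of_eq (congrArg IsNonzeroAt h2)).trans ((isNonzeroAt_smul_iff _ h3).trans ?_)
  exact isUnit_germ_pullFun_iff φ.left le_rfl x ⟨x, hxV, rfl⟩ hxV c

end

/-! ### Charts -/

section
open MonoidalCategory CartesianMonoidalCategory
variable {k : Type u} [Field k] {H X Z : Over (Spec (.of k))} [GrpObj H] [ModObj H X]
  {L : X.left.Modules} [IsInvertible L] (Φ : Linearisation H X L)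
  {U : X.left.Opens} {φ : openOver U ⟶ Z} {M : Z.left.Modules} {r : ℕ}
  (θ : (Scheme.Modules.pullback φ.left).obj M ≅ (tensorPow L r).restrict U.ι)

/-- An invariant `h` such that `φ` maps `X_h ⊆ U` to an affine open set `W` on which the section `m`
generates `M`, together with a fraction `a / b` of invariants that represents `φ^* m` on `X_h` and
generates `𝒪(r)` on `D_+(h)`. The invariant `h` is a multiple of `f`. -/
structure Chart (f : PosInvariant Φ) where
  /-- The degree of `h`. -/
  deg : ℕ
  deg_pos : 0 < deg
  /-- The invariant that defines the open sets `X_h` and `D_+(h)`. -/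
  h : invariants Φ deg
  /-- The degree of `h / f`. -/
  codeg : ℕ
  /-- The quotient of `h` by `f`. -/
  cofactor : invariants Φ codeg
  deg_eq : deg = f.1 + 1 + codeg
  ofInvariant_eq : ofInvariant Φ deg h = f.elem * ofInvariant Φ codeg cofactor
  locus_le : locus Φ h ≤ f.locus
  locus_le_domain : locus Φ h ≤ U
  /-- The affine open set that contains the image of `X_h`. -/
  W : Z.left.Opens
  isAffineOpen : IsAffineOpen W
  locus_le_preimage : locus Φ h ≤ U.ι ''ᵁ φ.left ⁻¹ᵁ W
  /-- A generator of `M` on `W`. -/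
  m : Γ(M, W)
  isFrame : IsFrame M m
  /-- The degree of the denominator `b`. -/
  d : ℕ
  /-- The numerator of the fraction that represents `φ^* m`. -/
  a : invariants Φ (d + r)
  /-- The denominator of the fraction that represents `φ^* m`. -/
  b : invariants Φ d
  le_num : Proj.basicOpen (grading Φ) (ofInvariant Φ deg h) ≤
    Proj.basicOpen (grading Φ) (ofInvariant Φ _ a)
  le_den : Proj.basicOpen (grading Φ) (ofInvariant Φ deg h) ≤
    Proj.basicOpen (grading Φ) (ofInvariant Φ _ b)
  evalAt_eq : ∀ x (hx : x ∈ locus Φ h), evalAt Φ x (ofInvariant Φ _ a) =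
    evalAt Φ x (ofInvariant Φ _ b) * (tensorPullback θ m).1 ⟨x, locus_le_preimage hx⟩

variable {Φ}

lemma mem_image_preimage {W : Z.left.Opens} {x : X.left} (hx : x ∈ U)
    (h : φ.left ⟨x, hx⟩ ∈ W) : x ∈ U.ι ''ᵁ φ.left ⁻¹ᵁ W := ⟨⟨x, hx⟩, h, rfl⟩

lemma isNonzeroAt_evalAt_iff {n : ℕ} (s : invariants Φ n) (x : X.left) :
    IsNonzeroAt (evalAt Φ x (ofInvariant Φ n s)) ↔ x ∈ locus Φ s := by
  rw [evalAt_ofInvariant]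
  exact ⟨fun h => ⟨trivial, h⟩, fun ⟨_, h⟩ => h⟩

lemma exists_chart [IsIntegral X.left] [CompactSpace X.left] [CompactSpace (H ⊗ X).left]
    (hM : IsVeryAmple M) (hφ : IsInvariantMorphism H φ) (hθ : IsEquivariantIso Φ θ)
    (f : PosInvariant Φ) (hfU : f.locus ≤ U) (x : X.left) (hx : x ∈ f.locus) :
    ∃ c : Chart Φ θ f, x ∈ locus Φ c.h := by
  have := hM.isInvertible
  obtain ⟨m, W, g, hm, hmW, hxg, hg⟩ := hM.exists_section (φ.left ⟨x, hfU hx⟩)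
  have htop : f.locus ≤ U.ι ''ᵁ φ.left ⁻¹ᵁ ⊤ := fun y hy => mem_image_preimage (hfU hy) trivial
  -- `φ^* m` extends to `X` after multiplication by a power of `f`.
  obtain ⟨N, s, hs⟩ := exists_invariant_extension f.2 ⟨x, hx⟩
    (res_mem_tensorSections htop (tensorPullback θ m).2)
    (fun y hp ha => hθ ⊤ m y (htop hp) (htop ha))
  let f₀ := mulInvariants Φ f.2 s
  have hf₀ : locus Φ f₀ = f.locus ⊓ locus Φ s := locus_mul Φ f.2 s
  have ht (y : X.left) (hy : y ∈ f.locus) : y ∈ locus Φ s ↔ IsFrameAt m (φ.left ⟨y, hfU hy⟩) := by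
    rw [← isNonzeroAt_tensorPullback_iff θ m ⟨y, hfU hy⟩ trivial, ← isNonzeroAt_evalAt_iff,
      hs ⟨y, hy⟩]
    have h1 := isNonzeroAt_mul_iff
      (evalAt_mem Φ (SetLike.pow_mem_graded N (ofInvariant_mem Φ f.2)) f.locus)
      (res_mem_tensorSections htop (tensorPullback θ m).2) ⟨y, hy⟩
    have h2 := isNonzeroAt_evalAt_pow Φ f.2 y hy N
    rw [map_pow] at h1 h2
    exact h1.trans ⟨fun h => h.2, fun h => ⟨h2, h⟩⟩
  have hf₀W : locus Φ f₀ ≤ U.ι ''ᵁ φ.left ⁻¹ᵁ W := fun y hy => by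
    rw [hf₀] at hy
    exact mem_image_preimage (hfU hy.1) (hmW _ ((ht y hy.1).1 hy.2))
  have hxf₀ : x ∈ locus Φ f₀ := by
    rw [hf₀]
    exact ⟨hx, (ht x hx).2 ⟨W, le_top, Z.left.basicOpen_le g hxg, hm⟩⟩
  -- The function `φ^* g` on `X_{f₀}` extends to `X` after multiplication by a power of `f₀`.
  obtain ⟨N₁, s₁, hs₁⟩ := exists_invariant_eq_smul f₀ ⟨x, hxf₀⟩ (pullFun φ.left hf₀W g)
    (hφ.isInvariantFun φ hf₀W g)
  let h := mulInvariants Φ f₀ s₁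
  have hh : locus Φ h = locus Φ f₀ ⊓ locus Φ s₁ := locus_mul Φ f₀ s₁
  have hs₁' (y : X.left) (hy : y ∈ locus Φ f₀) (hyU : y ∈ U) :
      y ∈ locus Φ s₁ ↔ φ.left ⟨y, hyU⟩ ∈ Z.left.basicOpen g := by
    have h1 := isNonzeroAt_evalAt_pow Φ f₀ y hy N₁
    rw [map_pow] at h1
    have hyW : φ.left ⟨y, hyU⟩ ∈ W := by
      obtain ⟨y', hy', rfl⟩ := hf₀W hy
      exact hy'
    rw [← isNonzeroAt_evalAt_iff, hs₁ ⟨y, hy⟩, isNonzeroAt_smul_iff _ h1,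
      Z.left.mem_basicOpen g _ hyW]
    exact isUnit_germ_pullFun_iff φ.left hf₀W ⟨y, hyU⟩ hy hyW g
  have hhf₀ : ofInvariant Φ _ h = ofInvariant Φ _ f₀ * ofInvariant Φ _ s₁ := ofInvariant_mul Φ f₀ s₁
  have hf₀f : ofInvariant Φ _ f₀ = f.elem * ofInvariant Φ _ s := ofInvariant_mul Φ f.2 s
  have hhf : ofInvariant Φ _ h = f.elem * ofInvariant Φ _ (mulInvariants Φ s s₁) := by
    rw [hhf₀, hf₀f, ofInvariant_mul, mul_assoc]
  have hle : locus Φ h ≤ f.locus ⊓ locus Φ s := by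
    rw [hh, hf₀]
    exact inf_le_left
  have hW : locus Φ h ≤ U.ι ''ᵁ φ.left ⁻¹ᵁ Z.left.basicOpen g := fun y hy => by
    have h1 := hfU (hle hy).1
    rw [hh] at hy
    exact mem_image_preimage h1 ((hs₁' y hy.1 h1).1 hy.2)
  obtain ⟨b, hb⟩ : f.elem ^ N ∈ grading Φ (N * (f.1 + 1)) :=
    SetLike.pow_mem_graded N (ofInvariant_mem Φ f.2)
  refine ⟨⟨_, Nat.add_pos_left (Nat.add_pos_left f.1.succ_pos _) _, h, _, mulInvariants Φ s s₁,
    add_assoc _ _ _, hhf, hle.trans inf_le_left, (hle.trans inf_le_left).trans hfU,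
    Z.left.basicOpen g, hg, hW, resSec M le_top m, ?_, N * (f.1 + 1), s, b, ?_, ?_, ?_⟩, ?_⟩
  · have := hm.res (Z.left.basicOpen_le g)
    rwa [resSec_resSec] at this
  · exact Proj.basicOpen_mono _ _ _ ⟨f.elem * ofInvariant Φ _ s₁, by rw [hhf₀, hf₀f]; ring⟩
  · rw [hb]
    exact fun y hy => y.asHomogeneousIdeal.toIdeal.primeCompl.pow_mem
      (Proj.basicOpen_mono _ _ _ ⟨_, hhf⟩ hy) N
  · intro y hy
    rw [tensorPullback_res, hb, map_pow]
    exact hs ⟨y, (hle hy).1⟩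
  · change x ∈ locus Φ h
    rw [hh]
    exact ⟨hxf₀, (hs₁' x hxf₀ (hfU hx)).2 hxg⟩

end

/-! ### Gluing the morphisms on the charts -/

section
variable {X Y : Scheme.{u}} {J : Type u}

lemma exists_hom_glue (D : J → X.Opens) (f : ∀ j, (D j).toScheme ⟶ Y)
    (h : ∀ i j, X.homOfLE (inf_le_left : D i ⊓ D j ≤ D i) ≫ f i =
      X.homOfLE (inf_le_right : D i ⊓ D j ≤ D j) ≫ f j) :
    ∃ g : (⨆ j, D j).toScheme ⟶ Y, ∀ j, X.homOfLE (le_iSup D j) ≫ g = f j :=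
  ⟨(Scheme.Opens.iSupOpenCover D).glueMorphisms f (pullback_compat D f h),
    fun j => (Scheme.Opens.iSupOpenCover D).ι_glueMorphisms _ _ j⟩

lemma hom_ext_of_le_iSup {U : X.Opens} (V : J → X.Opens) (hV : ∀ j, V j ≤ U) (hU : U ≤ ⨆ j, V j)
    {f g : U.toScheme ⟶ Y} (h : ∀ j, X.homOfLE (hV j) ≫ f = X.homOfLE (hV j) ≫ g) : f = g := by
  obtain rfl : U = ⨆ j, V j := le_antisymm hU (iSup_le hV)
  exact (Scheme.Opens.iSupOpenCover V).hom_ext _ _ h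

end

section
open MonoidalCategory CartesianMonoidalCategory
variable {k : Type u} [Field k] {H X Z : Over (Spec (.of k))} [GrpObj H] [ModObj H X]
  {L : X.left.Modules} [IsInvertible L] {Φ : Linearisation H X L}

lemma homOfLE_locusToBasicOpen {m n d : ℕ} {f : invariants Φ m} {g : invariants Φ n} (hm : 0 < m)
    (hd0 : 0 < d) (hd : d = m + n) (h : invariants Φ d)
    (hh : ofInvariant Φ d h = ofInvariant Φ m f * ofInvariant Φ n g)
    (hle : locus Φ h ≤ locus Φ f)
    (hD : Proj.basicOpen (grading Φ) (ofInvariant Φ d h) ≤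
      Proj.basicOpen (grading Φ) (ofInvariant Φ m f)) :
    X.left.homOfLE hle ≫ locusToBasicOpen f hm =
      locusToBasicOpen h hd0 ≫ (Proj (grading Φ)).homOfLE hD := by
  rw [← cancel_mono (Scheme.Opens.ι _), Category.assoc, Category.assoc, Scheme.homOfLE_ι,
    locusToBasicOpen_ι, locusToBasicOpen_ι]
  exact homOfLE_locusToProj Φ f hm hd0 hd h hh hle

lemma basicOpen_mulInvariants {m n : ℕ} (f : invariants Φ m) (g : invariants Φ n) :
    Proj.basicOpen (grading Φ) (ofInvariant Φ _ (mulInvariants Φ f g)) =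
      Proj.basicOpen (grading Φ) (ofInvariant Φ m f) ⊓
        Proj.basicOpen (grading Φ) (ofInvariant Φ n g) := by
  rw [ofInvariant_mul, Proj.basicOpen_mul]

lemma locus_mulInvariants_nonempty [IrreducibleSpace X.left] {m n : ℕ} {f : invariants Φ m}
    {g : invariants Φ n} (hf : (locus Φ f : Set X.left).Nonempty)
    (hg : (locus Φ g : Set X.left).Nonempty) :
    (locus Φ (mulInvariants Φ f g) : Set X.left).Nonempty := by
  rw [locus_mul]
  exact nonempty_preirreducible_inter (locus Φ f).2 (locus Φ g).2 hf hg

/-- Morphisms from `D_+(f)` and `D_+(g)` to a separated scheme that restrict to the same morphism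
on `X_f ∩ X_g` agree on `D_+(f) ∩ D_+(g)`, since the image of `X_{fg}` is dense in it. -/
lemma homOfLE_comp_eq_of_locusToBasicOpen [IsIntegral X.left] {Y : Scheme.{u}} [Y.IsSeparated]
    {U : X.left.Opens} (φ : U.toScheme ⟶ Y) {m n : ℕ} {f : invariants Φ m} {g : invariants Φ n}
    (hm : 0 < m) (hn : 0 < n) (hf : (locus Φ f : Set X.left).Nonempty)
    (hg : (locus Φ g : Set X.left).Nonempty) (hfU : locus Φ f ≤ U) (hgU : locus Φ g ≤ U)
    {ψ : (Proj.basicOpen (grading Φ) (ofInvariant Φ m f)).toScheme ⟶ Y}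
    {ψ' : (Proj.basicOpen (grading Φ) (ofInvariant Φ n g)).toScheme ⟶ Y}
    (hψ : locusToBasicOpen f hm ≫ ψ = X.left.homOfLE hfU ≫ φ)
    (hψ' : locusToBasicOpen g hn ≫ ψ' = X.left.homOfLE hgU ≫ φ) :
    (Proj (grading Φ)).homOfLE inf_le_left ≫ ψ = (Proj (grading Φ)).homOfLE inf_le_right ≫ ψ' := by
  have hD := (basicOpen_mulInvariants f g).le
  have hX := (locus_mul Φ f g).le
  have hmn : 0 < m + n := Nat.add_pos_left hm n
  have := isReduced_proj (Φ := Φ)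
  have hdom : IsDominant (locusToBasicOpen (mulInvariants Φ f g) hmn ≫
      (Proj (grading Φ)).homOfLE hD) := by
    have h1 := isDominant_locusToProj (mulInvariants Φ f g) hmn (locus_mulInvariants_nonempty hf hg)
    rw [← locusToBasicOpen_ι, ← Scheme.homOfLE_ι _ hD, ← Category.assoc] at h1
    exact IsDominant.of_comp_of_isOpenImmersion _ (Scheme.Opens.ι _)
  have e1 := homOfLE_locusToBasicOpen hm hmn rfl (mulInvariants Φ f g) (ofInvariant_mul Φ f g)
    (hX.trans inf_le_left) (hD.trans inf_le_left)
  have e2 := homOfLE_locusToBasicOpen hn hmn (add_comm m n) (mulInvariants Φ f g)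
    ((ofInvariant_mul Φ f g).trans (mul_comm _ _)) (hX.trans inf_le_right) (hD.trans inf_le_right)
  refine ext_of_isDominant (locusToBasicOpen (mulInvariants Φ f g) hmn ≫
      (Proj (grading Φ)).homOfLE hD) ?_
  rw [Category.assoc, Category.assoc, Scheme.homOfLE_homOfLE_assoc, Scheme.homOfLE_homOfLE_assoc,
    ← Category.assoc, ← Category.assoc, ← e1, ← e2, Category.assoc, Category.assoc, hψ, hψ']
  exact (Scheme.homOfLE_homOfLE_assoc X.left _ _ _).trans
    (Scheme.homOfLE_homOfLE_assoc X.left _ _ _).symm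

end

section
open MonoidalCategory CartesianMonoidalCategory
variable {k : Type u} [Field k] {H X Z : Over (Spec (.of k))} [GrpObj H] [ModObj H X]
  {L : X.left.Modules} [IsInvertible L] {Φ : Linearisation H X L}
  {U : X.left.Opens} {φ : openOver U ⟶ Z} {M : Z.left.Modules} {r : ℕ}
  {θ : (Scheme.Modules.pullback φ.left).obj M ≅ (tensorPow L r).restrict U.ι}

/-- The open set `D_+(h)`. -/
abbrev Chart.basicOpen {f : PosInvariant Φ} (c : Chart Φ θ f) : (Proj (grading Φ)).Opens :=
  Proj.basicOpen (grading Φ) (ofInvariant Φ c.deg c.h)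

variable {J : Type u} {f : J → PosInvariant Φ} (c : ∀ j, Chart Φ θ (f j))

/-- The union of the open sets `D_+(h)`. -/
abbrev chartUnion : (Proj (grading Φ)).Opens := ⨆ j, (c j).basicOpen

lemma basicOpen_le_chartUnion (j : J) : (c j).basicOpen ≤ chartUnion c :=
  le_iSup (fun j => (c j).basicOpen) j

lemma isInnerEnvelopingQuotient_iSup_basicOpen [Finite J] (hU : U ≤ semistable Φ)
    (hf : ∀ j, f j ∈ finitelyGenerated Φ) (hc : U ≤ ⨆ j, locus Φ (c j).h) :
    IsInnerEnvelopingQuotient hU (chartUnion c) where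
  isCompact := by
    have h : IsCompact (⋃ j, ((c j).basicOpen : Set (Proj (grading Φ)))) :=
      isCompact_iUnion fun j => (Proj.isAffineOpen_basicOpen (grading Φ) _
        (ofInvariant_mem Φ (c j).h) (c j).deg_pos).isCompact
    rw [← Opens.coe_iSup] at h
    exact h
  le_envelopingQuotient := iSup_le fun j =>
    (Proj.basicOpen_mono _ _ _ ⟨_, (c j).ofInvariant_eq⟩).trans
      (le_iSup (fun g : finitelyGenerated Φ => Proj.basicOpen (grading Φ) g.1.elem) ⟨f j, hf j⟩)
  range_subset := by
    rintro _ ⟨x, rfl⟩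
    obtain ⟨j, hj⟩ := Opens.mem_iSup.1 (hc x.2)
    have h1 := homOfLE_quotientMapOn_locus hU (hf j) (c j).deg_pos (c j).deg_eq
      (c j).ofInvariant_eq (c j).locus_le_domain (c j).locus_le
    have h2 := locusToProj_mem (c j).h (c j).deg_pos ⟨x.1, hj⟩
    have h4 : X.left.homOfLE (c j).locus_le_domain ⟨x.1, hj⟩ = x :=
      Subtype.ext (X.left.homOfLE_apply (c j).locus_le_domain _)
    have h5 : quotientMapOn hU x = locusToProj Φ (c j).h (c j).deg_pos ⟨x.1, hj⟩ :=
      (congrArg (quotientMapOn hU) h4.symm).trans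
        (congrArg (fun g : (locus Φ (c j).h).toScheme ⟶ Proj (grading Φ) => g ⟨x.1, hj⟩) h1)
    exact h5 ▸ basicOpen_le_chartUnion c j h2

lemma IsInnerEnvelopingQuotient.map_ι {hU : U ≤ semistable Φ}
    {𝒰 : (projOver (grading Φ)).left.Opens} (h : IsInnerEnvelopingQuotient hU 𝒰) :
    h.map ≫ 𝒰.ι = quotientMapOn hU :=
  IsOpenImmersion.lift_fac _ _ _

/-- On `X_h`, for `h` a multiple of some `f ∈ I^{ss,fg}`, the map `q` to an inner enveloping
quotient that contains `D_+(h)` is the natural map to `D_+(h)`. -/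
lemma IsInnerEnvelopingQuotient.homOfLE_map {hU : U ≤ semistable Φ} {𝒰 : (Proj (grading Φ)).Opens}
    (hq : IsInnerEnvelopingQuotient hU 𝒰)
    {f : PosInvariant Φ} (hf : f ∈ finitelyGenerated Φ) {n d : ℕ} (hd0 : 0 < d) {h : invariants Φ d}
    {g : invariants Φ n} (hd : d = f.1 + 1 + n)
    (hh : ofInvariant Φ d h = f.elem * ofInvariant Φ n g) (hA : locus Φ h ≤ U)
    (hle : locus Φ h ≤ f.locus) (hD : Proj.basicOpen (grading Φ) (ofInvariant Φ d h) ≤ 𝒰) :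
    X.left.homOfLE hA ≫ hq.map = locusToBasicOpen h hd0 ≫ (Proj (grading Φ)).homOfLE hD := by
  have h1 := homOfLE_quotientMapOn_locus hU hf hd0 hd hh hA hle
  have h2 : locusToBasicOpen h hd0 ≫ (Proj (grading Φ)).homOfLE hD ≫ 𝒰.ι =
      locusToProj Φ h hd0 := by
    rw [Scheme.homOfLE_ι, locusToBasicOpen_ι]
  refine (cancel_mono (Scheme.Opens.ι 𝒰)).1 ?_
  refine (Category.assoc _ _ _).trans (Eq.trans ?_ (Category.assoc _ _ _).symm)
  exact (congrArg (X.left.homOfLE hA ≫ ·) hq.map_ι).trans (h1.trans h2.symm)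

/-- The morphisms `D_+(h_j) → Z` through which `φ` factors on the `X_{h_j}` glue to a morphism over
`k`. -/
lemma exists_factorisation [IsIntegral X.left] [CompactSpace X.left] [CompactSpace (H ⊗ X).left]
    [Z.left.IsSeparated] (hφ : IsInvariantMorphism H φ)
    (hne : ∀ j, (locus Φ (c j).h : Set X.left).Nonempty) :
    ∃ ψ : openOver (X := projOver (grading Φ)) (chartUnion c) ⟶ Z,
      ∀ j, locusToBasicOpen (c j).h (c j).deg_pos ≫
          (Proj (grading Φ)).homOfLE (basicOpen_le_chartUnion c j) ≫ ψ.left =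
        X.left.homOfLE (c j).locus_le_domain ≫ φ.left ∧
      (c j).basicOpen ≤ (chartUnion c).ι ''ᵁ ψ.left ⁻¹ᵁ (c j).W := by
  choose ψ hψ hψW using fun j => exists_descent hφ (c j).h (c j).deg_pos (hne j)
    (c j).locus_le_domain (c j).isAffineOpen (c j).locus_le_preimage
  obtain ⟨g, hg⟩ := exists_hom_glue (fun j => (c j).basicOpen) ψ fun i j =>
    homOfLE_comp_eq_of_locusToBasicOpen φ.left (c i).deg_pos (c j).deg_pos (hne i) (hne j)
      (c i).locus_le_domain (c j).locus_le_domain (hψ i) (hψ j)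
  have := isReduced_proj (Φ := Φ)
  have hg' : g ≫ Z.hom = (chartUnion c).ι ≫ (projOver (grading Φ)).hom := by
    refine hom_ext_of_le_iSup (fun j => (c j).basicOpen) (basicOpen_le_chartUnion c) le_rfl
      fun j => ?_
    have := isDominant_locusToBasicOpen (c j).h (c j).deg_pos (hne j)
    refine ext_of_isDominant (locusToBasicOpen (c j).h (c j).deg_pos) ?_
    have h1 : locusToBasicOpen (c j).h (c j).deg_pos ≫
        (Proj (grading Φ)).homOfLE (basicOpen_le_chartUnion c j) ≫ g ≫ Z.hom =
        (locus Φ (c j).h).ι ≫ X.hom := by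
      rw [reassoc_of% hg j, reassoc_of% hψ j]
      have h2 : φ.left ≫ Z.hom = U.ι ≫ X.hom := Over.w φ
      refine (congrArg (X.left.homOfLE (c j).locus_le_domain ≫ ·) h2).trans ?_
      exact Scheme.homOfLE_ι_assoc _ _ _
    refine h1.trans ((locusToProj_hom (c j).h (c j).deg_pos).symm.trans ?_)
    refine (congrArg (· ≫ _) (locusToBasicOpen_ι (c j).h (c j).deg_pos).symm).trans ?_
    refine (Category.assoc _ _ _).trans (congrArg (locusToBasicOpen _ _ ≫ ·) ?_)
    exact (Scheme.homOfLE_ι_assoc (Proj (grading Φ))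
      (basicOpen_le_chartUnion c j) _).symm
  refine ⟨Over.homMk g hg', fun j => ⟨?_, fun y hy => ?_⟩⟩
  · exact (congrArg (locusToBasicOpen _ _ ≫ ·) (hg j)).trans (hψ j)
  · refine ⟨⟨y, Opens.mem_iSup.2 ⟨j, hy⟩⟩, ?_, rfl⟩
    have h1 : ψ j ⟨y, hy⟩ ∈ (c j).W := hψW j ⟨⟨y, hy⟩, rfl⟩
    have h4 : (Proj (grading Φ)).homOfLE (basicOpen_le_chartUnion c j) ⟨y, hy⟩ =
        ⟨y, Opens.mem_iSup.2 ⟨j, hy⟩⟩ :=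
      Subtype.ext ((Proj (grading Φ)).homOfLE_apply (basicOpen_le_chartUnion c j) _)
    have h5 : ψ j ⟨y, hy⟩ = g ⟨y, Opens.mem_iSup.2 ⟨j, hy⟩⟩ :=
      (congrArg (fun t : (c j).basicOpen.toScheme ⟶ Z.left => t ⟨y, hy⟩) (hg j).symm).trans
        (congrArg g h4)
    exact (iff_of_eq (congrArg (· ∈ (c j).W) h5)).1 h1

end

/-! ### Comparison of transition functions -/

section
variable {X Z : Scheme.{u}} {M : Z.Modules} {N : X.Modules}

lemma IsFrame.restrict {V : X.Opens} {A : V.toScheme.Opens} {s : Γ(N, V.ι ''ᵁ A)}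
    (hs : IsFrame N s) : IsFrame (N.restrict V.ι) (U := A) s := by
  intro B hB
  have h1 : Function.Bijective (V.ι.appIso B).inv := ConcreteCategory.bijective_of_isIso _
  exact (hs _ (V.ι.image_mono hB)).comp h1

lemma smul_restrict_ι {V : X.Opens} {A : V.toScheme.Opens} (c : Γ(V.toScheme, A))
    (s : Γ(N, V.ι ''ᵁ A)) : c • (show Γ(N.restrict V.ι, A) from s) =
      ((show Γ(X, V.ι ''ᵁ A) from c) • s : Γ(N, V.ι ''ᵁ A)) := by
  refine (smul_restrict V.ι c _).trans ?_
  rw [Scheme.Opens.ι_appIso]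
  rfl

lemma resSec_restrict_eq_smul {V : X.Opens} {A B₁ B₂ : V.toScheme.Opens} (h₁ : A ≤ B₁)
    (h₂ : A ≤ B₂) {s : Γ(N, V.ι ''ᵁ B₁)} {t : Γ(N, V.ι ''ᵁ B₂)} (u : Γ(V.toScheme, A))
    (h : resSec N (V.ι.image_mono h₁) s =
      (show Γ(X, V.ι ''ᵁ A) from u) • resSec N (V.ι.image_mono h₂) t) :
    resSec (N.restrict V.ι) h₁ s = u • resSec (N.restrict V.ι) h₂ t :=
  h.trans (smul_restrict_ι u (resSec N (V.ι.image_mono h₂) t)).symm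

/-- A morphism `ψ` from an open set pulls `M` back to `N` if the pullbacks of frames of `M` have the
same transition functions as frames of `N` on an open cover. -/
lemma nonempty_pullback_iso_restrict {𝒰 : X.Opens} (ψ : 𝒰.toScheme ⟶ Z) {J : Type*}
    {D : J → X.Opens} (hD : 𝒰 ≤ ⨆ j, D j) {W : J → Z.Opens}
    (hW : ∀ j, D j ≤ 𝒰.ι ''ᵁ ψ ⁻¹ᵁ W j) {m : ∀ j, Γ(M, W j)} (hm : ∀ j, IsFrame M (m j))
    {n : ∀ j, Γ(N, D j)} (hn : ∀ j, IsFrame N (n j))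
    (h : ∀ i j (hle : D i ⊓ D j ≤ 𝒰.ι ''ᵁ ψ ⁻¹ᵁ (W i ⊓ W j)) (v : Γ(Z, W i ⊓ W j)),
      v • resSec M inf_le_right (m j) = resSec M inf_le_left (m i) →
        resSec N inf_le_left (n i) = pullFun ψ hle v • resSec N inf_le_right (n j)) :
    Nonempty ((Scheme.Modules.pullback ψ).obj M ≅ N.restrict 𝒰.ι) := by
  have hV (j) : 𝒰.ι ⁻¹ᵁ D j ≤ ψ ⁻¹ᵁ W j := fun x hx => by
    obtain ⟨y, hy, hyx⟩ := hW j hx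
    rwa [← Subtype.ext hyx]
  have hι (j) : 𝒰.ι ''ᵁ 𝒰.ι ⁻¹ᵁ D j ≤ D j := 𝒰.ι.image_preimage_le _
  have hp (j) := ((hm j).pullSec ψ).res (hV j)
  have hn' (j) := ((hn j).res (hι j)).restrict
  refine ⟨SameTransition.iso (fun i j u hu => ?_) hp hn' (top_le_iff.1 fun x _ => ?_)⟩
  · obtain ⟨v, hv, -⟩ := (hm j).existsUnique inf_le_right
      (resSec M (inf_le_left : W i ⊓ W j ≤ W i) (m i))
    have hVW : 𝒰.ι ⁻¹ᵁ D i ⊓ 𝒰.ι ⁻¹ᵁ D j ≤ ψ ⁻¹ᵁ (W i ⊓ W j) := inf_le_inf (hV i) (hV j)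
    have hle : D i ⊓ D j ≤ 𝒰.ι ''ᵁ ψ ⁻¹ᵁ (W i ⊓ W j) := fun x hx => by
      obtain ⟨y, -, rfl⟩ := hW i hx.1
      exact ⟨y, hVW hx, rfl⟩
    have hu' : resFun hVW (ψ.app _ v) = u := by
      apply ((hp j).res inf_le_right).eq_of_smul_eq
      refine Eq.trans ?_ hu
      have h1 := congrArg (fun s => resSec _ hVW (pullSec ψ M s)) hv
      rw [pullSec_smul, pullSec_res, pullSec_res, resSec_smul, resSec_resSec, resSec_resSec] at h1
      rw [resSec_resSec, resSec_resSec]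
      exact h1
    have hle' : 𝒰.ι ''ᵁ (𝒰.ι ⁻¹ᵁ D i ⊓ 𝒰.ι ⁻¹ᵁ D j) ≤ D i ⊓ D j :=
      le_inf ((𝒰.ι.image_mono inf_le_left).trans (hι i))
        ((𝒰.ι.image_mono inf_le_right).trans (hι j))
    have h2 := congrArg (resSec N hle') (h i j hle v hv)
    rw [resSec_smul, resSec_resSec, resSec_resSec, pullFun_apply, resFun_resFun] at h2
    refine resSec_restrict_eq_smul inf_le_left inf_le_right u ?_
    rw [resSec_resSec, resSec_resSec, ← hu']
    exact h2
  · obtain ⟨j, hj⟩ := Opens.mem_iSup.1 (hD x.2)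
    exact Opens.mem_iSup.2 ⟨j, hj⟩

end

section
open MonoidalCategory CartesianMonoidalCategory
variable {k : Type u} [Field k] {H X Z : Over (Spec (.of k))} [GrpObj H] [ModObj H X]
  {L : X.left.Modules} [IsInvertible L] {Φ : Linearisation H X L}

/-- The value of a function on `D_+(h)` in the localisation at a point. -/
lemma stalkToTwistStalk_germ_awayToSection {A : Type u} [CommRing A] [Algebra k A]
    (𝒜 : ℕ → Submodule k A) [GradedAlgebra 𝒜] (h : A)
    (z : HomogeneousLocalization.NumDenSameDeg 𝒜 (Submonoid.powers h)) (y : Proj 𝒜)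
    (hy : y ∈ Proj.basicOpen 𝒜 h) : ∃ hz : z.den.1 ∉ y.asHomogeneousIdeal,
      stalkToTwistStalk 𝒜 y ((Proj 𝒜).presheaf.germ _ y hy
        (Proj.awayToSection 𝒜 h (HomogeneousLocalization.mk z))) =
      TwistStalk.frac z.num.1 z.den.1 hz :=
  ⟨(Submonoid.powers_le (P := y.asHomogeneousIdeal.toIdeal.primeCompl)).2 hy z.den_mem,
    stalkToTwistStalk_germ 𝒜 y hy _⟩

variable {U : X.left.Opens} {φ : openOver U ⟶ Z} {M : Z.left.Modules} {r : ℕ}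
  {θ : (Scheme.Modules.pullback φ.left).obj M ≅ (tensorPow L r).restrict U.ι}

/-- The fractions `a / b` and `a' / b'` of two charts have the same transition function as the
sections `m` and `m'`. This holds for the restrictions to `X_h ∩ X_{h'}`, where the fractions are
`φ^* m` and `φ^* m'`, and an identity between invariants may be checked on a nonempty open set. -/
lemma Chart.frac_eq [IsIntegral X.left] {f f' : PosInvariant Φ} (c : Chart Φ θ f)
    (c' : Chart Φ θ f') (hc : (locus Φ c.h : Set X.left).Nonempty)
    (hc' : (locus Φ c'.h : Set X.left).Nonempty) {𝒰 : (Proj (grading Φ)).Opens}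
    (ψ : 𝒰.toScheme ⟶ Z.left) (hD : c.basicOpen ≤ 𝒰)
    (hψ : locusToBasicOpen c.h c.deg_pos ≫ (Proj (grading Φ)).homOfLE hD ≫ ψ =
      X.left.homOfLE c.locus_le_domain ≫ φ.left)
    (hle : c.basicOpen ⊓ c'.basicOpen ≤ 𝒰.ι ''ᵁ ψ ⁻¹ᵁ (c.W ⊓ c'.W)) (v : Γ(Z.left, c.W ⊓ c'.W))
    (hv : v • resSec M inf_le_right c'.m = resSec M inf_le_left c.m) (y : Proj (grading Φ))
    (hy : y ∈ c.basicOpen ⊓ c'.basicOpen) :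
    TwistStalk.frac (ofInvariant Φ _ c.a) (ofInvariant Φ _ c.b) (c.le_den hy.1) =
      stalkToTwistStalk (grading Φ) y ((Proj (grading Φ)).presheaf.germ _ y hy (pullFun ψ hle v)) *
        TwistStalk.frac (ofInvariant Φ _ c'.a) (ofInvariant Φ _ c'.b) (c'.le_den hy.2) := by
  let h := mulInvariants Φ c.h c'.h
  have hpos : 0 < c.deg + c'.deg := Nat.add_pos_left c.deg_pos _
  have hDh : Proj.basicOpen (grading Φ) (ofInvariant Φ _ h) ≤ c.basicOpen ⊓ c'.basicOpen :=
    (basicOpen_mulInvariants c.h c'.h).le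
  have hXh : locus Φ h ≤ locus Φ c.h ⊓ locus Φ c'.h := (locus_mul Φ c.h c'.h).le
  have hyh : y ∈ Proj.basicOpen (grading Φ) (ofInvariant Φ _ h) :=
    (basicOpen_mulInvariants c.h c'.h).ge hy
  have hXW : locus Φ h ≤ U.ι ''ᵁ φ.left ⁻¹ᵁ (c.W ⊓ c'.W) := fun x hx => by
    obtain ⟨x, hxW, rfl⟩ := c.locus_le_preimage (hXh hx).1
    obtain ⟨x', hxW', hx'⟩ := c'.locus_le_preimage (hXh hx).2
    obtain rfl : x' = x := Subtype.ext hx'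
    exact ⟨x', ⟨hxW, hxW'⟩, rfl⟩
  obtain ⟨z, hz⟩ : ∃ z, Proj.awayToSection (grading Φ) (ofInvariant Φ _ h) z =
      pullFun ψ (hDh.trans hle) v :=
    (ConcreteCategory.bijective_of_isIso
      (Proj.basicOpenIsoAway (grading Φ) _ (ofInvariant_mem Φ h) hpos).hom).2 _
  have hψh : locusToBasicOpen h hpos ≫ (Proj (grading Φ)).homOfLE
      ((hDh.trans inf_le_left).trans hD) ≫ ψ =
        X.left.homOfLE ((hXh.trans inf_le_left).trans c.locus_le_domain) ≫ φ.left := by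
    have h1 := homOfLE_locusToBasicOpen c.deg_pos hpos rfl h (ofInvariant_mul Φ c.h c'.h)
      (hXh.trans inf_le_left) (hDh.trans inf_le_left)
    rw [← Scheme.homOfLE_homOfLE _ (hDh.trans inf_le_left) hD, Category.assoc, ← Category.assoc,
      ← h1, Category.assoc, hψ]
    exact Scheme.homOfLE_homOfLE_assoc X.left _ _ _
  have hpull := awayToSections_eq_pullFun φ.left ψ h hpos _ _ hψh hXW (hDh.trans hle) v z hz
  obtain ⟨z, rfl⟩ := HomogeneousLocalization.mk_surjective z
  obtain ⟨hden, hgerm⟩ := stalkToTwistStalk_germ_awayToSection (grading Φ) (ofInvariant Φ _ h) z y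
    hyh
  have hgerm' : stalkToTwistStalk (grading Φ) y ((Proj (grading Φ)).presheaf.germ _ y hy
      (pullFun ψ hle v)) = TwistStalk.frac z.num.1 z.den.1 hden := by
    rw [← hgerm, hz, pullFun_apply, pullFun_apply, germ_resFun, germ_resFun]
  refine Eq.trans ?_ ((congrArg (· * _) hgerm').trans
    (TwistStalk.frac_mul (grading Φ) _ _ _ _ hden (c'.le_den hy.2))).symm
  refine TwistStalk.frac_eq_iff _ _ (sub_eq_zero.1 ?_)
  refine eq_zero_of_evalAt_eq_zero (n := c.d + r + (z.deg + c'.d)) (sub_mem ?_ ?_)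
    (locus_mulInvariants_nonempty hc hc') fun x hx => ?_
  · exact SetLike.mul_mem_graded (ofInvariant_mem Φ c.a)
      (SetLike.mul_mem_graded z.den.2 (ofInvariant_mem Φ c'.b))
  · have := SetLike.mul_mem_graded (SetLike.mul_mem_graded z.num.2 (ofInvariant_mem Φ c'.a))
      (ofInvariant_mem Φ c.b)
    rwa [show z.deg + (c'.d + r) + c.d = c.d + r + (z.deg + c'.d) by ring] at this
  · have h1 := isQuotientFun_awayFun Φ h z ⟨x, hx⟩
    have h2 : awayFun Φ h (HomogeneousLocalization.mk z) = pullFun φ.left hXW v := hpull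
    rw [h2, pullFun_apply, germ_resFun] at h1
    have h3 := tensorPullback_smul θ v (resSec M inf_le_right c'.m) ⟨x, hXW hx⟩
    rw [hv, tensorPullback_res, tensorPullback_res, pullFun_apply, germ_resFun] at h3
    rw [map_sub, sub_eq_zero]
    simp only [map_mul]
    rw [c.evalAt_eq x (hXh hx).1, c'.evalAt_eq x (hXh hx).2, h1]
    refine (congrArg (fun t => evalAt Φ x (ofInvariant Φ _ c.b) * t * (evalAt Φ x z.den.1 *
      evalAt Φ x (ofInvariant Φ _ c'.b))) h3).trans ?_
    simp only [mul_smul_comm, smul_mul_assoc]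
    congr 1
    ring

end

/-! ### The factorisation and its uniqueness -/

section
open MonoidalCategory CartesianMonoidalCategory
variable {k : Type u} [Field k] {H X Z : Over (Spec (.of k))} [GrpObj H] [ModObj H X]
  {L : X.left.Modules} [IsInvertible L] {Φ : Linearisation H X L}
  {U : X.left.Opens} {φ : openOver U ⟶ Z} {M : Z.left.Modules} {r : ℕ}
  {θ : (Scheme.Modules.pullback φ.left).obj M ≅ (tensorPow L r).restrict U.ι}

/-- A morphism through which `φ` factors pulls `M` back to `𝒪(r)`. -/
lemma nonempty_pullback_iso_twist [IsIntegral X.left] {J : Type u} {f : J → PosInvariant Φ}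
    (c : ∀ j, Chart Φ θ (f j)) (hne : ∀ j, (locus Φ (c j).h : Set X.left).Nonempty)
    {𝒰 : (projOver (grading Φ)).left.Opens} (h𝒰 : 𝒰 ≤ chartUnion c)
    (hle : ∀ j, (c j).basicOpen ≤ 𝒰) (ψ : 𝒰.toScheme ⟶ Z.left)
    (hψ : ∀ j, locusToBasicOpen (c j).h (c j).deg_pos ≫ (Proj (grading Φ)).homOfLE (hle j) ≫ ψ =
      X.left.homOfLE (c j).locus_le_domain ≫ φ.left)
    (hW : ∀ j, (c j).basicOpen ≤ 𝒰.ι ''ᵁ ψ ⁻¹ᵁ (c j).W) :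
    Nonempty ((Scheme.Modules.pullback ψ).obj M ≅ (twist (grading Φ) r).restrict 𝒰.ι) :=
  nonempty_pullback_iso_restrict ψ h𝒰 hW (fun j => (c j).isFrame)
    (n := fun j => twistFrac (ofInvariant_mem Φ (c j).a) (ofInvariant_mem Φ (c j).b) (c j).le_den)
    (fun j => isFrame_twistFrac _ _ (c j).le_num (c j).le_den)
    fun i j hle' v hv => Subtype.ext (funext fun y =>
      (c i).frac_eq (c j) (hne i) (hne j) ψ (hle i) (hψ i) hle' v hv y.1 y.2)

/-- If finitely many charts cover `U`, then `φ` factors through an inner enveloping quotient on which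
`M` pulls back to `𝒪(r)`. -/
lemma exists_innerEnvelopingQuotient [IsIntegral X.left] [CompactSpace X.left]
    [CompactSpace (H ⊗ X).left] [Z.left.IsSeparated] (hφ : IsInvariantMorphism H φ)
    {J : Type u} [Finite J] {f : J → PosInvariant Φ}
    (c : ∀ j, Chart Φ θ (f j)) (hne : ∀ j, (locus Φ (c j).h : Set X.left).Nonempty)
    (hU : U ≤ semistable Φ)
    (hf : ∀ j, f j ∈ finitelyGenerated Φ) (hc : U ≤ ⨆ j, locus Φ (c j).h) :
    ∃ (𝒰 : (projOver (grading Φ)).left.Opens) (h : IsInnerEnvelopingQuotient hU 𝒰)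
      (φ' : openOver 𝒰 ⟶ Z), φ.left = h.map ≫ φ'.left ∧
      Nonempty ((Scheme.Modules.pullback φ'.left).obj M ≅
        (twist (grading Φ) r).restrict 𝒰.ι) := by
  obtain ⟨ψ, hψ⟩ := exists_factorisation c hφ hne
  have hq := isInnerEnvelopingQuotient_iSup_basicOpen c hU hf hc
  refine ⟨chartUnion c, hq, ψ, ?_, nonempty_pullback_iso_twist c hne le_rfl
    (basicOpen_le_chartUnion c) ψ.left (fun j => (hψ j).1)
    fun j => (hψ j).2⟩
  refine hom_ext_of_le_iSup (fun j => locus Φ (c j).h) (fun j => (c j).locus_le_domain) hc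
    fun j => ?_
  refine (hψ j).1.symm.trans ?_
  have h1 := hq.homOfLE_map (hf j) (c j).deg_pos (c j).deg_eq (c j).ofInvariant_eq
    (c j).locus_le_domain (c j).locus_le (basicOpen_le_chartUnion c j)
  exact (Category.assoc _ _ _).symm.trans
    ((congrArg (· ≫ ψ.left) h1.symm).trans (Category.assoc _ _ _))

/-- `q` maps a nonempty `U` to a dense subset of `Proj S^H`. -/
lemma isDominant_quotientMapOn [IsIntegral X.left] (hU : U ≤ semistable Φ) {f : PosInvariant Φ}
    (hf : f ∈ finitelyGenerated Φ) (hfU : f.locus ≤ U) (hne : (f.locus : Set X.left).Nonempty) :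
    IsDominant (quotientMapOn hU) := by
  have h1 := isDominant_locusToProj f.2 f.1.succ_pos hne
  have h2 : X.left.homOfLE hfU ≫ quotientMapOn hU = locusToProj Φ f.2 f.1.succ_pos := by
    refine (homOfLE_quotientMapOn hU hfU hf le_rfl).trans ?_
    rw [Scheme.homOfLE_rfl]
    exact Category.id_comp _
  have h3 : IsDominant (X.left.homOfLE hfU ≫ quotientMapOn hU) := h2 ▸ h1
  exact IsDominant.of_comp (X.left.homOfLE hfU) (quotientMapOn hU)

/-- Morphisms to a separated scheme that agree after composition with `q` agree. -/
lemma homOfLE_comp_eq_of_map_comp_eq [IsIntegral X.left] {Y : Scheme.{u}} [Y.IsSeparated]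
    {hU : U ≤ semistable Φ} (hdom : IsDominant (quotientMapOn hU))
    {𝒰 𝒰' : (projOver (grading Φ)).left.Opens}
    (h : IsInnerEnvelopingQuotient hU 𝒰) (h' : IsInnerEnvelopingQuotient hU 𝒰')
    (ψ : 𝒰.toScheme ⟶ Y) (ψ' : 𝒰'.toScheme ⟶ Y) (hψ : h.map ≫ ψ = h'.map ≫ ψ') :
    (projOver (grading Φ)).left.homOfLE (inf_le_left : 𝒰 ⊓ 𝒰' ≤ 𝒰) ≫ ψ =
      (projOver (grading Φ)).left.homOfLE (inf_le_right : 𝒰 ⊓ 𝒰' ≤ 𝒰') ≫ ψ' := by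
  have hred : IsReduced (projOver (grading Φ)).left := isReduced_proj (Φ := Φ)
  let q : U.toScheme ⟶ (𝒰 ⊓ 𝒰').toScheme := IsOpenImmersion.lift (𝒰 ⊓ 𝒰').ι (quotientMapOn hU)
    ((Set.subset_inter h.range_subset h'.range_subset).trans (Scheme.Opens.range_ι (𝒰 ⊓ 𝒰')).ge)
  have hq : q ≫ (𝒰 ⊓ 𝒰').ι = quotientMapOn hU := IsOpenImmersion.lift_fac _ _ _
  have : IsDominant q := by
    rw [← hq] at hdom
    exact IsDominant.of_comp_of_isOpenImmersion q (𝒰 ⊓ 𝒰').ι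
  have h1 : q ≫ (projOver (grading Φ)).left.homOfLE inf_le_left = h.map := by
    rw [← cancel_mono 𝒰.ι, Category.assoc, Scheme.homOfLE_ι, hq, h.map_ι]
  have h2 : q ≫ (projOver (grading Φ)).left.homOfLE inf_le_right = h'.map := by
    rw [← cancel_mono 𝒰'.ι, Category.assoc, Scheme.homOfLE_ι, hq, h'.map_ι]
  refine ext_of_isDominant q ?_
  rw [← Category.assoc, ← Category.assoc, h1, h2, hψ]

end

section
open MonoidalCategory CartesianMonoidalCategory
variable {k : Type u} [Field k] {H X : Over (Spec (.of k))}

lemma IsVariety.isSeparated_left (hX : IsVariety X) : X.left.IsSeparated := by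
  have := hX.isSeparated
  exact ⟨by rw [← Limits.terminal.comp_from X.hom]; infer_instance⟩

lemma IsVariety.compactSpace_left (hX : IsVariety X) : CompactSpace X.left := by
  have := hX.quasiCompact
  exact QuasiCompact.compactSpace_of_compactSpace X.hom

lemma IsVariety.isNoetherian_left (hX : IsVariety X) : IsNoetherian X.left := by
  have := hX.compactSpace_left
  have := hX.locallyOfFiniteType
  have := LocallyOfFiniteType.isLocallyNoetherian X.hom
  constructor

lemma IsVariety.compactSpace_prod_left (hH : IsVariety H) (hX : IsVariety X) :
    CompactSpace (H ⊗ X).left := by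
  have := hX.compactSpace_left
  have := hH.quasiCompact
  exact inferInstanceAs (CompactSpace ↑(Limits.pullback H.hom X.hom))

end

end
end EnvQuot

open EnvQuot

/-- Any morphism from `U` with the stated properties factors through an inner enveloping quotient,
and such factorisations agree on overlaps. -/
theorem proposition3p6 {k : Type u} [Field k] [IsAlgClosed k] [CharZero k]
    {H X Z : Over (Spec (.of k))} [GrpObj H] [ModObj H X] (hH : IsLinearAlgebraicGroup H)
    (hX : IsVariety X) (hXirr : IrreducibleSpace X.left)
    (L : X.left.Modules) [IsInvertible L] (Φ : Linearisation H X L)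
    (𝒮 : Set (PosInvariant Φ)) (h𝒮 : 𝒮 ⊆ finitelyGenerated Φ)
    (hU : (unionLocus 𝒮 : Set X.left).Nonempty)
    (hZ : IsVariety Z) (M : Z.left.Modules) (hM : IsVeryAmple M)
    (φ : openOver (unionLocus 𝒮) ⟶ Z) (hφ : IsInvariantMorphism H φ)
    (r : ℕ) (hr : 0 < r)
    (θ : (Scheme.Modules.pullback φ.left).obj M ≅ (tensorPow L r).restrict (unionLocus 𝒮).ι)
    (hθ : IsEquivariantIso Φ θ) :
    (∃ (𝒰 : (projOver (grading Φ)).left.Opens)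
        (h : IsInnerEnvelopingQuotient (unionLocus_le h𝒮) 𝒰) (φ' : openOver 𝒰 ⟶ Z),
      φ.left = h.map ≫ φ'.left ∧
      Nonempty ((Scheme.Modules.pullback φ'.left).obj M ≅ (twist (grading Φ) r).restrict 𝒰.ι)) ∧
    (∀ (𝒰 𝒰' : (projOver (grading Φ)).left.Opens)
        (h : IsInnerEnvelopingQuotient (unionLocus_le h𝒮) 𝒰)
        (h' : IsInnerEnvelopingQuotient (unionLocus_le h𝒮) 𝒰')
        (ψ : openOver 𝒰 ⟶ Z) (ψ' : openOver 𝒰' ⟶ Z),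
      h.map ≫ ψ.left = h'.map ≫ ψ'.left →
        (projOver (grading Φ)).left.homOfLE (inf_le_left : 𝒰 ⊓ 𝒰' ≤ 𝒰) ≫ ψ.left =
          (projOver (grading Φ)).left.homOfLE (inf_le_right : 𝒰 ⊓ 𝒰' ≤ 𝒰') ≫ ψ'.left) := by
  have := hX.isReduced
  have := isIntegral_of_irreducibleSpace_of_isReduced X.left
  have := hX.isNoetherian_left
  have := hH.toIsVariety.compactSpace_prod_left hX
  have := hZ.isSeparated_left
  refine ⟨?_, fun 𝒰 𝒰' h h' ψ ψ' hψ => ?_⟩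
  · have hch (x : unionLocus 𝒮) : ∃ (f : PosInvariant Φ) (_ : f ∈ finitelyGenerated Φ)
        (c : Chart Φ θ f), x.1 ∈ locus Φ c.h := by
      obtain ⟨⟨f, hf⟩, hx⟩ := Opens.mem_iSup.1 x.2
      obtain ⟨c, hc⟩ := exists_chart θ hM hφ hθ f
        (le_iSup (fun f : 𝒮 => f.1.locus) ⟨f, hf⟩) x.1 hx
      exact ⟨f, h𝒮 hf, c, hc⟩
    choose f hf c hc using hch
    obtain ⟨t, ht⟩ := (NoetherianSpace.isCompact (unionLocus 𝒮 : Set X.left)).elim_finite_subcover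
      (fun x => (locus Φ (c x).h : Set X.left)) (fun x => (locus Φ (c x).h).2)
      fun x hx => Set.mem_iUnion.2 ⟨⟨x, hx⟩, hc ⟨x, hx⟩⟩
    refine exists_innerEnvelopingQuotient hφ (fun j : t => c j.1) (fun j => ⟨_, hc j.1⟩) _
      (fun j => hf j.1) fun x hx => ?_
    obtain ⟨j, hj, hx⟩ := Set.mem_iUnion₂.1 (ht hx)
    exact Opens.mem_iSup.2 ⟨⟨j, hj⟩, hx⟩
  · obtain ⟨x, hx⟩ := hU
    obtain ⟨⟨f, hf⟩, hx⟩ := Opens.mem_iSup.1 hx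
    exact homOfLE_comp_eq_of_map_comp_eq (isDominant_quotientMapOn _ (h𝒮 hf)
      (le_iSup (fun f : 𝒮 => f.1.locus) ⟨f, hf⟩) ⟨x, hx⟩) h h' ψ.left ψ'.left hψ
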